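/- **Setting.** A rational $G^1$ polygonal surface $\mathcal M$ made up of rectangles and triangles consists of a finite non-empty collection of closed rectangles and (non-degenerate) triangles $\Omega_\ell\subset\mathbb R^2$, $\ell\in K_0$, and a finite collection of gluings $\lambda_e:\tau_e\to\tau'_e$, $e\in K_1$, where $\lambda_e$ is an affine homeomorphism between two polygonal edges; each polygonal edge is glued to at most one other edge and never to itself, and the resulting topological surface is connected. The glued pairs are the interior edges, the other polygonal edges are the boundary edges. A vertex of $\mathcal M$ is a class of identified polygonal vertices; it is a boundary vertex if it lies on a boundary edge, and an interior vertex otherwise. The standard coordinates $(u,v)$ attached to a polygonal edge $\tau$ at its endpoint $P$ are the affine coordinates with origin $P$, $(u,v)=(1,0)$ at the other end of $\tau$, and $(u,v)=(0,1)$ at the other end of the second edge at $P$. For every interior edge, with standard coordinates $(u_1,v_1)$, $(u_2,v_2)$ attached to $\tau_e\subset\Omega_1$, $\tau'_e\subset\Omega_2$ at endpoints matched by $\lambda_e$, an identification of tangent spaces $$\frac{\partial}{\partial u_1}\mapsto\frac{\partial}{\partial u_2},\qquad \frac{\partial}{\partial v_1}\mapsto \beta(u_1)\frac{\partial}{\partial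 u_2}+\gamma(u_1)\frac{\partial}{\partial v_2},\qquad \beta=\frac ba,\quad \gamma=\frac ca,$$ is given, where $a,b,c\in\mathbb R[u_1]$ have no common factor, $a\ne0$ and $\gamma<0$ on $[0,1]$. The same gluing viewed from the other polygon or from the other endpoint has its own $\beta,\gamma$, obtained by the coordinate change. An edge is joining at an end-vertex if $\beta=0$ there, in the standard coordinates at this vertex. A crossing vertex is an interior vertex $\{P_1,\dots,P_4\}$ of valency $4$ at which all four edges are joining. These data satisfy the following conditions. Let $\{P_1,\dots,P_n\}$ be a vertex, $P_k\in\Omega_k$, with edge $\tau_k$ of $\Omega_k$ at $P_k$ glued to the edge $\tau'_{k-1}$ of $\Omega_{k-1}$ at $P_{k-1}$, where $\tau_k,\tau_k'$ are the two edges of the polygon $\Omega_k$ at $P_k$ (cyclically for an interior vertex; for $k=2,\dots,n$ at a boundary vertex, where $\tau_1$, $\tau'_n$ are boundary edges), let $\beta_k,\gamma_k$ be the gluing functions of $\tau_k\to\tau'_{k-1}$ in the standard coordinates with $u_k=0$ at $P_k$, and put $A_k=\begin{pmatrix}0&1\\ \gamma_k(0)&\beta_k(0)\end{pmatrix}$.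 - At an interior vertex, $A_n\cdots A_1=I$, and for $1\le k<n$ the product $A_k\cdots A_1$ has a non-positive entry in each row and on the main diagonal. - At a crossing vertex, moreover, $\beta_1'(0)+\frac{\gamma_2'(0)}{\gamma_2(0)}=-\gamma_1(0)\Bigl(\beta_3'(0)+\frac{\gamma_4'(0)}{\gamma_4(0)}\Bigr)$ and $\beta_2'(0)+\frac{\gamma_3'(0)}{\gamma_3(0)}=-\gamma_2(0)\Bigl(\beta_4'(0)+\frac{\gamma_1'(0)}{\gamma_1(0)}\Bigr)$. - At a boundary vertex with $n\ge2$, for $2\le k\le n$ the product $A_k\cdots A_2$ has a non-positive entry in each row and on the main diagonal, and the bottom row of $A_n\cdots A_2$ is not $(1\ 0)$. For an integer $k\ge0$, $S^1_k(\mathcal M)$ is the real vector space of tuples $(g_\ell)_{\ell\in K_0}$ of polynomial functions on the polygons, of degree $\le k$ on triangles and of bidegree $\le(k,k)$ (in coordinates parallel to the sides) on rectangles, such that for every interior edge $g_1|_{\tau_e}=g_2\circ\lambda_e$ and $\frac{\partial g_1}{\partial v_1}(u,0)=\beta(u)\frac{\partial g_2}{\partial u_2}(u,0)+\gamma(u)\frac{\partial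 g_2}{\partial v_2}(u,0)$ for all $u\in[0,1]$. For an interior edge $\mathcal E$ put $\delta(\mathcal E)=\max(r_1+\deg a,\ \deg b,\ r_2+\deg c)$, where $r_j=1$ if $\Omega_j$ is a rectangle and $r_j=0$ if it is a triangle. Let $N_0$, $N_0^+$, $N_1^\partial$, $N_\Box$, $N_\Delta$ be the numbers of vertices, crossing vertices, boundary edges, rectangles and triangles of $\mathcal M$. **Statement.** Suppose that $\delta(\mathcal E)=1$ for all interior edges $\mathcal E$ of $\mathcal M$, and let $k\ge6$ be an integer. Then $S^1_k(\mathcal M)$ is finite-dimensional and $$\dim S^1_k(\mathcal M)=3N_0+N_0^++(k-2)N_1^\partial+(k+1)\Bigl((k-3)N_\Box+\frac{k-4}{2}N_\Delta\Bigr).$$ -/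

import Mathlib

open Set Polynomial

/-! ### Convex polygons and their directed edges -/

/-- Points, and vectors, of the plane `ℝ²`. -/
abbrev Plane := Fin 2 → ℝ

/-- The determinant of two plane vectors. -/
def planeDet (x y : Plane) : ℝ := x 0 * y 1 - x 1 * y 0

/-- A (non-degenerate) convex polygon with `m + 3` sides, given by its vertices listed
counterclockwise: every vertex that is not an endpoint of the edge from vertex `i` to vertex
`i + 1` lies strictly to the left of this edge. -/
structure ConvexPolygon where
  m : ℕ
  vertex : Fin (m + 3) → Plane
  convex : ∀ i j, j ≠ i → j ≠ i + 1 →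
    0 < planeDet (vertex (i + 1) - vertex i) (vertex j - vertex i)

namespace ConvexPolygon

/-- The closed polygon as a subset of the plane. -/
def carrier (P : ConvexPolygon) : Set Plane := convexHull ℝ (Set.range P.vertex)

def IsTriangle (P : ConvexPolygon) : Prop := P.m = 0

/-- Four sides, and all angles are right angles. -/
def IsRectangle (P : ConvexPolygon) : Prop :=
  P.m = 1 ∧ ∀ i, (P.vertex (i + 1) - P.vertex i) ⬝ᵥ (P.vertex (i + 2) - P.vertex (i + 1)) = 0

open Classical in
/-- `1` for a rectangle, `0` for a triangle. -/
noncomputable def rectIndicator (P : ConvexPolygon) : ℕ := if P.IsRectangle then 1 else 0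

/-- The polynomial `p`, written in the coordinates `(u, v)` with origin at vertex `0` and with
`(u, v) = (1, 0)`, `(0, 1)` at the two neighbouring vertices. On a rectangle `(u, 1 - u)`,
`(v, 1 - v)` are the tensor product coordinates. -/
noncomputable def inCornerCoords (P : ConvexPolygon) :
    MvPolynomial (Fin 2) ℝ →ₐ[ℝ] MvPolynomial (Fin 2) ℝ :=
  MvPolynomial.aeval fun i =>
    MvPolynomial.C (P.vertex 0 i)
      + MvPolynomial.C (P.vertex 1 i - P.vertex 0 i) * MvPolynomial.X 0
      + MvPolynomial.C (P.vertex (-1) i - P.vertex 0 i) * MvPolynomial.X 1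

/-- Degree at most `k` on a triangle, bidegree at most `(k, k)` on a rectangle. -/
def DegreeLE (P : ConvexPolygon) (k : ℕ) (p : MvPolynomial (Fin 2) ℝ) : Prop :=
  (P.IsTriangle → p.totalDegree ≤ k) ∧
  (P.IsRectangle → ∀ j, (P.inCornerCoords p).degreeOf j ≤ k)

end ConvexPolygon

/-- A directed edge of one of the polygons `Ω ℓ`. The edge `i` joins the vertices `i`, `i + 1`;
it is directed from `i` to `i + 1` if `fwd = true`, and from `i + 1` to `i` otherwise. -/
structure Dart {K₀ : Type*} (Ω : K₀ → ConvexPolygon) where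
  poly : K₀
  idx : Fin ((Ω poly).m + 3)
  fwd : Bool

namespace Dart

variable {K₀ : Type*} {Ω : K₀ → ConvexPolygon}

/-- The underlying undirected polygonal edge. -/
def edge (d : Dart Ω) : Σ ℓ, Fin ((Ω ℓ).m + 3) := ⟨d.poly, d.idx⟩

/-- The polygonal vertex at which the directed edge starts. -/
def corner (d : Dart Ω) : Σ ℓ, Fin ((Ω ℓ).m + 3) :=
  ⟨d.poly, if d.fwd then d.idx else d.idx + 1⟩

/-- The same edge, directed oppositely. -/
def rev (d : Dart Ω) : Dart Ω := ⟨d.poly, d.idx, !d.fwd⟩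

/-- The other edge of the polygon at the starting vertex, directed away from this vertex. -/
def other (d : Dart Ω) : Dart Ω :=
  ⟨d.poly, if d.fwd then d.idx - 1 else d.idx + 1, !d.fwd⟩

/-- The position of the starting point. -/
def start (d : Dart Ω) : Plane := (Ω d.poly).vertex (if d.fwd then d.idx else d.idx + 1)

/-- The position of the end point. -/
def finish (d : Dart Ω) : Plane := d.rev.start

/-- The derivative direction `∂/∂u` of the standard coordinate system `(u, v)` attached to the
edge, with `u = 0` at the starting point. -/
def dirU (d : Dart Ω) : Plane := d.finish - d.start

/-- The derivative direction `∂/∂v` of the same coordinate system: it points along the other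
edge at the starting point, and `v = 1` at the end of that edge. -/
def dirV (d : Dart Ω) : Plane := d.other.finish - d.start

/-- The point `(u, v) = (t, 0)` of the edge. -/
def point (d : Dart Ω) (t : ℝ) : Plane := d.start + t • d.dirU

/-- The constant `q` in the change of coordinates described at `revR`. -/
noncomputable def revQ (d : Dart Ω) : ℝ :=
  planeDet d.dirU d.dirV / planeDet d.dirU d.rev.dirV

/-- The two standard coordinate systems attached to an edge are related by
`(u, v) ↦ (1 - u - r v, q v)`, that is, `dirV = r • dirU + q • rev.dirV`. -/
noncomputable def revR (d : Dart Ω) : ℝ :=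
  planeDet d.dirV d.rev.dirV / planeDet d.dirU d.rev.dirV

end Dart

/-! ### Linear `G⁰` polygonal surfaces -/

/-- A linear `G⁰` polygonal surface: polygons `Ω ℓ` (`ℓ ∈ K₀`) with edges glued in pairs
(`e ∈ K₁`) by the affine homeomorphisms that send the directed edge `src e` to the directed
edge `tgt e`. -/
structure LinearG0Surface (K₀ K₁ : Type*) where
  Ω : K₀ → ConvexPolygon
  src : K₁ → Dart Ω
  tgt : K₁ → Dart Ω
  /-- Each polygonal edge is paired with at most one other edge, and never with itself. -/
  paired_once : Function.Injective
    (Sum.elim (fun e => (src e).edge) (fun e => (tgt e).edge))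
  /-- The surface is connected. -/
  nonempty : Nonempty K₀
  connected : ∀ ℓ ℓ', Relation.EqvGen
    (fun p q => ∃ e, p = (src e).poly ∧ q = (tgt e).poly) ℓ ℓ'

/-- A gluing `e ∈ K₁` together with a choice of the side from which it is viewed (`swap`) and of
the direction in which the edge is run through (`back`). -/
structure OrientedGluing (K₁ : Type*) where
  e : K₁
  swap : Bool
  back : Bool

namespace LinearG0Surface

variable {K₀ K₁ : Type*} (M : LinearG0Surface K₀ K₁)

/-- The directed edge from which the oriented gluing starts. -/
def fromDart (h : OrientedGluing K₁) : Dart M.Ω :=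
  let d := if h.swap then M.tgt h.e else M.src h.e
  if h.back then d.rev else d

/-- The directed edge to which the oriented gluing leads. -/
def toDart (h : OrientedGluing K₁) : Dart M.Ω :=
  let d := if h.swap then M.src h.e else M.tgt h.e
  if h.back then d.rev else d

/-- A polygonal edge that is not glued. -/
def IsBoundaryEdge (ε : Σ ℓ, Fin ((M.Ω ℓ).m + 3)) : Prop :=
  ∀ e, ε ≠ (M.src e).edge ∧ ε ≠ (M.tgt e).edge

/-- The vertices of the surface: polygonal vertices up to the identifications by the gluings. -/
def Vertex : Type _ :=
  Quot fun p q : (Σ ℓ, Fin ((M.Ω ℓ).m + 3)) =>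
    ∃ h : OrientedGluing K₁, p = (M.fromDart h).corner ∧ q = (M.toDart h).corner

/-- The vertex of the surface represented by a polygonal vertex. -/
def vertexOf (p : Σ ℓ, Fin ((M.Ω ℓ).m + 3)) : M.Vertex := Quot.mk _ p

/-- A vertex is a boundary vertex if it is on a boundary edge. -/
def IsBoundaryVertex (v : M.Vertex) : Prop :=
  ∃ d : Dart M.Ω, M.IsBoundaryEdge d.edge ∧ M.vertexOf d.corner = v

/-- Consecutive gluings around a vertex: if `h` glues `τ_k ⊂ Ω_k` to `τ'_{k-1} ⊂ Ω_{k-1}`, and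
`h'` glues `τ_{k+1} ⊂ Ω_{k+1}` to `τ'_k ⊂ Ω_k`, then `τ_k`, `τ'_k` are the two edges of the polygon
`Ω_k` at its vertex `P_k`. -/
def Next (h h' : OrientedGluing K₁) : Prop := M.toDart h' = (M.fromDart h).other

/-- `[h₁, …, hₙ]` are the gluings around an interior vertex `{P₁, …, Pₙ}`, where `h_k` glues
`τ_k ⊂ Ω_k` to `τ'_{k-1} ⊂ Ω_{k-1}`, cyclically. -/
def IsInteriorFan (l : List (OrientedGluing K₁)) : Prop :=
  l ≠ [] ∧ (l.map fun h => (M.fromDart h).corner).Nodup ∧ (l ++ l.head?.toList).IsChain M.Next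

/-- `[h₂, …, hₙ]` are the gluings at a boundary vertex `{P₁, …, Pₙ}`, where `h_k` glues
`τ_k ⊂ Ω_k` to `τ'_{k-1} ⊂ Ω_{k-1}`, and the edges `τ₁`, `τ'ₙ` are on the boundary. -/
def IsBoundaryFan (l : List (OrientedGluing K₁)) : Prop :=
  l ≠ [] ∧ l.IsChain M.Next ∧
  (∀ h ∈ l.head?, M.IsBoundaryEdge (M.toDart h).other.edge) ∧
  (∀ h ∈ l.getLast?, M.IsBoundaryEdge (M.fromDart h).other.edge)

/-- `N₀`: the number of vertices. -/
noncomputable def numVertices : ℕ := Nat.card M.Vertex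

/-- `N₁^∂`: the number of boundary edges. -/
noncomputable def numBoundaryEdges : ℕ := Nat.card {ε // M.IsBoundaryEdge ε}

/-- `N_□`: the number of rectangles. -/
noncomputable def numRectangles : ℕ := Nat.card {ℓ // (M.Ω ℓ).IsRectangle}

/-- `N_Δ`: the number of triangles. -/
noncomputable def numTriangles : ℕ := Nat.card {ℓ // (M.Ω ℓ).IsTriangle}

end LinearG0Surface

/-! ### Rational gluing data -/

/-- Polynomials `a, b, c` that represent `β = b / a` and `γ = c / a`. -/
structure GluingTriple where
  a : ℝ[X]
  b : ℝ[X]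
  c : ℝ[X]

namespace GluingTriple

noncomputable def beta (T : GluingTriple) (t : ℝ) : ℝ := T.b.eval t / T.a.eval t

noncomputable def gamma (T : GluingTriple) (t : ℝ) : ℝ := T.c.eval t / T.a.eval t

/-- The same gluing, viewed from the other side: `(β, γ) ↦ (-β / γ, 1 / γ)`. -/
noncomputable def swap (T : GluingTriple) : GluingTriple := ⟨T.c, -T.b, T.a⟩

/-- The same gluing in the coordinates `(1 - uᵢ - rᵢ vᵢ, qᵢ vᵢ)`, `i = 1, 2`:
`β ↦ (r₁ - r₂ γ(1 - u) - β(1 - u)) / q₁`, `γ ↦ (q₂ / q₁) γ(1 - u)`. -/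
noncomputable def back (T : GluingTriple) (q₁ r₁ q₂ r₂ : ℝ) : GluingTriple where
  a := C q₁ * T.a.comp (1 - X)
  b := C r₁ * T.a.comp (1 - X) - C r₂ * T.c.comp (1 - X) - T.b.comp (1 - X)
  c := C q₂ * T.c.comp (1 - X)

end GluingTriple

/-- A linear `G⁰` polygonal surface with a rational identification of tangent spaces along each
glued pair of edges. In the standard coordinates `(u₁, v₁)`, `(u₂, v₂)` attached to the directed
edges `src e`, `tgt e` it is given by `∂/∂u₁ ↦ ∂/∂u₂`,
`∂/∂v₁ ↦ β(u₁) ∂/∂u₂ + γ(u₁) ∂/∂v₂`. -/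
structure RationalGluing (K₀ K₁ : Type*) extends LinearG0Surface K₀ K₁ where
  data : K₁ → GluingTriple

namespace RationalGluing

variable {K₀ K₁ : Type*} (M : RationalGluing K₀ K₁)

/-- The gluing data in the standard coordinates attached to `fromDart h`, `toDart h`. -/
noncomputable def triple (h : OrientedGluing K₁) : GluingTriple :=
  let T := M.data h.e
  let T' := if h.back then
    T.back (M.src h.e).revQ (M.src h.e).revR (M.tgt h.e).revQ (M.tgt h.e).revR else T
  if h.swap then T'.swap else T'

noncomputable def beta (h : OrientedGluing K₁) : ℝ → ℝ := (M.triple h).beta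

noncomputable def gamma (h : OrientedGluing K₁) : ℝ → ℝ := (M.triple h).gamma

/-- The edge is a joining edge at the vertex where `fromDart h` and `toDart h` start. -/
def IsJoining (h : OrientedGluing K₁) : Prop := M.beta h 0 = 0

/-- With `(u_k, v_k)` the standard coordinates at `P_k` attached to `τ_k`, this matrix expresses
`∂/∂u_k`, `∂/∂v_k` in terms of `∂/∂u_{k-1}`, `∂/∂v_{k-1}`. -/
noncomputable def tangentMatrix (h : OrientedGluing K₁) : Matrix (Fin 2) (Fin 2) ℝ :=
  !![0, 1; M.gamma h 0, M.beta h 0]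

/-- The product `A_n ⋯ A_1` of the tangent matrices of `[h₁, …, hₙ]`. -/
noncomputable def fanProduct (l : List (OrientedGluing K₁)) : Matrix (Fin 2) (Fin 2) ℝ :=
  (l.map M.tangentMatrix).reverse.prod

/-- A crossing vertex: an interior vertex of valency four at which all four edges are joining. -/
def IsCrossing (v : M.Vertex) : Prop :=
  ¬ M.IsBoundaryVertex v ∧ Nat.card {p // M.vertexOf p = v} = 4 ∧
  ∀ h : OrientedGluing K₁, M.vertexOf (M.fromDart h).corner = v → M.IsJoining h

/-- `N₀⁺`: the number of crossing vertices. -/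
noncomputable def numCrossing : ℕ := Nat.card {v : M.Vertex // M.IsCrossing v}

/-- `δ` of the interior edge `e`. -/
noncomputable def delta (e : K₁) : ℕ :=
  max (max ((M.Ω (M.src e).poly).rectIndicator + (M.data e).a.natDegree) (M.data e).b.natDegree)
    ((M.Ω (M.tgt e).poly).rectIndicator + (M.data e).c.natDegree)

/-- `G¹` functions: each `g ℓ` extends from the polygon `Ω ℓ` to a `C¹` function on a
neighbourhood, the values match along glued edges, and
`∂g₁/∂v₁ = β(u) ∂g₂/∂u₂ + γ(u) ∂g₂/∂v₂` there. -/
def IsG1Function (g : K₀ → Plane → ℝ) : Prop :=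
  (∀ ℓ, ∃ U, IsOpen U ∧ (M.Ω ℓ).carrier ⊆ U ∧ ContDiffOn ℝ 1 (g ℓ) U) ∧
  ∀ e, ∀ t ∈ Icc (0 : ℝ) 1,
    g (M.src e).poly ((M.src e).point t) = g (M.tgt e).poly ((M.tgt e).point t) ∧
    lineDeriv ℝ (g (M.src e).poly) ((M.src e).point t) (M.src e).dirV =
      (M.data e).beta t *
          lineDeriv ℝ (g (M.tgt e).poly) ((M.tgt e).point t) (M.tgt e).dirU +
        (M.data e).gamma t *
          lineDeriv ℝ (g (M.tgt e).poly) ((M.tgt e).point t) (M.tgt e).dirV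

/-- A non-positive entry in each row and on the main diagonal. -/
def NoOverlap (A : Matrix (Fin 2) (Fin 2) ℝ) : Prop :=
  (∀ i, ∃ j, A i j ≤ 0) ∧ ∃ i, A i i ≤ 0

/-- The condition on the first derivatives of the gluing data around a crossing vertex. -/
def CrossingCondition (h₁ h₂ h₃ h₄ : OrientedGluing K₁) : Prop :=
  deriv (M.beta h₁) 0 + deriv (M.gamma h₂) 0 / M.gamma h₂ 0 =
      -M.gamma h₁ 0 * (deriv (M.beta h₃) 0 + deriv (M.gamma h₄) 0 / M.gamma h₄ 0) ∧
  deriv (M.beta h₂) 0 + deriv (M.gamma h₃) 0 / M.gamma h₃ 0 =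
      -M.gamma h₂ 0 * (deriv (M.beta h₄) 0 + deriv (M.gamma h₁) 0 / M.gamma h₁ 0)

end RationalGluing

/-- A rational `G¹` polygonal surface. -/
structure RationalG1Surface (K₀ K₁ : Type*) extends RationalGluing K₀ K₁ where
  /-- `a, b, c` have no common factor. -/
  coprime : ∀ e p, p ∣ (data e).a → p ∣ (data e).b → p ∣ (data e).c → IsUnit p
  /-- `β` and `γ` are continuous functions on the edge. -/
  denom_ne_zero : ∀ e, ∀ t ∈ Icc (0 : ℝ) 1, (data e).a.eval t ≠ 0
  gamma_neg : ∀ e, ∀ t ∈ Icc (0 : ℝ) 1, (data e).gamma t < 0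
  /-- Around an interior vertex the identifications of tangent spaces compose to the identity. -/
  interior_compat : ∀ l, toRationalGluing.IsInteriorFan l → toRationalGluing.fanProduct l = 1
  /-- At a crossing vertex the mixed derivatives are compatible. -/
  crossing_compat : ∀ h₁ h₂ h₃ h₄, toRationalGluing.IsInteriorFan [h₁, h₂, h₃, h₄] →
    toRationalGluing.IsJoining h₁ → toRationalGluing.IsJoining h₂ →
    toRationalGluing.IsJoining h₃ → toRationalGluing.IsJoining h₄ →
    toRationalGluing.CrossingCondition h₁ h₂ h₃ h₄
  /-- The tangent sectors at an interior vertex do not overlap. -/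
  interior_sectors : ∀ l, toRationalGluing.IsInteriorFan l →
    ∀ l', l' <+: l → l' ≠ [] → l' ≠ l →
      RationalGluing.NoOverlap (toRationalGluing.fanProduct l')
  /-- The tangent sectors at a boundary vertex do not overlap. -/
  boundary_sectors : ∀ l, toRationalGluing.IsBoundaryFan l →
    (∀ l', l' <+: l → l' ≠ [] → RationalGluing.NoOverlap (toRationalGluing.fanProduct l')) ∧
    toRationalGluing.fanProduct l 1 ≠ ![1, 0]

/-! ### Polynomial splines -/

theorem ConvexPolygon.DegreeLE.zero (P : ConvexPolygon) (k : ℕ) : P.DegreeLE k 0 := by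
  simp [ConvexPolygon.DegreeLE]

theorem ConvexPolygon.DegreeLE.add {P : ConvexPolygon} {k : ℕ} {p q : MvPolynomial (Fin 2) ℝ}
    (hp : P.DegreeLE k p) (hq : P.DegreeLE k q) : P.DegreeLE k (p + q) := by
  refine ⟨fun h => (MvPolynomial.totalDegree_add _ _).trans (max_le (hp.1 h) (hq.1 h)),
    fun h j => ?_⟩
  rw [map_add]
  exact (MvPolynomial.degreeOf_add_le _ _ _).trans (max_le (hp.2 h j) (hq.2 h j))

theorem ConvexPolygon.DegreeLE.smul {P : ConvexPolygon} {k : ℕ} {p : MvPolynomial (Fin 2) ℝ}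
    (c : ℝ) (hp : P.DegreeLE k p) : P.DegreeLE k (c • p) := by
  refine ⟨fun h => (MvPolynomial.totalDegree_smul_le _ _).trans (hp.1 h), fun h j => ?_⟩
  rw [map_smul, MvPolynomial.smul_eq_C_mul]
  exact (MvPolynomial.degreeOf_C_mul_le _ _ _).trans (hp.2 h j)

theorem contDiff_mvPolynomial_eval (p : MvPolynomial (Fin 2) ℝ) :
    ContDiff ℝ 1 fun x : Plane => MvPolynomial.eval x p := by
  induction p using MvPolynomial.induction_on with
  | C a => simpa using contDiff_const
  | add p q hp hq =>
    simp only [map_add]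
    exact hp.add hq
  | mul_X p i hp =>
    simp only [map_mul, MvPolynomial.eval_X]
    exact hp.mul (contDiff_apply ℝ ℝ i)

theorem differentiable_mvPolynomial_eval (p : MvPolynomial (Fin 2) ℝ) :
    Differentiable ℝ fun x : Plane => MvPolynomial.eval x p :=
  (contDiff_mvPolynomial_eval p).differentiable one_ne_zero

theorem lineDeriv_mvPolynomial_add (p q : MvPolynomial (Fin 2) ℝ) (x v : Plane) :
    lineDeriv ℝ (fun y : Plane => MvPolynomial.eval y (p + q)) x v =
      lineDeriv ℝ (fun y : Plane => MvPolynomial.eval y p) x v +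
        lineDeriv ℝ (fun y : Plane => MvPolynomial.eval y q) x v := by
  have hp := differentiable_mvPolynomial_eval p x
  have hq := differentiable_mvPolynomial_eval q x
  have hpq := differentiable_mvPolynomial_eval (p + q) x
  rw [hp.lineDeriv_eq_fderiv, hq.lineDeriv_eq_fderiv, hpq.lineDeriv_eq_fderiv]
  simp only [map_add]
  rw [fderiv_fun_add hp hq]
  rfl

theorem lineDeriv_mvPolynomial_smul (c : ℝ) (p : MvPolynomial (Fin 2) ℝ) (x v : Plane) :
    lineDeriv ℝ (fun y : Plane => MvPolynomial.eval y (c • p)) x v =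
      c * lineDeriv ℝ (fun y : Plane => MvPolynomial.eval y p) x v := by
  have hp := differentiable_mvPolynomial_eval p x
  have hcp := differentiable_mvPolynomial_eval (c • p) x
  rw [hp.lineDeriv_eq_fderiv, hcp.lineDeriv_eq_fderiv]
  simp only [MvPolynomial.smul_eval]
  rw [fderiv_const_mul hp]
  rfl

namespace RationalGluing

variable {K₀ K₁ : Type*} (M : RationalGluing K₀ K₁)

/-- The space `S¹_k(M)` of polynomial `G¹` splines: tuples of polynomial functions on the polygons,
of degree at most `k` on triangles and of bidegree at most `(k, k)` on rectangles, that form a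
`G¹` function. (A polynomial function on a polygon determines the polynomial.) -/
def splineSpace (k : ℕ) : Submodule ℝ (K₀ → MvPolynomial (Fin 2) ℝ) where
  carrier := {p | (∀ ℓ, (M.Ω ℓ).DegreeLE k (p ℓ)) ∧
    M.IsG1Function fun ℓ x => MvPolynomial.eval x (p ℓ)}
  zero_mem' := by
    refine ⟨fun ℓ => ConvexPolygon.DegreeLE.zero _ _, fun ℓ => ⟨univ, isOpen_univ,
      subset_univ _, (contDiff_mvPolynomial_eval _).contDiffOn⟩, fun e t _ => ?_⟩
    simp [lineDeriv]
  add_mem' := by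
    intro p q hp hq
    refine ⟨fun ℓ => (hp.1 ℓ).add (hq.1 ℓ), fun ℓ => ⟨univ, isOpen_univ,
      subset_univ _, (contDiff_mvPolynomial_eval _).contDiffOn⟩, fun e t ht => ⟨?_, ?_⟩⟩
    · have h1 := (hp.2.2 e t ht).1
      have h2 := (hq.2.2 e t ht).1
      simp only [Pi.add_apply, map_add] at h1 h2 ⊢
      rw [h1, h2]
    · have h1 := (hp.2.2 e t ht).2
      have h2 := (hq.2.2 e t ht).2
      simp only [Pi.add_apply, lineDeriv_mvPolynomial_add] at h1 h2 ⊢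
      rw [h1, h2]
      ring
  smul_mem' := by
    intro c p hp
    refine ⟨fun ℓ => (hp.1 ℓ).smul c, fun ℓ => ⟨univ, isOpen_univ,
      subset_univ _, (contDiff_mvPolynomial_eval _).contDiffOn⟩, fun e t ht => ⟨?_, ?_⟩⟩
    · have h1 := (hp.2.2 e t ht).1
      simp only [Pi.smul_apply, MvPolynomial.smul_eval] at h1 ⊢
      rw [h1]
    · have h1 := (hp.2.2 e t ht).2
      simp only [Pi.smul_apply, lineDeriv_mvPolynomial_smul] at h1 ⊢
      rw [h1]
      ring

end RationalGluing

/-! Multiplying the derivative condition by `a` turns the G¹ conditions along an edge into two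
polynomial equations W = 0 and V = 0, where W = g₁ - g₂ and V = a ∂g₁/∂v₁ - b ∂g₂/∂u₂ - c ∂g₂/∂v₂ on
the edge. So the spline space is the kernel of a linear map `gap` from all tuples of polynomials to
pairs (W, V) (`splineSpace_eq`), and δ = 1 guarantees that W and V have degree at most k
(`gap_mem_edgeSpace`). This map need not be onto, but its cokernel is visible at the end points of
the edges.

To measure it, `gap` is compared with a corner problem that does not depend on k. At each polygonal
corner take the value, the gradient and the mixed derivative (`cornerJets`); at each end of each
edge take W, W', V and, if the edge is joining there, V' (`edgeJet`). These form a commutative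
square with `gap` and `cornerGap`. Both jet maps are onto, and every (W, V) with zero end data is in
the image of `gap` (`mem_map_gap`): it is produced edge by edge by polynomials that vanish doubly on
all other sides. The one-variable problem behind this (`exists_edge_data`) is where coprimality and
k ≥ 6 enter; at an end that is not joining, V' is adjusted freely because the numerator of β is
non-zero there. A diagram chase (`Submodule.finrank_inf_ker_add`) then expresses the dimension
through that of the kernel of the corner problem.

In the corner problem, matching values and gradients amount to one value and one covector for each
vertex: the directed edges at a vertex form an orbit of a dihedral group generated by `other` and
`glue`, and covectors are transported along it without monodromy, by A_n ⋯ A_1 = I at an interior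
vertex and because the orbit is a path at a boundary vertex (`exists_section`). The mixed
derivatives are still free, one for each corner. Every joining end imposes one linear condition on
them. These conditions are independent (`mixedGap_surjective`), except that at a crossing vertex
they close up to a cycle of four, and one of them follows from the other three by the crossing
condition (`cornerGap_omitted`). Hence the kernel has dimension 3N₀ + #corners - #joining ends +
N₀⁺.

The joining ends cancel in the final count, and the number of gluings is eliminated by counting the
sides of the polygons. -/

open scoped Matrix

/-! ### Directional derivatives and restriction of polynomials to lines -/

/-- The derivative of a polynomial in two variables in the direction `w`. -/
noncomputable def dirDeriv (w : Plane) :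
    Derivation ℝ (MvPolynomial (Fin 2) ℝ) (MvPolynomial (Fin 2) ℝ) :=
  w 0 • MvPolynomial.pderiv 0 + w 1 • MvPolynomial.pderiv 1

theorem dirDeriv_apply (w : Plane) (p : MvPolynomial (Fin 2) ℝ) :
    dirDeriv w p = w 0 • MvPolynomial.pderiv 0 p + w 1 • MvPolynomial.pderiv 1 p := rfl

theorem dirDeriv_X (w : Plane) (i : Fin 2) :
    dirDeriv w (MvPolynomial.X i) = MvPolynomial.C (w i) := by
  fin_cases i <;> simp [dirDeriv_apply, MvPolynomial.pderiv_X, MvPolynomial.smul_eq_C_mul]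

theorem dirDeriv_C (w : Plane) (a : ℝ) : dirDeriv w (MvPolynomial.C a) = 0 := by
  simp [dirDeriv]

theorem dirDeriv_add_dir (v w : Plane) (p : MvPolynomial (Fin 2) ℝ) :
    dirDeriv (v + w) p = dirDeriv v p + dirDeriv w p := by
  simp only [dirDeriv_apply, Pi.add_apply, add_smul]; abel

theorem dirDeriv_smul_dir (a : ℝ) (w : Plane) (p : MvPolynomial (Fin 2) ℝ) :
    dirDeriv (a • w) p = a • dirDeriv w p := by
  simp only [dirDeriv_apply, Pi.smul_apply, smul_eq_mul, mul_smul, smul_add]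

theorem dirDeriv_comm (v w : Plane) (p : MvPolynomial (Fin 2) ℝ) :
    dirDeriv v (dirDeriv w p) = dirDeriv w (dirDeriv v p) := by
  induction p using MvPolynomial.induction_on with
  | C a => simp
  | add p q hp hq => simp only [map_add, hp, hq]
  | mul_X p i hp =>
    simp only [Derivation.leibniz, map_add, smul_eq_mul, dirDeriv_X, dirDeriv_C, hp]
    ring

/-- The polynomial `t ↦ p (x + t w)`. -/
noncomputable def restrictLine (x w : Plane) : MvPolynomial (Fin 2) ℝ →ₐ[ℝ] ℝ[X] :=
  MvPolynomial.aeval fun i => C (x i) + C (w i) * X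

theorem restrictLine_X (x w : Plane) (i : Fin 2) :
    restrictLine x w (MvPolynomial.X i) = C (x i) + C (w i) * X := by
  simp [restrictLine]

theorem restrictLine_C (x w : Plane) (a : ℝ) : restrictLine x w (MvPolynomial.C a) = C a := by
  simp [restrictLine]

theorem eval_restrictLine (x w : Plane) (t : ℝ) (p : MvPolynomial (Fin 2) ℝ) :
    (restrictLine x w p).eval t = MvPolynomial.eval (x + t • w) p := by
  induction p using MvPolynomial.induction_on with
  | C a => simp [restrictLine_C]
  | add p q hp hq => simp only [map_add, eval_add, hp, hq]
  | mul_X p i hp =>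
    simp only [map_mul, eval_mul, hp, restrictLine_X, MvPolynomial.eval_X, eval_add, eval_C,
      eval_X, Pi.add_apply, Pi.smul_apply, smul_eq_mul]
    ring

theorem derivative_restrictLine (x w : Plane) (p : MvPolynomial (Fin 2) ℝ) :
    derivative (restrictLine x w p) = restrictLine x w (dirDeriv w p) := by
  induction p using MvPolynomial.induction_on with
  | C a => rw [restrictLine_C, dirDeriv_C, derivative_C, map_zero]
  | add p q hp hq => simp only [map_add, hp, hq]
  | mul_X p i hp =>
    simp only [map_mul, derivative_mul, hp, restrictLine_X, Derivation.leibniz, map_add,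
      smul_eq_mul, dirDeriv_X, restrictLine_C, derivative_C, derivative_X]
    ring

/-- Replaces the analytic derivative in the definition of G¹ functions by the algebraic one. -/
theorem lineDeriv_eval (x w : Plane) (p : MvPolynomial (Fin 2) ℝ) :
    lineDeriv ℝ (fun y : Plane => MvPolynomial.eval y p) x w =
      MvPolynomial.eval x (dirDeriv w p) := by
  have h : (fun t : ℝ => MvPolynomial.eval (x + t • w) p) =
      fun t => (restrictLine x w p).eval t := by
    funext t; rw [eval_restrictLine]
  rw [lineDeriv, h, Polynomial.deriv, derivative_restrictLine, eval_restrictLine]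
  simp

theorem restrictLine_comp (x w : Plane) (p : MvPolynomial (Fin 2) ℝ) :
    (restrictLine x w p).comp (1 - X) = restrictLine (x + w) (-w) p := by
  apply Polynomial.funext
  intro t
  simp only [eval_comp, eval_restrictLine, eval_sub, eval_one, eval_X]
  rw [show x + (1 - t) • w = x + w + t • -w by module]

/-! ### Degrees -/

/-- The degree lost here is what lets `a` or `c` be linear when the adjacent polygon is a triangle.
-/
theorem totalDegree_pderiv_le {k : ℕ} {p : MvPolynomial (Fin 2) ℝ} (hp : p.totalDegree ≤ k)
    (i : Fin 2) : (MvPolynomial.pderiv i p).totalDegree ≤ k - 1 := by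
  rw [p.as_sum, map_sum]
  refine MvPolynomial.totalDegree_finsetSum_le fun s hs => ?_
  rw [MvPolynomial.pderiv_monomial]
  by_cases h0 : s i = 0
  · simp [h0]
  · refine (MvPolynomial.totalDegree_monomial_le _ _).trans ?_
    have h1 := (MvPolynomial.le_totalDegree hs).trans hp
    have h2 : (s - Finsupp.single i 1).sum (fun _ e => e) + 1 = s.sum fun _ e => e := by
      conv_rhs => rw [← tsub_add_cancel_of_le (show Finsupp.single i 1 ≤ s by
        rw [Finsupp.single_le_iff]; omega)]
      rw [Finsupp.sum_add_index' (by simp) (by simp)]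
      simp
    simp only [Function.id_def]
    omega

/-- No degree is gained: a derivative transverse to a side of a rectangle may keep degree k along
the side. This accounts for the summand r_j in δ. -/
theorem degreeOf_pderiv_le {k : ℕ} {p : MvPolynomial (Fin 2) ℝ} {j : Fin 2}
    (hp : p.degreeOf j ≤ k) (i : Fin 2) : (MvPolynomial.pderiv i p).degreeOf j ≤ k := by
  rw [p.as_sum, map_sum]
  refine (MvPolynomial.degreeOf_sum_le _ _ _).trans (Finset.sup_le fun s hs => ?_)
  rw [MvPolynomial.pderiv_monomial]
  refine (MvPolynomial.degreeOf_le_iff.2 fun m hm => ?_)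
  have := MvPolynomial.support_monomial_subset hm
  rw [Finset.mem_singleton] at this
  subst this
  have := (MvPolynomial.degreeOf_le_iff.1 hp) s hs
  simp only [Finsupp.coe_tsub, Pi.sub_apply]
  omega

theorem natDegree_aeval_le_totalDegree {g : Fin 2 → ℝ[X]} (hg : ∀ i, (g i).natDegree ≤ 1)
    (p : MvPolynomial (Fin 2) ℝ) : (MvPolynomial.aeval g p).natDegree ≤ p.totalDegree := by
  rw [MvPolynomial.aeval_def, MvPolynomial.eval₂_eq']
  refine natDegree_sum_le_of_forall_le _ _ fun s hs => ?_
  refine (natDegree_C_mul_le _ _).trans ((natDegree_prod_le _ _).trans ?_)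
  refine le_trans ?_ (MvPolynomial.le_totalDegree hs)
  rw [Finsupp.sum_fintype _ _ (by simp)]
  refine Finset.sum_le_sum fun i _ => natDegree_pow_le.trans ?_
  nlinarith [hg i, Nat.zero_le (s i)]

/-- Applied to the corner coordinates restricted to a side of a rectangle. One of them is constant
there, so the bound is k and not 2k. -/
theorem natDegree_aeval_le_degreeOf {k : ℕ} {g : Fin 2 → ℝ[X]}
    {p : MvPolynomial (Fin 2) ℝ} (hp : ∀ j, p.degreeOf j ≤ k) :
    (MvPolynomial.aeval g p).natDegree ≤ k * ((g 0).natDegree + (g 1).natDegree) := by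
  rw [MvPolynomial.aeval_def, MvPolynomial.eval₂_eq']
  refine natDegree_sum_le_of_forall_le _ _ fun s hs => ?_
  refine (natDegree_C_mul_le _ _).trans ((natDegree_prod_le _ _).trans ?_)
  rw [Fin.sum_univ_two, mul_add]
  exact add_le_add
    (natDegree_pow_le.trans (Nat.mul_le_mul_right _ ((MvPolynomial.degreeOf_le_iff.1 (hp 0)) s hs)))
    (natDegree_pow_le.trans (Nat.mul_le_mul_right _ ((MvPolynomial.degreeOf_le_iff.1 (hp 1)) s hs)))

/-! ### Affine forms -/

/-- The affine form `x ↦ c + n₀ x₀ + n₁ x₁`. -/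
noncomputable def affineForm (c : ℝ) (n : Plane) : MvPolynomial (Fin 2) ℝ :=
  MvPolynomial.C c + MvPolynomial.C (n 0) * MvPolynomial.X 0
    + MvPolynomial.C (n 1) * MvPolynomial.X 1

theorem eval_affineForm (c : ℝ) (n x : Plane) :
    MvPolynomial.eval x (affineForm c n) = c + n 0 * x 0 + n 1 * x 1 := by
  simp [affineForm]

theorem dirDeriv_affineForm (c : ℝ) (n w : Plane) :
    dirDeriv w (affineForm c n) = MvPolynomial.C (n 0 * w 0 + n 1 * w 1) := by
  simp only [affineForm, map_add, Derivation.leibniz, dirDeriv_C, dirDeriv_X, smul_eq_mul,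
    mul_zero, add_zero, zero_add, map_mul]

theorem restrictLine_affineForm (c : ℝ) (n x w : Plane) :
    restrictLine x w (affineForm c n) =
      C (c + n 0 * x 0 + n 1 * x 1) + C (n 0 * w 0 + n 1 * w 1) * X := by
  simp only [affineForm, map_add, map_mul, restrictLine_C, restrictLine_X]
  ring

theorem totalDegree_affineForm_le (c : ℝ) (n : Plane) : (affineForm c n).totalDegree ≤ 1 := by
  have h : ∀ i, (MvPolynomial.C (n i) * MvPolynomial.X i :
      MvPolynomial (Fin 2) ℝ).totalDegree ≤ 1 := fun i =>
    (MvPolynomial.totalDegree_mul _ _).trans (by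
      rw [MvPolynomial.totalDegree_C, MvPolynomial.totalDegree_X])
  refine (MvPolynomial.totalDegree_add _ _).trans (max_le ?_ (h 1))
  refine (MvPolynomial.totalDegree_add _ _).trans (max_le ?_ (h 0))
  simp

theorem one_sub_affineForm (c : ℝ) (n : Plane) :
    1 - affineForm c n = affineForm (1 - c) (-n) := by
  simp only [affineForm, map_sub, map_one, Pi.neg_apply, map_neg]
  ring

theorem affineForm_add (c c' : ℝ) (n n' : Plane) :
    affineForm c n + affineForm c' n' = affineForm (c + c') (n + n') := by
  simp only [affineForm, map_add, Pi.add_apply]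
  ring

/-! ### Dimensions of spaces of polynomials in two variables -/

theorem finrank_restrictDegree (k : ℕ) :
    Module.finrank ℝ (MvPolynomial.restrictDegree (Fin 2) ℝ k) = (k + 1) ^ 2 := by
  rw [MvPolynomial.restrictDegree,
    Module.finrank_eq_nat_card_basis (MvPolynomial.basisRestrictSupport ℝ _)]
  have e : ({n : Fin 2 →₀ ℕ | ∀ i, n i ≤ k} : Set (Fin 2 →₀ ℕ)) ≃ (Fin 2 → Fin (k + 1)) :=
    { toFun := fun n i => ⟨n.1 i, Nat.lt_succ_of_le (n.2 i)⟩
      invFun := fun f => ⟨Finsupp.equivFunOnFinite.symm fun i => f i, fun i => by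
        simpa using Nat.le_of_lt_succ (f i).2⟩
      left_inv := fun n => by ext; simp
      right_inv := fun f => by ext; simp }
  rw [Nat.card_congr e]
  simp

/-- Exponents are sorted by their total degree i, with i + 1 of them in each degree. The factor 2
avoids division in ℕ. -/
theorem finrank_restrictTotalDegree (k : ℕ) :
    2 * Module.finrank ℝ (MvPolynomial.restrictTotalDegree (Fin 2) ℝ k) = (k + 1) * (k + 2) := by
  rw [MvPolynomial.restrictTotalDegree,
    Module.finrank_eq_nat_card_basis (MvPolynomial.basisRestrictSupport ℝ _)]
  have e : ({n : Fin 2 →₀ ℕ | (n.sum fun _ e => e) ≤ k} : Set (Fin 2 →₀ ℕ)) ≃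
      (Σ i : Fin (k + 1), Fin (i + 1)) :=
    { toFun := fun n => ⟨⟨n.1 0 + n.1 1, by
          have := n.2
          rw [Set.mem_ofPred_eq, Finsupp.sum_fintype _ _ (by simp), Fin.sum_univ_two] at this
          omega⟩, ⟨n.1 0, by simp⟩⟩
      invFun := fun f => ⟨Finsupp.equivFunOnFinite.symm ![f.2, f.1 - f.2], by
        have h1 := f.1.2
        have h2 := f.2.2
        rw [Set.mem_ofPred_eq, Finsupp.sum_fintype _ _ (by simp), Fin.sum_univ_two]
        simp
        omega⟩
      left_inv := fun n => by
        ext i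
        fin_cases i <;> simp
      right_inv := fun f => by
        obtain ⟨⟨a, ha⟩, ⟨b, hb⟩⟩ := f
        have hb' : b < a + 1 := hb
        have : b + (a - b) = a := by omega
        simp only [Finsupp.equivFunOnFinite_symm_apply_apply, Matrix.cons_val_zero,
          Matrix.cons_val_one]
        refine Sigma.ext (Fin.ext this) ?_
        refine (Fin.heq_ext_iff ?_).2 rfl
        simp [this] }
  rw [Nat.card_congr e, Nat.card_sigma]
  simp only [Nat.card_eq_fintype_card, Fintype.card_fin]
  rw [Fin.sum_univ_eq_sum_range (fun i => i + 1) (k + 1)]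
  have := Finset.sum_range_id_mul_two (k + 2)
  rw [Finset.sum_range_succ'] at this
  simp only [add_zero, Nat.add_one_sub_one, show k + 2 - 1 = k + 1 from rfl] at this
  linarith

/-! ### Convex polygons, triangles and rectangles -/

/-- Cramer's rule. -/
theorem plane_eq_add (x u w : Plane) (h : planeDet u w ≠ 0) :
    x = (planeDet x w / planeDet u w) • u + (planeDet u x / planeDet u w) • w := by
  ext i
  simp only [Pi.add_apply, Pi.smul_apply, smul_eq_mul]
  rw [div_mul_eq_mul_div, div_mul_eq_mul_div, ← add_div, eq_div_iff h]
  fin_cases i <;> simp [planeDet] <;> ring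

namespace ConvexPolygon

theorem add_two_ne (P : ConvexPolygon) (i : Fin (P.m + 3)) : i + 1 + 1 ≠ i ∧ i + 1 + 1 ≠ i + 1 := by
  obtain ⟨m, -, -⟩ := P
  constructor
  · intro h
    have : (1 + 1 : Fin (m + 3)) = 0 := by simpa [add_assoc] using h
    have h2 : (2 : ℕ) % (m + 3) = 0 := by simpa [Fin.ext_iff, Fin.val_add] using this
    rw [Nat.mod_eq_of_lt (by omega)] at h2
    omega
  · intro h
    simp at h

theorem sub_one_ne (P : ConvexPolygon) (i : Fin (P.m + 3)) : i - 1 ≠ i ∧ i - 1 ≠ i + 1 := by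
  have h := P.add_two_ne (i - 1)
  simp only [sub_add_cancel] at h
  exact ⟨fun e => by simp at e, fun e => h.1 e.symm⟩

theorem IsTriangle.cases_eq {P : ConvexPolygon} (hP : P.IsTriangle) (i j : Fin (P.m + 3)) :
    (j = i ∨ j = i + 1 ∨ j = i - 1) ∧ i + 1 + 1 = i - 1 ∧ i - 1 - 1 = i + 1 := by
  have key : ∀ m (_ : m = 0) (i j : Fin (m + 3)),
      (j = i ∨ j = i + 1 ∨ j = i - 1) ∧ i + 1 + 1 = i - 1 ∧ i - 1 - 1 = i + 1 := by
    rintro m rfl; decide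
  exact key P.m hP i j

theorem IsRectangle.cases_eq {P : ConvexPolygon} (hP : P.IsRectangle) (i j : Fin (P.m + 3)) :
    (j = i ∨ j = i + 1 ∨ j = i - 1 ∨ j = i + 1 + 1) ∧ i + 1 + 1 + 1 = i - 1 ∧
      i - 1 - 1 = i + 1 + 1 ∧ i + 2 = i + 1 + 1 := by
  have key : ∀ m (_ : m = 1) (i j : Fin (m + 3)),
      (j = i ∨ j = i + 1 ∨ j = i - 1 ∨ j = i + 1 + 1) ∧ i + 1 + 1 + 1 = i - 1 ∧
        i - 1 - 1 = i + 1 + 1 ∧ i + 2 = i + 1 + 1 := by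
    rintro m rfl; decide
  exact key P.m hP.1 i j

theorem IsTriangle.not_isRectangle {P : ConvexPolygon} (hP : P.IsTriangle) : ¬ P.IsRectangle :=
  fun h => by
    have h0 : P.m = 0 := hP
    have h1 : P.m = 1 := h.1
    omega

theorem IsRectangle.not_isTriangle {P : ConvexPolygon} (hP : P.IsRectangle) : ¬ P.IsTriangle :=
  fun h => h.not_isRectangle hP

/-- A rectangle is a parallelogram. -/
theorem IsRectangle.vertex_add_two {P : ConvexPolygon} (hP : P.IsRectangle)
    (i : Fin (P.m + 3)) :
    P.vertex (i + 1 + 1) = P.vertex (i + 1) + P.vertex (i - 1) - P.vertex i := by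
  have hc := fun j => (hP.cases_eq j j).2
  have h0 := hP.2 i
  have h1 := hP.2 (i + 1)
  have h3 := hP.2 (i - 1)
  have hdet := P.convex i (i + 1 + 1) (P.add_two_ne i).1 (P.add_two_ne i).2
  rw [(hc _).2.2] at h0 h1 h3
  rw [(hc i).1] at h1
  rw [sub_add_cancel] at h3
  simp only [dotProduct, Fin.sum_univ_two, Pi.sub_apply, planeDet] at h0 h1 h3 hdet
  generalize P.vertex i = a at *
  generalize P.vertex (i + 1) = b at *
  generalize P.vertex (i + 1 + 1) = c at *
  generalize P.vertex (i - 1) = d at *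
  -- The defect a - b + c - d is orthogonal to two adjacent sides; these are independent by `hdet`,
  -- so it vanishes.
  have e1 : (c 0 - d 0 + a 0 - b 0) * (b 0 - a 0) + (c 1 - d 1 + a 1 - b 1) * (b 1 - a 1) = 0 := by
    linarith
  have e2 : (c 0 - d 0 + a 0 - b 0) * (c 0 - b 0) + (c 1 - d 1 + a 1 - b 1) * (c 1 - b 1) = 0 := by
    linarith
  have z0 : c 0 - d 0 + a 0 - b 0 = 0 := by
    apply (mul_eq_zero.1 _).resolve_right hdet.ne'
    linear_combination (c 1 - a 1) * e1 - (b 1 - a 1) * e1 - (b 1 - a 1) * e2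
  have z1 : c 1 - d 1 + a 1 - b 1 = 0 := by
    apply (mul_eq_zero.1 _).resolve_right hdet.ne'
    linear_combination (b 0 - a 0) * e2 - (c 0 - b 0) * e1
  ext j
  fin_cases j
  · simp; linarith
  · simp; linarith

end ConvexPolygon

namespace Dart

variable {K₀ : Type*} {Ω : K₀ → ConvexPolygon}

section Mk

variable (ℓ : K₀) (i : Fin ((Ω ℓ).m + 3))

theorem mk_other_true : (⟨ℓ, i, true⟩ : Dart Ω).other = ⟨ℓ, i - 1, false⟩ := rfl
theorem mk_other_false : (⟨ℓ, i, false⟩ : Dart Ω).other = ⟨ℓ, i + 1, true⟩ := rfl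
theorem mk_rev (b : Bool) : (⟨ℓ, i, b⟩ : Dart Ω).rev = ⟨ℓ, i, !b⟩ := rfl
theorem mk_corner_true : (⟨ℓ, i, true⟩ : Dart Ω).corner = ⟨ℓ, i⟩ := rfl
theorem mk_corner_false : (⟨ℓ, i, false⟩ : Dart Ω).corner = ⟨ℓ, i + 1⟩ := rfl
theorem mk_start_true : (⟨ℓ, i, true⟩ : Dart Ω).start = (Ω ℓ).vertex i := rfl
theorem mk_start_false : (⟨ℓ, i, false⟩ : Dart Ω).start = (Ω ℓ).vertex (i + 1) := rfl
theorem mk_dirU_true :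
    (⟨ℓ, i, true⟩ : Dart Ω).dirU = (Ω ℓ).vertex (i + 1) - (Ω ℓ).vertex i := rfl
theorem mk_dirU_false :
    (⟨ℓ, i, false⟩ : Dart Ω).dirU = (Ω ℓ).vertex i - (Ω ℓ).vertex (i + 1) := rfl
theorem mk_dirV_true :
    (⟨ℓ, i, true⟩ : Dart Ω).dirV = (Ω ℓ).vertex (i - 1) - (Ω ℓ).vertex i := rfl
theorem mk_dirV_false :
    (⟨ℓ, i, false⟩ : Dart Ω).dirV = (Ω ℓ).vertex (i + 1 + 1) - (Ω ℓ).vertex (i + 1) := rfl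

end Mk

@[simp] theorem rev_rev (d : Dart Ω) : d.rev.rev = d := by
  obtain ⟨ℓ, i, b⟩ := d; simp [rev]

@[simp] theorem other_other (d : Dart Ω) : d.other.other = d := by
  obtain ⟨ℓ, i, b⟩ := d; cases b
  · rw [mk_other_false, mk_other_true, add_sub_cancel_right]
  · rw [mk_other_true, mk_other_false, sub_add_cancel]

theorem other_corner (d : Dart Ω) : d.other.corner = d.corner := by
  obtain ⟨ℓ, i, b⟩ := d; cases b
  · rfl
  · rw [mk_other_true, mk_corner_false, sub_add_cancel, mk_corner_true]

theorem other_start (d : Dart Ω) : d.other.start = d.start := by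
  obtain ⟨ℓ, i, b⟩ := d; cases b
  · rfl
  · rw [mk_other_true, mk_start_false, sub_add_cancel, mk_start_true]

theorem other_dirU (d : Dart Ω) : d.other.dirU = d.dirV := by
  rw [dirU, dirV, other_start]

theorem other_dirV (d : Dart Ω) : d.other.dirV = d.dirU := by
  rw [dirU, dirV, other_start, other_other]

theorem other_ne (d : Dart Ω) : d.other ≠ d := by
  obtain ⟨ℓ, i, b⟩ := d; cases b <;> simp [other]

theorem rev_start (d : Dart Ω) : d.rev.start = d.start + d.dirU := by
  simp [dirU, finish]

theorem rev_dirU (d : Dart Ω) : d.rev.dirU = -d.dirU := by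
  simp [dirU, finish]

/-- Thus passing from a corner to a directed edge loses only the action of `other`, and vertices of
the surface can be studied as orbits of directed edges. -/
theorem eq_or_eq_other {d d' : Dart Ω} (h : d'.corner = d.corner) : d' = d ∨ d' = d.other := by
  obtain ⟨ℓ, i, b⟩ := d
  obtain ⟨ℓ', i', b'⟩ := d'
  simp only [corner, Sigma.mk.injEq] at h
  obtain ⟨rfl, h⟩ := h
  have h := eq_of_heq h
  cases b <;> cases b' <;> simp [other] at h ⊢ <;> subst h <;> simp

/-- Strict convexity, applied to the two neighbours of the edge: the standard coordinates at either
end are genuine affine coordinates. -/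
theorem dirU_det_ne_zero (d : Dart Ω) :
    planeDet d.dirU d.dirV ≠ 0 ∧ planeDet d.dirU d.rev.dirV ≠ 0 := by
  obtain ⟨ℓ, i, b⟩ := d
  have h1 := (Ω ℓ).convex i (i + 1 + 1) ((Ω ℓ).add_two_ne i).1 ((Ω ℓ).add_two_ne i).2
  have h2 := (Ω ℓ).convex i (i - 1) ((Ω ℓ).sub_one_ne i).1 ((Ω ℓ).sub_one_ne i).2
  cases b <;> simp only [mk_rev, mk_dirU_true, mk_dirU_false, mk_dirV_true,
    mk_dirV_false, Bool.not_true, Bool.not_false, planeDet, Pi.sub_apply] at h1 h2 ⊢ <;> constructor <;> intro h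
  · apply h1.ne'; linear_combination -h
  · apply h2.ne'; linear_combination -h
  · apply h2.ne'; linear_combination h
  · apply h1.ne'; linear_combination h

theorem dirV_eq (d : Dart Ω) : d.dirV = d.revR • d.dirU + d.revQ • d.rev.dirV :=
  plane_eq_add _ _ _ d.dirU_det_ne_zero.2

/-- The coordinate `u` of the standard coordinates `(u, v)`, as a polynomial function; the
coordinate `v` is `d.other.coordU`. -/
noncomputable def coordU (d : Dart Ω) : MvPolynomial (Fin 2) ℝ :=
  affineForm ((d.start 1 * d.dirV 0 - d.start 0 * d.dirV 1) / planeDet d.dirU d.dirV)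
    ![d.dirV 1 / planeDet d.dirU d.dirV, -d.dirV 0 / planeDet d.dirU d.dirV]

theorem eval_coordU (d : Dart Ω) (x : Plane) :
    MvPolynomial.eval x d.coordU = planeDet (x - d.start) d.dirV / planeDet d.dirU d.dirV := by
  rw [coordU, eval_affineForm]
  simp only [planeDet, Matrix.cons_val_zero, Matrix.cons_val_one, Pi.sub_apply]
  ring

theorem eval_other_coordU (d : Dart Ω) (x : Plane) :
    MvPolynomial.eval x d.other.coordU =
      planeDet d.dirU (x - d.start) / planeDet d.dirU d.dirV := by
  rw [eval_coordU, other_start, other_dirU, other_dirV,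
    show planeDet d.dirV d.dirU = - planeDet d.dirU d.dirV by simp only [planeDet]; ring,
    show planeDet (x - d.start) d.dirU = - planeDet d.dirU (x - d.start) by
      simp only [planeDet]; ring, neg_div_neg_eq]

theorem dirDeriv_coordU (d : Dart Ω) (w : Plane) :
    dirDeriv w d.coordU = MvPolynomial.C (planeDet w d.dirV / planeDet d.dirU d.dirV) := by
  rw [coordU, dirDeriv_affineForm]
  simp only [planeDet, Matrix.cons_val_zero, Matrix.cons_val_one]
  congr 1
  ring

theorem dirDeriv_dirU_coordU (d : Dart Ω) : dirDeriv d.dirU d.coordU = 1 := by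
  rw [dirDeriv_coordU, div_self d.dirU_det_ne_zero.1, MvPolynomial.C_1]

theorem dirDeriv_dirV_coordU (d : Dart Ω) : dirDeriv d.dirV d.coordU = 0 := by
  rw [dirDeriv_coordU, show planeDet d.dirV d.dirV = 0 by simp only [planeDet]; ring, zero_div,
    MvPolynomial.C_0]

theorem dirDeriv_dirU_other_coordU (d : Dart Ω) : dirDeriv d.dirU d.other.coordU = 0 := by
  have := d.other.dirDeriv_dirV_coordU
  rwa [other_dirV] at this

theorem dirDeriv_dirV_other_coordU (d : Dart Ω) : dirDeriv d.dirV d.other.coordU = 1 := by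
  have := d.other.dirDeriv_dirU_coordU
  rwa [other_dirU] at this

theorem eval_start_coordU (d : Dart Ω) : MvPolynomial.eval d.start d.coordU = 0 := by
  simp [eval_coordU, planeDet]

theorem eval_start_other_coordU (d : Dart Ω) :
    MvPolynomial.eval d.start d.other.coordU = 0 := by
  simp [eval_other_coordU, planeDet]

/-- Restriction of polynomials to an edge, with the parameter `u`. -/
noncomputable def restrict (d : Dart Ω) : MvPolynomial (Fin 2) ℝ →ₐ[ℝ] ℝ[X] :=
  restrictLine d.start d.dirU

theorem restrict_coordU (d : Dart Ω) : d.restrict d.coordU = X := by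
  apply Polynomial.funext
  intro t
  rw [restrict, eval_restrictLine, eval_coordU, eval_X, div_eq_iff d.dirU_det_ne_zero.1]
  simp only [planeDet, Pi.sub_apply, Pi.add_apply, Pi.smul_apply, smul_eq_mul]
  ring

theorem restrict_other_coordU (d : Dart Ω) : d.restrict d.other.coordU = 0 := by
  apply Polynomial.funext
  intro t
  rw [restrict, eval_restrictLine, eval_other_coordU, eval_zero,
    div_eq_zero_iff]
  left
  simp only [planeDet, Pi.sub_apply, Pi.add_apply, Pi.smul_apply, smul_eq_mul]
  ring

theorem eval_restrict (d : Dart Ω) (t : ℝ) (p : MvPolynomial (Fin 2) ℝ) :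
    (d.restrict p).eval t = MvPolynomial.eval (d.point t) p :=
  eval_restrictLine _ _ _ _

theorem eval_zero_restrict (d : Dart Ω) (p : MvPolynomial (Fin 2) ℝ) :
    (d.restrict p).eval 0 = MvPolynomial.eval d.start p := by
  simp [eval_restrict, point]

theorem derivative_restrict (d : Dart Ω) (p : MvPolynomial (Fin 2) ℝ) :
    derivative (d.restrict p) = d.restrict (dirDeriv d.dirU p) :=
  derivative_restrictLine _ _ _

theorem restrict_comp (d : Dart Ω) (p : MvPolynomial (Fin 2) ℝ) :
    (d.restrict p).comp (1 - X) = d.rev.restrict p := by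
  rw [restrict, restrictLine_comp, restrict, rev_start, rev_dirU]

/-! ### Positions of the vertices in standard coordinates -/

/-- Three non-collinear values determine an affine form. On a triangle these are all the vertices;
on a rectangle the remaining one is treated in `eval_fourth_coordU`. -/
theorem eval_vertex_coordU (ℓ : K₀) (i : Fin ((Ω ℓ).m + 3)) (b : Bool) :
    MvPolynomial.eval ((Ω ℓ).vertex i) (coordU (⟨ℓ, i, b⟩ : Dart Ω)) = (if b then 0 else 1) ∧
    MvPolynomial.eval ((Ω ℓ).vertex (i + 1)) (coordU (⟨ℓ, i, b⟩ : Dart Ω)) =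
      (if b then 1 else 0) ∧
    MvPolynomial.eval ((Ω ℓ).vertex (if b then i - 1 else i + 1 + 1))
      (coordU (⟨ℓ, i, b⟩ : Dart Ω)) = 0 := by
  have h := (⟨ℓ, i, b⟩ : Dart Ω).dirU_det_ne_zero.1
  simp only [eval_coordU]
  cases b <;> simp only [mk_start_true, mk_start_false, mk_dirU_true, mk_dirU_false, mk_dirV_true,
    mk_dirV_false, if_true, Bool.false_eq_true, if_false] at h ⊢
  · refine ⟨div_self h, ?_, ?_⟩ <;> rw [div_eq_zero_iff] <;> left <;>
      simp only [planeDet, Pi.sub_apply] <;> ring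
  · refine ⟨?_, div_self h, ?_⟩ <;> rw [div_eq_zero_iff] <;> left <;>
      simp only [planeDet, Pi.sub_apply] <;> ring

theorem eval_vertex_other_coordU (ℓ : K₀) (i : Fin ((Ω ℓ).m + 3)) (b : Bool) :
    MvPolynomial.eval ((Ω ℓ).vertex i) (coordU (⟨ℓ, i, b⟩ : Dart Ω).other) = 0 ∧
    MvPolynomial.eval ((Ω ℓ).vertex (i + 1)) (coordU (⟨ℓ, i, b⟩ : Dart Ω).other) = 0 ∧
    MvPolynomial.eval ((Ω ℓ).vertex (if b then i - 1 else i + 1 + 1))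
      (coordU (⟨ℓ, i, b⟩ : Dart Ω).other) = 1 := by
  have h := (⟨ℓ, i, b⟩ : Dart Ω).dirU_det_ne_zero.1
  simp only [eval_other_coordU]
  cases b <;> simp only [mk_start_true, mk_start_false, mk_dirU_true, mk_dirU_false, mk_dirV_true,
    mk_dirV_false, if_true, Bool.false_eq_true, if_false] at h ⊢
  all_goals refine ⟨?_, ?_, div_self h⟩ <;> rw [div_eq_zero_iff] <;> left <;>
      simp only [planeDet, Pi.sub_apply] <;> ring

end Dart

/-! ### Products of affine forms -/

theorem totalDegree_aeval_le (p : ℝ[X]) {f : MvPolynomial (Fin 2) ℝ} (hf : f.totalDegree ≤ 1) :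
    (aeval f p).totalDegree ≤ p.natDegree := by
  rw [aeval_eq_sum_range]
  refine MvPolynomial.totalDegree_finsetSum_le fun i hi => ?_
  refine (MvPolynomial.totalDegree_smul_le _ _).trans
    ((MvPolynomial.totalDegree_pow _ _).trans ?_)
  rw [Finset.mem_range] at hi
  nlinarith

theorem degreeOf_aeval_le (p : ℝ[X]) (f : MvPolynomial (Fin 2) ℝ) (j : Fin 2) :
    (aeval f p).degreeOf j ≤ p.natDegree * f.degreeOf j := by
  rw [aeval_eq_sum_range]
  refine (MvPolynomial.degreeOf_sum_le _ _ _).trans (Finset.sup_le fun i hi => ?_)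
  rw [MvPolynomial.smul_eq_C_mul]
  refine (MvPolynomial.degreeOf_C_mul_le _ _ _).trans
    ((MvPolynomial.degreeOf_pow_le _ _ _).trans ?_)
  rw [Finset.mem_range] at hi
  exact Nat.mul_le_mul_right _ (by omega)

theorem dirDeriv_aeval (w : Plane) (f : MvPolynomial (Fin 2) ℝ) (p : ℝ[X]) :
    dirDeriv w (aeval f p) = aeval f (derivative p) * dirDeriv w f := by
  induction p using Polynomial.induction_on' with
  | add p q hp hq => simp only [map_add, hp, hq, add_mul]
  | monomial n a =>
    simp only [aeval_monomial, derivative_monomial, Derivation.leibniz,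
      Derivation.leibniz_pow, MvPolynomial.algebraMap_eq, dirDeriv_C, smul_eq_mul, nsmul_eq_mul,
      map_mul, map_natCast]
    ring

theorem restrictLine_affineForm_eq_zero {c : ℝ} {n x w : Plane}
    (h0 : MvPolynomial.eval x (affineForm c n) = 0)
    (h1 : MvPolynomial.eval (x + w) (affineForm c n) = 0) :
    restrictLine x w (affineForm c n) = 0 := by
  rw [eval_affineForm] at h0 h1
  simp only [Pi.add_apply] at h1
  rw [restrictLine_affineForm, h0, show n 0 * w 0 + n 1 * w 1 = 0 by linarith]
  simp

theorem dirDeriv_affineForm_eq {c : ℝ} {n x y : Plane} :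
    dirDeriv (y - x) (affineForm c n) = MvPolynomial.C
      (MvPolynomial.eval y (affineForm c n) - MvPolynomial.eval x (affineForm c n)) := by
  rw [dirDeriv_affineForm, eval_affineForm, eval_affineForm]
  simp only [Pi.sub_apply]
  congr 1
  ring

/-- Polynomials of degree at most one. -/
def IsAffineForm (f : MvPolynomial (Fin 2) ℝ) : Prop := ∃ c n, f = affineForm c n

theorem IsAffineForm.one_sub {f : MvPolynomial (Fin 2) ℝ} (hf : IsAffineForm f) :
    IsAffineForm (1 - f) := by
  obtain ⟨c, n, rfl⟩ := hf; exact ⟨_, _, one_sub_affineForm c n⟩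

theorem IsAffineForm.add {f g : MvPolynomial (Fin 2) ℝ} (hf : IsAffineForm f)
    (hg : IsAffineForm g) : IsAffineForm (f + g) := by
  obtain ⟨c, n, rfl⟩ := hf
  obtain ⟨c', n', rfl⟩ := hg
  exact ⟨_, _, affineForm_add c c' n n'⟩

theorem IsAffineForm.totalDegree_le {f : MvPolynomial (Fin 2) ℝ} (hf : IsAffineForm f) :
    f.totalDegree ≤ 1 := by
  obtain ⟨c, n, rfl⟩ := hf; exact totalDegree_affineForm_le c n

/-! ### Jets at a corner, and double vanishing along a side -/

namespace Dart

variable {K₀ : Type*} {Ω : K₀ → ConvexPolygon}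

theorem isAffineForm_coordU (d : Dart Ω) : IsAffineForm d.coordU := ⟨_, _, rfl⟩

/-- Value, first derivatives and mixed derivative at the starting point, in the standard
coordinates. -/
noncomputable def jet (d : Dart Ω) (p : MvPolynomial (Fin 2) ℝ) : Fin 4 → ℝ :=
  ![MvPolynomial.eval d.start p, MvPolynomial.eval d.start (dirDeriv d.dirU p),
    MvPolynomial.eval d.start (dirDeriv d.dirV p),
    MvPolynomial.eval d.start (dirDeriv d.dirU (dirDeriv d.dirV p))]

theorem restrict_eq_zero_of_isAffineForm {ℓ : K₀} {j : Fin ((Ω ℓ).m + 3)} {b : Bool}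
    {f : MvPolynomial (Fin 2) ℝ} (hf : IsAffineForm f)
    (h0 : MvPolynomial.eval ((Ω ℓ).vertex j) f = 0)
    (h1 : MvPolynomial.eval ((Ω ℓ).vertex (j + 1)) f = 0) :
    (⟨ℓ, j, b⟩ : Dart Ω).restrict f = 0 := by
  obtain ⟨c, n, rfl⟩ := hf
  rw [restrict]
  cases b
  · apply restrictLine_affineForm_eq_zero <;> simpa [mk_start_false, mk_dirU_false]
  · apply restrictLine_affineForm_eq_zero <;> simpa [mk_start_true, mk_dirU_true]

/-- A polynomial that is divisible by the square of an affine form vanishing on an edge has zero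
value and derivatives there. -/
theorem restrict_sq_mul {d : Dart Ω} {f : MvPolynomial (Fin 2) ℝ} (h : d.restrict f = 0)
    (g : MvPolynomial (Fin 2) ℝ) (w : Plane) :
    d.restrict (f ^ 2 * g) = 0 ∧ d.restrict (dirDeriv w (f ^ 2 * g)) = 0 := by
  constructor
  · simp [h]
  · simp [Derivation.leibniz, Derivation.leibniz_pow, h]

/-- At a zero of f, the only term of the jet of f²g that can survive is 2 f_u f_v g in the mixed
derivative. It disappears if f is constant along one of the two sides at the corner. -/
theorem jet_sq_mul {d : Dart Ω} {f : MvPolynomial (Fin 2) ℝ}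
    (h : MvPolynomial.eval d.start f = 0)
    (h' : dirDeriv d.dirU f = 0 ∨ dirDeriv d.dirV f = 0) (g : MvPolynomial (Fin 2) ℝ) :
    d.jet (f ^ 2 * g) = 0 := by
  ext i
  fin_cases i
  · simp [jet, h]
  · simp [jet, h, Derivation.leibniz, Derivation.leibniz_pow]
  · simp [jet, h, Derivation.leibniz, Derivation.leibniz_pow]
  · rcases h' with h' | h' <;>
    simp [jet, h, Derivation.leibniz, Derivation.leibniz_pow, h']

/-- By the Leibniz rule the jet depends on the four coefficients through a unitriangular system,
since F is 1 at the corner. -/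
theorem jet_mul_bilinear (d : Dart Ω) {F : MvPolynomial (Fin 2) ℝ}
    (hF : MvPolynomial.eval d.start F = 1) (α β γ δ : ℝ) :
    d.jet (F * (MvPolynomial.C α + MvPolynomial.C β * d.coordU
      + MvPolynomial.C γ * d.other.coordU + MvPolynomial.C δ * (d.coordU * d.other.coordU))) =
    ![α, β + α * d.jet F 1, γ + α * d.jet F 2,
      δ + β * d.jet F 2 + γ * d.jet F 1 + α * d.jet F 3] := by
  ext i
  fin_cases i <;>
  simp [jet, Derivation.leibniz, dirDeriv_dirU_coordU, dirDeriv_dirV_coordU,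
    dirDeriv_dirU_other_coordU, dirDeriv_dirV_other_coordU, eval_start_coordU,
    eval_start_other_coordU, hF, dirDeriv_C] <;> ring

/-- Every jet at the starting point is attained by a multiple of a given polynomial. -/
theorem exists_jet_eq (d : Dart Ω) {F : MvPolynomial (Fin 2) ℝ}
    (hF : MvPolynomial.eval d.start F = 1) (c : Fin 4 → ℝ) :
    ∃ α β γ δ : ℝ, d.jet (F * (MvPolynomial.C α + MvPolynomial.C β * d.coordU
      + MvPolynomial.C γ * d.other.coordU + MvPolynomial.C δ * (d.coordU * d.other.coordU))) = c := by
  -- Back substitution in the triangular system of `jet_mul_bilinear`.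
  refine ⟨c 0, c 1 - c 0 * d.jet F 1, c 2 - c 0 * d.jet F 2,
    c 3 - c 0 * d.jet F 3 - (c 2 - c 0 * d.jet F 2) * d.jet F 1
      - (c 1 - c 0 * d.jet F 1) * d.jet F 2, ?_⟩
  rw [jet_mul_bilinear d hF]
  ext i
  fin_cases i <;> simp

end Dart

/-! ### Rectangles -/

namespace ConvexPolygon

theorem inCornerCoords_affineForm (P : ConvexPolygon) (c : ℝ) (n : Plane) :
    P.inCornerCoords (affineForm c n) =
      affineForm (MvPolynomial.eval (P.vertex 0) (affineForm c n))
        ![MvPolynomial.eval (P.vertex 1) (affineForm c n)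
            - MvPolynomial.eval (P.vertex 0) (affineForm c n),
          MvPolynomial.eval (P.vertex (-1)) (affineForm c n)
            - MvPolynomial.eval (P.vertex 0) (affineForm c n)] := by
  simp only [eval_affineForm]
  simp only [inCornerCoords, affineForm, map_add, map_mul, MvPolynomial.aeval_X, map_sub,
    MvPolynomial.algHom_C, MvPolynomial.algebraMap_eq, Matrix.cons_val_zero, Matrix.cons_val_one]
  ring

end ConvexPolygon

theorem degreeOf_affineForm_le (c : ℝ) (n : Plane) (j : Fin 2) :
    (affineForm c n).degreeOf j ≤ if n j = 0 then 0 else 1 := by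
  have h0 : ∀ i, i ≠ j → (MvPolynomial.C (n i) * MvPolynomial.X i :
      MvPolynomial (Fin 2) ℝ).degreeOf j ≤ 0 := fun i hi =>
    (MvPolynomial.degreeOf_C_mul_le _ _ _).trans (by
      rw [MvPolynomial.degreeOf_X, if_neg (Ne.symm hi)])
  have h1 : (MvPolynomial.C (n j) * MvPolynomial.X j :
      MvPolynomial (Fin 2) ℝ).degreeOf j ≤ if n j = 0 then 0 else 1 := by
    split_ifs with h
    · simp [h]
    · refine (MvPolynomial.degreeOf_C_mul_le _ _ _).trans ?_
      rw [MvPolynomial.degreeOf_X, if_pos rfl]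
  refine (MvPolynomial.degreeOf_add_le _ _ _).trans (max_le
    ((MvPolynomial.degreeOf_add_le _ _ _).trans (max_le ?_ ?_)) ?_)
  · simp
  · fin_cases j
    · exact h1
    · exact (h0 0 (by decide)).trans (Nat.zero_le _)
  · fin_cases j
    · exact (h0 1 (by decide)).trans (Nat.zero_le _)
    · exact h1

namespace Dart

variable {K₀ : Type*} {Ω : K₀ → ConvexPolygon}

/-- The four values of the standard coordinates at the vertices of a rectangle. -/
theorem eval_fourth_coordU {ℓ : K₀} (h : (Ω ℓ).IsRectangle) (i : Fin ((Ω ℓ).m + 3)) (b : Bool) :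
    MvPolynomial.eval ((Ω ℓ).vertex (if b then i + 1 + 1 else i - 1))
      (coordU (⟨ℓ, i, b⟩ : Dart Ω)) = 1 ∧
    MvPolynomial.eval ((Ω ℓ).vertex (if b then i + 1 + 1 else i - 1))
      (coordU (⟨ℓ, i, b⟩ : Dart Ω).other) = 1 := by
  have e : ∀ f : MvPolynomial (Fin 2) ℝ, IsAffineForm f →
      MvPolynomial.eval ((Ω ℓ).vertex (i + 1 + 1)) f =
      MvPolynomial.eval ((Ω ℓ).vertex (i + 1)) f + MvPolynomial.eval ((Ω ℓ).vertex (i - 1)) f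
        - MvPolynomial.eval ((Ω ℓ).vertex i) f := by
    rintro _ ⟨c, n, rfl⟩
    rw [h.vertex_add_two]
    simp only [eval_affineForm, Pi.sub_apply, Pi.add_apply]
    ring
  obtain ⟨a1, a2, a3⟩ := eval_vertex_coordU (Ω := Ω) ℓ i b
  obtain ⟨b1, b2, b3⟩ := eval_vertex_other_coordU (Ω := Ω) ℓ i b
  have e1 := e _ (⟨ℓ, i, b⟩ : Dart Ω).isAffineForm_coordU
  have e2 := e _ (⟨ℓ, i, b⟩ : Dart Ω).other.isAffineForm_coordU
  cases b <;> simp only [if_true, Bool.false_eq_true, if_false] at * <;> constructor <;> linarith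

/-- Every side of a rectangle is parallel to one of the coordinate axes. -/
theorem eval_coordU_succ {ℓ : K₀} (h : (Ω ℓ).IsRectangle) (i j : Fin ((Ω ℓ).m + 3)) (b : Bool) :
    MvPolynomial.eval ((Ω ℓ).vertex (j + 1)) (coordU (⟨ℓ, i, b⟩ : Dart Ω)) =
      MvPolynomial.eval ((Ω ℓ).vertex j) (coordU (⟨ℓ, i, b⟩ : Dart Ω)) ∨
    MvPolynomial.eval ((Ω ℓ).vertex (j + 1)) (coordU (⟨ℓ, i, b⟩ : Dart Ω).other) =
      MvPolynomial.eval ((Ω ℓ).vertex j) (coordU (⟨ℓ, i, b⟩ : Dart Ω).other) := by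
  obtain ⟨a1, a2, a3⟩ := eval_vertex_coordU (Ω := Ω) ℓ i b
  obtain ⟨b1, b2, b3⟩ := eval_vertex_other_coordU (Ω := Ω) ℓ i b
  obtain ⟨a4, b4⟩ := eval_fourth_coordU h i b
  obtain ⟨hj, e1, e2, -⟩ := h.cases_eq i j
  rcases hj with rfl | rfl | rfl | rfl <;> cases b <;>
    simp only [if_true, Bool.false_eq_true, if_false, e1, sub_add_cancel] at * <;>
    simp only [*, true_or, or_true]

/-- Along each of the two sides at vertex 0, one of u, v is constant. So each corner variable occurs
in at most one of u, v, and bidegrees of products of polynomials in u and in v can be bounded factor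
by factor. -/
theorem degreeOf_inCornerCoords_coordU {d : Dart Ω} (h : (Ω d.poly).IsRectangle) (j : Fin 2) :
    ((Ω d.poly).inCornerCoords d.coordU).degreeOf j
      + ((Ω d.poly).inCornerCoords d.other.coordU).degreeOf j ≤ 1 := by
  obtain ⟨ℓ, i, b⟩ := d
  have h0 := eval_coordU_succ h i 0 b
  have h1 := eval_coordU_succ h i (-1) b
  have e : (-1 + 1 : Fin ((Ω ℓ).m + 3)) = 0 := by simp
  have e' : (0 + 1 : Fin ((Ω ℓ).m + 3)) = 1 := by simp
  rw [e] at h1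
  rw [e'] at h0
  obtain ⟨c, n, hc⟩ := (⟨ℓ, i, b⟩ : Dart Ω).isAffineForm_coordU
  obtain ⟨c', n', hc'⟩ := (⟨ℓ, i, b⟩ : Dart Ω).other.isAffineForm_coordU
  rw [hc, hc'] at h0 h1 ⊢
  simp only
  rw [ConvexPolygon.inCornerCoords_affineForm, ConvexPolygon.inCornerCoords_affineForm]
  refine (add_le_add (degreeOf_affineForm_le _ _ j) (degreeOf_affineForm_le _ _ j)).trans ?_
  have key : ∀ x y : ℝ, x = 0 ∨ y = 0 →
      (if x = 0 then 0 else 1) + (if y = 0 then 0 else 1) ≤ 1 := by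
    rintro x y (rfl | rfl) <;> simp <;> split_ifs <;> simp
  fin_cases j
  · exact key _ _ (h0.imp sub_eq_zero.2 sub_eq_zero.2)
  · exact key _ _ (h1.imp (fun h => sub_eq_zero.2 h.symm) fun h => sub_eq_zero.2 h.symm)

end Dart

namespace ConvexPolygon

/-- The space of polynomial functions of degree `≤ k` on a triangle, of bidegree `≤ (k, k)` on a
rectangle. -/
def polySpace (P : ConvexPolygon) (k : ℕ) : Submodule ℝ (MvPolynomial (Fin 2) ℝ) where
  carrier := {p | P.DegreeLE k p}
  zero_mem' := DegreeLE.zero P k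
  add_mem' := DegreeLE.add
  smul_mem' := fun c _ => DegreeLE.smul c

theorem mem_polySpace_triangle {P : ConvexPolygon} (hP : P.IsTriangle) {k : ℕ}
    {p : MvPolynomial (Fin 2) ℝ} : p ∈ P.polySpace k ↔ p.totalDegree ≤ k :=
  ⟨fun h => h.1 hP, fun h => ⟨fun _ => h, fun h' => (hP.not_isRectangle h').elim⟩⟩

theorem mem_polySpace_rectangle {P : ConvexPolygon} (hP : P.IsRectangle) {k : ℕ}
    {p : MvPolynomial (Fin 2) ℝ} :
    p ∈ P.polySpace k ↔ ∀ j, (P.inCornerCoords p).degreeOf j ≤ k :=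
  ⟨fun h => h.2 hP, fun h => ⟨fun h' => (hP.not_isTriangle h').elim, fun _ => h⟩⟩

end ConvexPolygon

/-! ### Corner coordinates and dimensions of the polynomial spaces -/

namespace Dart

variable {K₀ : Type*} {Ω : K₀ → ConvexPolygon}

theorem corner_coords (ℓ : K₀) : (Ω ℓ).inCornerCoords (⟨ℓ, 0, true⟩ : Dart Ω).coordU
      = MvPolynomial.X 0 ∧
    (Ω ℓ).inCornerCoords (⟨ℓ, 0, true⟩ : Dart Ω).other.coordU = MvPolynomial.X 1 := by
  have ha := eval_vertex_coordU (Ω := Ω) ℓ 0 true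
  have hb := eval_vertex_other_coordU (Ω := Ω) ℓ 0 true
  simp only [zero_add, if_true, zero_sub] at ha hb
  obtain ⟨a1, a2, a3⟩ := ha
  obtain ⟨b1, b2, b3⟩ := hb
  obtain ⟨c, n, hc⟩ := (⟨ℓ, 0, true⟩ : Dart Ω).isAffineForm_coordU
  obtain ⟨c', n', hc'⟩ := (⟨ℓ, 0, true⟩ : Dart Ω).other.isAffineForm_coordU
  rw [hc] at a1 a2 a3 ⊢
  rw [hc'] at b1 b2 b3 ⊢
  rw [ConvexPolygon.inCornerCoords_affineForm, ConvexPolygon.inCornerCoords_affineForm,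
    a1, a2, a3, b1, b2, b3]
  constructor <;> simp [affineForm]

theorem aeval_corner_coords (ℓ : K₀) (p : MvPolynomial (Fin 2) ℝ) :
    MvPolynomial.aeval ![(⟨ℓ, 0, true⟩ : Dart Ω).coordU, (⟨ℓ, 0, true⟩ : Dart Ω).other.coordU]
      ((Ω ℓ).inCornerCoords p) = p := by
  set d : Dart Ω := ⟨ℓ, 0, true⟩ with hd
  suffices h : (MvPolynomial.aeval ![d.coordU, d.other.coordU]).comp (Ω ℓ).inCornerCoords =
      AlgHom.id ℝ _ from DFunLike.congr_fun h p
  apply MvPolynomial.algHom_ext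
  intro i
  apply MvPolynomial.funext
  intro x
  have h := congrFun (plane_eq_add (x - d.start) d.dirU d.dirV d.dirU_det_ne_zero.1) i
  have e0 : (0 + 1 : Fin ((Ω ℓ).m + 3)) = 1 := zero_add 1
  have e1 : (0 - 1 : Fin ((Ω ℓ).m + 3)) = -1 := zero_sub 1
  rw [← eval_coordU, ← eval_other_coordU] at h
  simp only [ConvexPolygon.inCornerCoords, AlgHom.comp_apply, MvPolynomial.aeval_X, map_add,
    map_mul, MvPolynomial.algHom_C, MvPolynomial.algebraMap_eq, MvPolynomial.eval_C,
    MvPolynomial.eval_X, AlgHom.id_apply, Matrix.cons_val_zero, Matrix.cons_val_one]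
  simp only [Pi.add_apply, Pi.sub_apply, Pi.smul_apply, smul_eq_mul] at h
  simp only [hd, mk_start_true, mk_dirU_true, mk_dirV_true, e0, e1, Pi.sub_apply] at h ⊢
  linarith

/-- Passing to corner coordinates, as an equivalence. -/
noncomputable def cornerEquiv (ℓ : K₀) :
    MvPolynomial (Fin 2) ℝ ≃ₐ[ℝ] MvPolynomial (Fin 2) ℝ :=
  AlgEquiv.ofAlgHom (Ω ℓ).inCornerCoords
    (MvPolynomial.aeval ![(⟨ℓ, 0, true⟩ : Dart Ω).coordU, (⟨ℓ, 0, true⟩ : Dart Ω).other.coordU])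
    (MvPolynomial.algHom_ext fun i => by
      have := corner_coords (Ω := Ω) ℓ
      fin_cases i <;> simp [this.1, this.2])
    (AlgHom.ext fun p => aeval_corner_coords ℓ p)

theorem polySpace_eq_rectangle {ℓ : K₀} (h : (Ω ℓ).IsRectangle) (k : ℕ) :
    (Ω ℓ).polySpace k = (MvPolynomial.restrictDegree (Fin 2) ℝ k).map
      (cornerEquiv (Ω := Ω) ℓ).symm.toLinearEquiv.toLinearMap := by
  ext p
  rw [ConvexPolygon.mem_polySpace_rectangle h, Submodule.mem_map_equiv,
    MvPolynomial.mem_restrictDegree]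
  simp only [MvPolynomial.degreeOf_le_iff]
  exact ⟨fun h s hs i => h i s hs, fun h i s hs => h s hs i⟩

theorem polySpace_eq_triangle {ℓ : K₀} (h : (Ω ℓ).IsTriangle) (k : ℕ) :
    (Ω ℓ).polySpace k = MvPolynomial.restrictTotalDegree (Fin 2) ℝ k := by
  ext p
  rw [ConvexPolygon.mem_polySpace_triangle h, MvPolynomial.mem_restrictTotalDegree]

theorem finite_polySpace {ℓ : K₀} (h : (Ω ℓ).IsTriangle ∨ (Ω ℓ).IsRectangle) (k : ℕ) :
    Module.Finite ℝ ((Ω ℓ).polySpace k) := by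
  rcases h with h | h
  · rw [polySpace_eq_triangle h]; infer_instance
  · rw [polySpace_eq_rectangle h]
    exact Module.Finite.equiv ((cornerEquiv (Ω := Ω) ℓ).symm.toLinearEquiv.submoduleMap _)

theorem finrank_polySpace_rectangle {ℓ : K₀} (h : (Ω ℓ).IsRectangle) (k : ℕ) :
    Module.finrank ℝ ((Ω ℓ).polySpace k) = (k + 1) ^ 2 := by
  rw [polySpace_eq_rectangle h, LinearEquiv.finrank_map_eq, finrank_restrictDegree]

theorem finrank_polySpace_triangle {ℓ : K₀} (h : (Ω ℓ).IsTriangle) (k : ℕ) :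
    2 * Module.finrank ℝ ((Ω ℓ).polySpace k) = (k + 1) * (k + 2) := by
  rw [polySpace_eq_triangle h, finrank_restrictTotalDegree]

/-! ### Degrees along the edges -/

theorem natDegree_affine_le {c e : ℝ} : (C c + C e * X : ℝ[X]).natDegree ≤ 1 := by
  refine (natDegree_add_le _ _).trans (max_le (by simp) ?_)
  exact (natDegree_C_mul_le _ _).trans natDegree_X_le

theorem natDegree_restrict_corner_coords {d : Dart Ω} (h : (Ω d.poly).IsRectangle) :
    (d.restrict (⟨d.poly, 0, true⟩ : Dart Ω).coordU).natDegree +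
      (d.restrict (⟨d.poly, 0, true⟩ : Dart Ω).other.coordU).natDegree ≤ 1 := by
  obtain ⟨ℓ, j, b⟩ := d
  have hs := eval_coordU_succ h 0 j true
  obtain ⟨c, n, hc⟩ := (⟨ℓ, 0, true⟩ : Dart Ω).isAffineForm_coordU
  obtain ⟨c', n', hc'⟩ := (⟨ℓ, 0, true⟩ : Dart Ω).other.isAffineForm_coordU
  have key : ∀ c n, MvPolynomial.eval ((Ω ℓ).vertex (j + 1)) (affineForm c n) =
      MvPolynomial.eval ((Ω ℓ).vertex j) (affineForm c n) →
      ((⟨ℓ, j, b⟩ : Dart Ω).restrict (affineForm c n)).natDegree = 0 := by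
    intro c n e
    rw [eval_affineForm, eval_affineForm] at e
    rw [restrict, restrictLine_affineForm]
    cases b
    · rw [mk_dirU_false]
      simp only [Pi.sub_apply]
      rw [show n 0 * ((Ω ℓ).vertex j 0 - (Ω ℓ).vertex (j + 1) 0)
        + n 1 * ((Ω ℓ).vertex j 1 - (Ω ℓ).vertex (j + 1) 1) = 0 by linarith, C_0, zero_mul,
        add_zero, natDegree_C]
    · rw [mk_dirU_true]
      simp only [Pi.sub_apply]
      rw [show n 0 * ((Ω ℓ).vertex (j + 1) 0 - (Ω ℓ).vertex j 0)
        + n 1 * ((Ω ℓ).vertex (j + 1) 1 - (Ω ℓ).vertex j 1) = 0 by linarith, C_0, zero_mul,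
        add_zero, natDegree_C]
  have key' : ∀ c n, ((⟨ℓ, j, b⟩ : Dart Ω).restrict (affineForm c n)).natDegree ≤ 1 := by
    intro c n
    rw [restrict, restrictLine_affineForm]
    exact natDegree_affine_le
  simp only
  rw [hc, hc'] at hs ⊢
  rcases hs with hs | hs
  · rw [key _ _ hs, zero_add]; exact key' _ _
  · rw [key _ _ hs, add_zero]; exact key' _ _

/-- On a rectangle the total degree would only give 2k; the bound k holds because at most one of the
corner coordinates varies along a side. -/
theorem natDegree_restrict_le {d : Dart Ω}
    (h : (Ω d.poly).IsTriangle ∨ (Ω d.poly).IsRectangle) {k : ℕ}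
    {p : MvPolynomial (Fin 2) ℝ} (hp : p ∈ (Ω d.poly).polySpace k) :
    (d.restrict p).natDegree ≤ k := by
  rcases h with h | h
  · exact (natDegree_aeval_le_totalDegree (fun _ => natDegree_affine_le) p).trans
      ((ConvexPolygon.mem_polySpace_triangle h).1 hp)
  · have hp' := (ConvexPolygon.mem_polySpace_rectangle h).1 hp
    rw [← aeval_corner_coords (Ω := Ω) d.poly p, MvPolynomial.comp_aeval_apply]
    refine (natDegree_aeval_le_degreeOf hp').trans ?_
    have := natDegree_restrict_corner_coords h
    simp only [Matrix.cons_val_zero, Matrix.cons_val_one]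
    nlinarith

theorem dirDeriv_mvAeval (w : Plane) (f : Fin 2 → MvPolynomial (Fin 2) ℝ)
    (p : MvPolynomial (Fin 2) ℝ) :
    dirDeriv w (MvPolynomial.aeval f p) =
      MvPolynomial.aeval f (MvPolynomial.pderiv 0 p) * dirDeriv w (f 0)
      + MvPolynomial.aeval f (MvPolynomial.pderiv 1 p) * dirDeriv w (f 1) := by
  induction p using MvPolynomial.induction_on with
  | C a => simp [MvPolynomial.algebraMap_eq]
  | add p q hp hq => simp only [map_add, hp, hq]; ring
  | mul_X p i hp =>
    simp only [map_mul, Derivation.leibniz, hp, MvPolynomial.aeval_X, smul_eq_mul, map_add,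
      MvPolynomial.pderiv_X]
    fin_cases i <;> simp <;> ring

/-- The difference of one between the two cases is balanced by r_j in the definition of δ. -/
theorem natDegree_restrict_dirDeriv_le {d : Dart Ω} {k : ℕ} {p : MvPolynomial (Fin 2) ℝ}
    (hp : p ∈ (Ω d.poly).polySpace k) (w : Plane) :
    ((Ω d.poly).IsTriangle → (d.restrict (dirDeriv w p)).natDegree ≤ k - 1) ∧
    ((Ω d.poly).IsRectangle → (d.restrict (dirDeriv w p)).natDegree ≤ k) := by
  constructor
  · intro h
    refine (natDegree_aeval_le_totalDegree (fun _ => natDegree_affine_le) _).trans ?_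
    have hp' := (ConvexPolygon.mem_polySpace_triangle h).1 hp
    refine (MvPolynomial.totalDegree_add _ _).trans (max_le ?_ ?_) <;>
      exact (MvPolynomial.totalDegree_smul_le _ _).trans (totalDegree_pderiv_le hp' _)
  · intro h
    have hp' := (ConvexPolygon.mem_polySpace_rectangle h).1 hp
    obtain ⟨c, n, hc⟩ := (⟨d.poly, 0, true⟩ : Dart Ω).isAffineForm_coordU
    obtain ⟨c', n', hc'⟩ := (⟨d.poly, 0, true⟩ : Dart Ω).other.isAffineForm_coordU
    have hd := natDegree_restrict_corner_coords h
    have key : ∀ i, (d.restrict (MvPolynomial.aeval ![(⟨d.poly, 0, true⟩ : Dart Ω).coordU,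
        (⟨d.poly, 0, true⟩ : Dart Ω).other.coordU] (MvPolynomial.pderiv i
          ((Ω d.poly).inCornerCoords p)))).natDegree ≤ k := by
      intro i
      rw [MvPolynomial.comp_aeval_apply]
      refine (natDegree_aeval_le_degreeOf fun j => degreeOf_pderiv_le (hp' j) i).trans ?_
      simp only [Matrix.cons_val_zero, Matrix.cons_val_one]
      nlinarith
    rw [← aeval_corner_coords (Ω := Ω) d.poly p, dirDeriv_mvAeval]
    simp only [Matrix.cons_val_zero, Matrix.cons_val_one, map_add, map_mul]
    rw [hc, hc', dirDeriv_affineForm, dirDeriv_affineForm, ← hc, ← hc']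
    simp only [restrict, restrictLine_C]
    refine (natDegree_add_le _ _).trans (max_le ?_ ?_)
    · exact (natDegree_mul_C_le _ _).trans (key 0)
    · exact (natDegree_mul_C_le _ _).trans (key 1)

end Dart

/-! ### Polynomials concentrated at one corner or on one side -/

namespace Dart

variable {K₀ : Type*} {Ω : K₀ → ConvexPolygon}

/-- The second edges at both ends lead to the same third vertex, so the two transverse directions
differ by `dirU`. -/
theorem revR_triangle {d : Dart Ω} (h : (Ω d.poly).IsTriangle) : d.revR = 1 := by
  have hd := d.dirU_det_ne_zero.2
  rw [revR, div_eq_one_iff_eq hd]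
  obtain ⟨ℓ, i, b⟩ := d
  have e := (h.cases_eq i i).2.1
  simp only at e
  cases b <;> simp only [mk_rev, mk_dirU_true, mk_dirU_false, mk_dirV_true,
    mk_dirV_false, Bool.not_true, Bool.not_false, planeDet, Pi.sub_apply, e] <;> ring

/-- The two transverse directions are parallel. -/
theorem revR_rectangle {d : Dart Ω} (h : (Ω d.poly).IsRectangle) : d.revR = 0 := by
  rw [revR, div_eq_zero_iff]
  left
  obtain ⟨ℓ, i, b⟩ := d
  have e := h.vertex_add_two i
  simp only at e
  cases b <;> simp only [mk_rev, mk_dirV_true, mk_dirV_false, Bool.not_true, Bool.not_false,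
    planeDet, Pi.sub_apply, e, Pi.add_apply] <;> ring

theorem eval_one_sub (x : Plane) (f : MvPolynomial (Fin 2) ℝ) :
    MvPolynomial.eval x (1 - f) = 1 - MvPolynomial.eval x f := by simp

theorem dirDeriv_sub_eq_zero {f : MvPolynomial (Fin 2) ℝ} (hf : IsAffineForm f) {x y : Plane}
    (h : MvPolynomial.eval y f = MvPolynomial.eval x f) : dirDeriv (y - x) f = 0 := by
  obtain ⟨c, n, rfl⟩ := hf
  rw [dirDeriv_affineForm_eq, h, sub_self, MvPolynomial.C_0]

/-- The jets of a multiple of the square of an affine form `f` vanish at the vertices of an edge on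
which `f` vanishes. -/
theorem jet_sq_mul_of_edge {ℓ : K₀} {j : Fin ((Ω ℓ).m + 3)} {f : MvPolynomial (Fin 2) ℝ}
    (hf : IsAffineForm f) (h0 : MvPolynomial.eval ((Ω ℓ).vertex j) f = 0)
    (h1 : MvPolynomial.eval ((Ω ℓ).vertex (j + 1)) f = 0) (g : MvPolynomial (Fin 2) ℝ) :
    (⟨ℓ, j, true⟩ : Dart Ω).jet (f ^ 2 * g) = 0 ∧
    (⟨ℓ, j + 1, true⟩ : Dart Ω).jet (f ^ 2 * g) = 0 := by
  constructor
  · refine jet_sq_mul (by rw [mk_start_true]; exact h0) (Or.inl ?_) g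
    rw [mk_dirU_true]
    exact dirDeriv_sub_eq_zero hf (h1.trans h0.symm)
  · refine jet_sq_mul (by rw [mk_start_true]; exact h1) (Or.inr ?_) g
    rw [mk_dirV_true, add_sub_cancel_right]
    exact dirDeriv_sub_eq_zero hf (h0.trans h1.symm)

/-- A bilinear polynomial is multiplied by (1 - u - v)² on a triangle and by (1 - u)²(1 - v)² on a
rectangle. The square factors kill the jets at the other vertices and equal 1 at the chosen one; the
degree is 4, respectively the bidegree is (3, 3). -/
theorem exists_corner_function {ℓ : K₀} (h : (Ω ℓ).IsTriangle ∨ (Ω ℓ).IsRectangle) {k : ℕ}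
    (hk : 4 ≤ k) (i : Fin ((Ω ℓ).m + 3)) (c : Fin 4 → ℝ) :
    ∃ p ∈ (Ω ℓ).polySpace k, (⟨ℓ, i, true⟩ : Dart Ω).jet p = c ∧
      ∀ j, j ≠ i → (⟨ℓ, j, true⟩ : Dart Ω).jet p = 0 := by
  set d : Dart Ω := ⟨ℓ, i, true⟩ with hd
  obtain ⟨a1, a2, a3⟩ := eval_vertex_coordU (Ω := Ω) ℓ i true
  obtain ⟨b1, b2, b3⟩ := eval_vertex_other_coordU (Ω := Ω) ℓ i true
  simp only [← hd, if_true] at a1 a2 a3 b1 b2 b3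
  have hu := d.isAffineForm_coordU
  have hv := d.other.isAffineForm_coordU
  rcases h with h | h
  · have hw : IsAffineForm (1 - (d.coordU + d.other.coordU)) := (hu.add hv).one_sub
    obtain ⟨α, β, γ, δ, hj⟩ := d.exists_jet_eq (F := (1 - (d.coordU + d.other.coordU)) ^ 2)
      (by simp [eval_start_coordU, eval_start_other_coordU]) c
    refine ⟨_, ?_, hj, fun j hji => ?_⟩
    · rw [ConvexPolygon.mem_polySpace_triangle h]
      have hu' := hu.totalDegree_le
      have hv' := hv.totalDegree_le
      have hw' := hw.totalDegree_le
      refine (MvPolynomial.totalDegree_mul _ _).trans ?_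
      have h1 := MvPolynomial.totalDegree_pow (1 - (d.coordU + d.other.coordU)) 2
      have h2 : ∀ (x : ℝ) (f : MvPolynomial (Fin 2) ℝ),
          (MvPolynomial.C x * f).totalDegree ≤ f.totalDegree := fun x f =>
        (MvPolynomial.totalDegree_mul _ _).trans (by simp)
      have h3 : (MvPolynomial.C α + MvPolynomial.C β * d.coordU + MvPolynomial.C γ * d.other.coordU
          + MvPolynomial.C δ * (d.coordU * d.other.coordU)).totalDegree ≤ 2 := by
        refine (MvPolynomial.totalDegree_add _ _).trans (max_le
          ((MvPolynomial.totalDegree_add _ _).trans (max_le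
            ((MvPolynomial.totalDegree_add _ _).trans (max_le ?_ ?_)) ?_)) ?_)
        · simp
        · exact (h2 _ _).trans (by omega)
        · exact (h2 _ _).trans (by omega)
        · exact (h2 _ _).trans ((MvPolynomial.totalDegree_mul _ _).trans (by omega))
      omega
    · have e := (h.cases_eq i i).2.1
      have key := jet_sq_mul_of_edge (Ω := Ω) (ℓ := ℓ) (j := i + 1) hw
        (by rw [eval_one_sub, map_add, a2, b2]; norm_num)
        (by rw [e, eval_one_sub, map_add, a3, b3]; norm_num)
      rw [e] at key
      rcases (h.cases_eq i j).1 with rfl | rfl | rfl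
      · exact (hji rfl).elim
      · exact (key _).1
      · exact (key _).2
  · obtain ⟨a4, b4⟩ := eval_fourth_coordU h i true
    simp only [← hd, if_true] at a4 b4
    obtain ⟨α, β, γ, δ, hj⟩ := d.exists_jet_eq
      (F := (1 - d.coordU) ^ 2 * (1 - d.other.coordU) ^ 2)
      (by simp [eval_start_coordU, eval_start_other_coordU]) c
    refine ⟨_, ?_, hj, fun j hji => ?_⟩
    · rw [ConvexPolygon.mem_polySpace_rectangle h]
      intro j
      have hdeg := degreeOf_inCornerCoords_coordU (d := d) h j
      simp only [map_mul, map_add, map_pow, map_sub, map_one, MvPolynomial.algHom_C,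
        MvPolynomial.algebraMap_eq]
      generalize (Ω ℓ).inCornerCoords d.coordU = u at *
      generalize (Ω ℓ).inCornerCoords d.other.coordU = v at *
      have h1 : ∀ f : MvPolynomial (Fin 2) ℝ, ((1 - f) ^ 2).degreeOf j ≤ 2 * f.degreeOf j :=
        fun f => (MvPolynomial.degreeOf_pow_le _ _ _).trans
          (Nat.mul_le_mul_left _ ((MvPolynomial.degreeOf_sub_le _ _ _).trans (by simp)))
      have h2 := h1 u
      have h3 := h1 v
      have h4 := MvPolynomial.degreeOf_mul_le j u v
      refine (MvPolynomial.degreeOf_mul_le _ _ _).trans (le_trans (add_le_add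
        (MvPolynomial.degreeOf_mul_le _ _ _) ((MvPolynomial.degreeOf_add_le _ _ _).trans (max_le
          ((MvPolynomial.degreeOf_add_le _ _ _).trans (max_le
            ((MvPolynomial.degreeOf_add_le _ _ _).trans (max_le (c := 1) ?_ ?_)) ?_)) ?_))) ?_)
      · simp
      · exact (MvPolynomial.degreeOf_C_mul_le _ _ _).trans (by omega)
      · exact (MvPolynomial.degreeOf_C_mul_le _ _ _).trans (by omega)
      · exact (MvPolynomial.degreeOf_C_mul_le _ _ _).trans (by omega)
      · omega
    · have e := (h.cases_eq i i).2.1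
      -- The factor (1 - u)² takes care of the two vertices on u = 1, the factor (1 - v)² of the two
      -- vertices on v = 1.
      have k1 := jet_sq_mul_of_edge (Ω := Ω) (ℓ := ℓ) (j := i + 1) hu.one_sub
        (by rw [eval_one_sub, a2]; norm_num) (by rw [eval_one_sub, a4]; norm_num)
      have k2 := jet_sq_mul_of_edge (Ω := Ω) (ℓ := ℓ) (j := i + 1 + 1) hv.one_sub
        (by rw [eval_one_sub, b4]; norm_num) (by rw [e, eval_one_sub, b3]; norm_num)
      rw [e] at k2
      rcases (h.cases_eq i j).1 with rfl | rfl | rfl | rfl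
      · exact (hji rfl).elim
      · rw [mul_assoc]; exact (k1 _).1
      · rw [mul_comm ((1 - d.coordU) ^ 2), mul_assoc]; exact (k2 _).2
      · rw [mul_assoc]; exact (k1 _).2

theorem restrict_aeval_coordU (d : Dart Ω) (p : ℝ[X]) : d.restrict (aeval d.coordU p) = p := by
  rw [← aeval_algHom_apply, restrict_coordU, aeval_X_left_apply]

/-- The function is u²(1 - u - v)²(p(u) + v q(u)), with a double zero on each of the other two
sides. The term with p in the transverse derivative comes from differentiating (1 - u - v)². -/
theorem exists_edge_function_triangle {d : Dart Ω} (h : (Ω d.poly).IsTriangle) {k : ℕ}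
    {p q : ℝ[X]} (hp : p.natDegree + 4 ≤ k) (hq : q.natDegree + 5 ≤ k) :
    ∃ g ∈ (Ω d.poly).polySpace k, d.restrict g = X ^ 2 * (1 - X) ^ 2 * p ∧
      d.restrict (dirDeriv d.dirV g) = X ^ 2 * (1 - X) ^ 2 * q - 2 * X ^ 2 * (1 - X) * p ∧
      ∀ (j : Fin ((Ω d.poly).m + 3)) (b : Bool) (w : Plane), j ≠ d.idx →
        (⟨d.poly, j, b⟩ : Dart Ω).restrict g = 0 ∧
        (⟨d.poly, j, b⟩ : Dart Ω).restrict (dirDeriv w g) = 0 := by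
  have hu := d.isAffineForm_coordU
  have hv := d.other.isAffineForm_coordU
  have hw : IsAffineForm (1 - (d.coordU + d.other.coordU)) := (hu.add hv).one_sub
  refine ⟨d.coordU ^ 2 * ((1 - (d.coordU + d.other.coordU)) ^ 2 *
    (aeval d.coordU p + d.other.coordU * aeval d.coordU q)), ?_, ?_, ?_, ?_⟩
  · rw [ConvexPolygon.mem_polySpace_triangle h]
    have h1 := MvPolynomial.totalDegree_pow d.coordU 2
    have h2 := MvPolynomial.totalDegree_pow (1 - (d.coordU + d.other.coordU)) 2
    have hu' := hu.totalDegree_le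
    have hv' := hv.totalDegree_le
    have hw' := hw.totalDegree_le
    have h3 : (aeval d.coordU p + d.other.coordU * aeval d.coordU q).totalDegree + 4 ≤ k := by
      refine le_trans (add_le_add_left (MvPolynomial.totalDegree_add _ _) 4) ?_
      have h4 := totalDegree_aeval_le p hu'
      have h5 := totalDegree_aeval_le q hu'
      have h6 := MvPolynomial.totalDegree_mul d.other.coordU (aeval d.coordU q)
      omega
    have h4 := MvPolynomial.totalDegree_mul ((1 - (d.coordU + d.other.coordU)) ^ 2)
      (aeval d.coordU p + d.other.coordU * aeval d.coordU q)
    refine (MvPolynomial.totalDegree_mul _ _).trans ?_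
    omega
  · simp only [map_mul, map_pow, map_sub, map_one, map_add, restrict_coordU,
      restrict_other_coordU, restrict_aeval_coordU]
    ring
  · simp only [Derivation.leibniz, Derivation.leibniz_pow, map_mul, map_pow, map_sub, map_one,
      map_add, restrict_coordU, dirDeriv_aeval, dirDeriv_dirV_coordU, dirDeriv_dirV_other_coordU,
      restrict_other_coordU, restrict_aeval_coordU, smul_eq_mul, nsmul_eq_mul, map_zero,
      Derivation.map_one_eq_zero, map_natCast]
    push_cast
    ring
  · intro j b w hj
    obtain ⟨ℓ, i, b'⟩ := d
    obtain ⟨a1, a2, a3⟩ := eval_vertex_coordU (Ω := Ω) ℓ i b'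
    obtain ⟨b1, b2, b3⟩ := eval_vertex_other_coordU (Ω := Ω) ℓ i b'
    obtain ⟨hc, e, -⟩ := h.cases_eq i j
    change j ≠ i at hj
    change IsAffineForm _ at hw hu hv
    set u := (⟨ℓ, i, b'⟩ : Dart Ω).coordU
    set v := (⟨ℓ, i, b'⟩ : Dart Ω).other.coordU
    have key : (⟨ℓ, j, b⟩ : Dart Ω).restrict u = 0 ∨
        (⟨ℓ, j, b⟩ : Dart Ω).restrict (1 - (u + v)) = 0 := by
      rcases hc with hc | rfl | rfl
      · exact (hj hc).elim
      · cases b' <;> simp only [if_true, Bool.false_eq_true, if_false, e] at a1 a2 a3 b1 b2 b3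
        · exact Or.inl (restrict_eq_zero_of_isAffineForm hu a2 (e ▸ a3))
        · refine Or.inr (restrict_eq_zero_of_isAffineForm hw ?_ ?_)
          · rw [eval_one_sub, map_add, a2, b2]; norm_num
          · rw [e, eval_one_sub, map_add, a3, b3]; norm_num
      · cases b' <;> simp only [if_true, Bool.false_eq_true, if_false, e] at a1 a2 a3 b1 b2 b3
        · refine Or.inr (restrict_eq_zero_of_isAffineForm hw ?_ ?_)
          · rw [eval_one_sub, map_add, a3, b3]; norm_num
          · rw [sub_add_cancel, eval_one_sub, map_add, a1, b1]; norm_num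
        · exact Or.inl (restrict_eq_zero_of_isAffineForm hu a3 (by rw [sub_add_cancel]; exact a1))
    rcases key with key | key
    · exact restrict_sq_mul key _ w
    · rw [mul_left_comm]; exact restrict_sq_mul key _ w

/-- The function is u²(1 - u)²(1 - v)²(p(u) + v(q(u) + 2p(u))); the summand 2p cancels the
derivative of (1 - v)² at v = 0. In contrast to the triangle, q may have degree k - 4. -/
theorem exists_edge_function_rectangle {d : Dart Ω} (h : (Ω d.poly).IsRectangle) {k : ℕ}
    {p q : ℝ[X]} (hp : p.natDegree + 4 ≤ k) (hq : q.natDegree + 4 ≤ k) :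
    ∃ g ∈ (Ω d.poly).polySpace k, d.restrict g = X ^ 2 * (1 - X) ^ 2 * p ∧
      d.restrict (dirDeriv d.dirV g) = X ^ 2 * (1 - X) ^ 2 * q ∧
      ∀ (j : Fin ((Ω d.poly).m + 3)) (b : Bool) (w : Plane), j ≠ d.idx →
        (⟨d.poly, j, b⟩ : Dart Ω).restrict g = 0 ∧
        (⟨d.poly, j, b⟩ : Dart Ω).restrict (dirDeriv w g) = 0 := by
  have hu := d.isAffineForm_coordU
  have hv := d.other.isAffineForm_coordU
  refine ⟨d.coordU ^ 2 * ((1 - d.coordU) ^ 2 * ((1 - d.other.coordU) ^ 2 *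
    (aeval d.coordU p + d.other.coordU * aeval d.coordU (q + 2 * p)))), ?_, ?_, ?_, ?_⟩
  · rw [ConvexPolygon.mem_polySpace_rectangle h]
    intro j
    have hdeg := degreeOf_inCornerCoords_coordU h j
    simp only [map_mul, map_add, map_pow, map_sub, map_one, ← aeval_algHom_apply]
    rw [← map_mul, ← map_add]
    generalize (Ω d.poly).inCornerCoords d.coordU = u at *
    generalize (Ω d.poly).inCornerCoords d.other.coordU = v at *
    have h1 : ∀ f : MvPolynomial (Fin 2) ℝ, ((1 - f) ^ 2).degreeOf j ≤ 2 * f.degreeOf j :=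
      fun f => (MvPolynomial.degreeOf_pow_le _ _ _).trans
        (Nat.mul_le_mul_left _ ((MvPolynomial.degreeOf_sub_le _ _ _).trans (by simp)))
    have hq' : (q + 2 * p).natDegree + 4 ≤ k := by
      have h2 : (2 * p).natDegree ≤ p.natDegree := 
        natDegree_mul_le.trans (by simp)
      have := natDegree_add_le q (2 * p)
      omega
    have h0 := MvPolynomial.degreeOf_pow_le j u 2
    have h2 := h1 u
    have h3 := h1 v
    have h4 := degreeOf_aeval_le p u j
    have h5 := degreeOf_aeval_le (q + 2 * p) u j
    have h6 := MvPolynomial.degreeOf_mul_le j v (aeval u (q + 2 * p))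
    have h7 := MvPolynomial.degreeOf_add_le j (aeval u p) (v * aeval u (q + 2 * p))
    have h8 := MvPolynomial.degreeOf_mul_le j ((1 - v) ^ 2)
      (aeval u p + v * aeval u (q + 2 * p))
    have h9 := MvPolynomial.degreeOf_mul_le j ((1 - u) ^ 2)
      ((1 - v) ^ 2 * (aeval u p + v * aeval u (q + 2 * p)))
    have h10 := MvPolynomial.degreeOf_mul_le j (u ^ 2)
      ((1 - u) ^ 2 * ((1 - v) ^ 2 * (aeval u p + v * aeval u (q + 2 * p))))
    -- If u does not involve the variable j, only the powers of v count and the degree is at most 3;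
    -- otherwise v does not involve it, and the degree is at most 4 plus that of p or q + 2p.
    rcases (by omega : u.degreeOf j = 0 ∨ (u.degreeOf j = 1 ∧ v.degreeOf j = 0)) with e | ⟨e, e'⟩
    · rw [e] at h4 h5
      omega
    · rw [e] at h4 h5
      omega
  · simp only [map_mul, map_pow, map_sub, map_one, map_add, restrict_coordU,
      restrict_other_coordU, restrict_aeval_coordU]
    ring
  · simp only [Derivation.leibniz, Derivation.leibniz_pow, map_mul, map_pow, map_sub, map_one,
      map_add, restrict_coordU, dirDeriv_aeval, dirDeriv_dirV_coordU, dirDeriv_dirV_other_coordU,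
      restrict_other_coordU, restrict_aeval_coordU, smul_eq_mul, nsmul_eq_mul, map_zero,
      Derivation.map_one_eq_zero, map_natCast, map_ofNat]
    push_cast
    ring
  · intro j b w hj
    obtain ⟨ℓ, i, b'⟩ := d
    obtain ⟨a1, a2, a3⟩ := eval_vertex_coordU (Ω := Ω) ℓ i b'
    obtain ⟨b1, b2, b3⟩ := eval_vertex_other_coordU (Ω := Ω) ℓ i b'
    obtain ⟨a4, b4⟩ := eval_fourth_coordU h i b'
    obtain ⟨hc, e, -⟩ := h.cases_eq i j
    change j ≠ i at hj
    set u := (⟨ℓ, i, b'⟩ : Dart Ω).coordU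
    set v := (⟨ℓ, i, b'⟩ : Dart Ω).other.coordU
    have key : (⟨ℓ, j, b⟩ : Dart Ω).restrict u = 0 ∨
        (⟨ℓ, j, b⟩ : Dart Ω).restrict (1 - u) = 0 ∨
        (⟨ℓ, j, b⟩ : Dart Ω).restrict (1 - v) = 0 := by
      rcases hc with hc | rfl | rfl | rfl
      · exact (hj hc).elim
      · cases b' <;> simp only [if_true, Bool.false_eq_true, if_false] at a1 a2 a3 a4 b3 b4
        · exact Or.inl (restrict_eq_zero_of_isAffineForm hu a2 a3)
        · exact Or.inr (Or.inl (restrict_eq_zero_of_isAffineForm hu.one_sub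
            (by rw [eval_one_sub, a2, sub_self]) (by rw [eval_one_sub, a4, sub_self])))
      · cases b' <;> simp only [if_true, Bool.false_eq_true, if_false] at a1 a2 a3 a4 b3 b4
        · exact Or.inr (Or.inl (restrict_eq_zero_of_isAffineForm hu.one_sub
            (by rw [eval_one_sub, a4, sub_self])
            (by rw [sub_add_cancel, eval_one_sub, a1, sub_self])))
        · exact Or.inl (restrict_eq_zero_of_isAffineForm hu a3 (by rw [sub_add_cancel]; exact a1))
      · refine Or.inr (Or.inr (restrict_eq_zero_of_isAffineForm hv.one_sub ?_ ?_))
        all_goals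
          cases b' <;> simp only [if_true, Bool.false_eq_true, if_false] at b3 b4 <;>
            simp only [e, eval_one_sub, b3, b4, sub_self]
    rcases key with key | key | key
    · exact restrict_sq_mul key _ w
    · rw [mul_left_comm]; exact restrict_sq_mul key _ w
    · rw [mul_left_comm ((1 - u) ^ 2), mul_left_comm]; exact restrict_sq_mul key _ w

open Classical in
/-- A polynomial function with prescribed values and normal derivatives on one edge, which vanishes
doubly on all other edges. -/
theorem exists_edge_function {d : Dart Ω} (h : (Ω d.poly).IsTriangle ∨ (Ω d.poly).IsRectangle)
    {k : ℕ} {p q : ℝ[X]} (hp : p.natDegree + 4 ≤ k)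
    (hq : q.natDegree + 5 ≤ k + (Ω d.poly).rectIndicator) :
    ∃ g ∈ (Ω d.poly).polySpace k, d.restrict g = X ^ 2 * (1 - X) ^ 2 * p ∧
      d.restrict (dirDeriv d.dirV g) =
        X ^ 2 * (1 - X) ^ 2 * q - C d.revR * (2 * X ^ 2 * (1 - X) * p) ∧
      ∀ (j : Fin ((Ω d.poly).m + 3)) (b : Bool) (w : Plane), j ≠ d.idx →
        (⟨d.poly, j, b⟩ : Dart Ω).restrict g = 0 ∧
        (⟨d.poly, j, b⟩ : Dart Ω).restrict (dirDeriv w g) = 0 := by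
  rcases h with h | h
  · rw [ConvexPolygon.rectIndicator, if_neg h.not_isRectangle] at hq
    rw [revR_triangle h, C_1, one_mul]
    exact exists_edge_function_triangle h hp hq
  · rw [ConvexPolygon.rectIndicator, if_pos h] at hq
    rw [revR_rectangle h, C_0, zero_mul, sub_zero]
    exact exists_edge_function_rectangle h hp (by omega)

end Dart

/-! ### Polynomials along an edge -/

theorem exists_hermite (w0 w1 w2 w3 : ℝ) : ∃ W : ℝ[X], W.natDegree ≤ 3 ∧ W.eval 0 = w0 ∧
    (derivative W).eval 0 = w1 ∧ W.eval 1 = w2 ∧ (derivative W).eval 1 = w3 := by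
  refine ⟨C w0 + C w1 * X + C (3 * w2 - w3 - 3 * w0 - 2 * w1) * X ^ 2
    + C (w3 - 2 * w2 + w1 + 2 * w0) * X ^ 3, by compute_degree, ?_, ?_, ?_, ?_⟩ <;>
  simp <;> ring

theorem exists_eq_mul_of_double_roots {k : ℕ} (hk : 4 ≤ k) {V : ℝ[X]} (hV : V.natDegree ≤ k)
    (h0 : V.eval 0 = 0) (h0' : (derivative V).eval 0 = 0) (h1 : V.eval 1 = 0)
    (h1' : (derivative V).eval 1 = 0) :
    ∃ Q : ℝ[X], V = X ^ 2 * (1 - X) ^ 2 * Q ∧ Q.natDegree + 4 ≤ k := by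
  have key : ∀ t : ℝ, V.eval t = 0 → (derivative V).eval t = 0 → (X - C t) ^ 2 ∣ V := by
    intro t e e'
    obtain ⟨q, hq⟩ := dvd_iff_isRoot.2 e
    rw [hq] at e'
    simp only [derivative_mul, eval_add, eval_mul, derivative_sub, derivative_X, derivative_C,
      eval_sub, eval_X, eval_C, eval_one, eval_zero] at e'
    obtain ⟨r, hr⟩ := dvd_iff_isRoot.2 (show q.IsRoot t by rw [IsRoot]; linarith)
    exact ⟨r, by rw [hq, hr]; ring⟩
  have hco : IsCoprime ((X - C (0 : ℝ)) ^ 2) ((X - C (1 : ℝ)) ^ 2) :=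
    (isCoprime_X_sub_C_of_isUnit_sub (by simp)).pow
  obtain ⟨Q, hQ⟩ := hco.mul_dvd (key 0 h0 h0') (key 1 h1 h1')
  refine ⟨Q, by rw [hQ, C_0, C_1]; ring, ?_⟩
  -- The zero polynomial has `natDegree` 0, which is why 4 ≤ k is required.
  by_cases hz : Q = 0
  · simpa [hz] using hk
  · have hm : ((X - C (0 : ℝ)) ^ 2 * (X - C (1 : ℝ)) ^ 2).Monic :=
      ((monic_X_sub_C _).pow 2).mul ((monic_X_sub_C _).pow 2)
    rw [hQ, hm.natDegree_mul' hz, natDegree_mul (pow_ne_zero _ (X_sub_C_ne_zero _))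
      (pow_ne_zero _ (X_sub_C_ne_zero _)), natDegree_pow, natDegree_pow, natDegree_X_sub_C,
      natDegree_X_sub_C] at hV
    omega

/-- The case of two triangles. -/
theorem exists_edge_solution_triangles {k : ℕ} (hk : 6 ≤ k) {a b c V : ℝ[X]}
    (ha1 : a.natDegree ≤ 1) (hb1 : b.natDegree ≤ 1) (hc1 : c.natDegree ≤ 1)
    (hmax : a.natDegree = 1 ∨ b.natDegree = 1 ∨ c.natDegree = 1)
    (hco : ∀ p, p ∣ a → p ∣ b → p ∣ c → IsUnit p)
    (ha : ∀ t ∈ Icc (0 : ℝ) 1, a.eval t ≠ 0) (hV : V.natDegree + 4 ≤ k) :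
    ∃ p q₁ q₂ : ℝ[X], p.natDegree + 4 ≤ k ∧ q₁.natDegree + 5 ≤ k ∧ q₂.natDegree + 5 ≤ k ∧
      X ^ 2 * (1 - X) ^ 2 * V = X ^ 2 * (1 - X) ^ 2 * (a * q₁ - c * q₂)
        - (a - c) * (2 * X ^ 2 * (1 - X) * p) - b * derivative (X ^ 2 * (1 - X) ^ 2 * p) := by
  obtain ⟨a1, a0, rfl⟩ := exists_eq_X_add_C_of_natDegree_le_one ha1
  obtain ⟨b1, b0, rfl⟩ := exists_eq_X_add_C_of_natDegree_le_one hb1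
  obtain ⟨c1, c0, rfl⟩ := exists_eq_X_add_C_of_natDegree_le_one hc1
  have ha0 : a0 ≠ 0 := by simpa using ha 0 (by simp)
  -- The determinant decides whether a and c span all polynomials of degree at most one. If not, c
  -- is a constant multiple of a, so q₁ and q₂ produce only multiples of a, and p has to remove the
  -- one remaining obstruction.
  by_cases hD : a0 * c1 - a1 * c0 = 0
  · have hcp : (C c1 * X + C c0 : ℝ[X]) = C (c0 / a0) * (C a1 * X + C a0) := by
      have e1 : c1 = c0 / a0 * a1 := by field_simp; linarith
      have e0 : c0 = c0 / a0 * a0 := by field_simp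
      rw [mul_add, ← mul_assoc, ← C_mul, ← C_mul, ← e1, ← e0]
    by_cases ha1' : a1 = 0
    · obtain rfl : a1 = 0 := ha1'
      obtain rfl : c1 = 0 := by
        rcases mul_eq_zero.1 (show a0 * c1 = 0 by linarith) with h | h
        · exact (ha0 h).elim
        · exact h
      have hb1' : b1 ≠ 0 := by
        rintro rfl
        simp at hmax
      obtain ⟨n, rfl⟩ := Nat.exists_eq_add_of_le' hk
      -- Here a and c are constant and b is linear, so only the coefficient of degree n + 2 = k - 4
      -- is out of reach of q₁. M is the contribution of p = X(1 - X)Xⁿ divided by X²(1 - X)²; its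
      -- coefficient in that degree is b₁(n + 6) ≠ 0.
      set M : ℝ[X] := -(2 * X ^ (n + 1) * (C a0 - C c0))
        - (C b1 * X + C b0) * (C (n + 3 : ℝ) * X ^ n - C (n + 6 : ℝ) * X ^ (n + 1)) with hM
      have hMc : M.coeff (n + 2) = b1 * (n + 6) := by
        have : M = C (b1 * (n + 6)) * X ^ (n + 2) + C (-2 * (a0 - c0) - b1 * (n + 3)
            + b0 * (n + 6)) * X ^ (n + 1) + C (-(b0 * (n + 3))) * X ^ n := by
          rw [hM]
          simp only [C_mul, C_add, C_sub, C_neg, map_natCast, map_ofNat]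
          ring
        rw [this]
        simp only [coeff_add, coeff_C_mul_X_pow]
        simp
      have hMd : M.natDegree ≤ n + 2 := by
        rw [hM]
        compute_degree!
        omega
      have hb6 : b1 * ((n : ℝ) + 6) ≠ 0 := mul_ne_zero hb1' (by positivity)
      set s := V.coeff (n + 2) / (b1 * (n + 6)) with hs
      have hQ : (V - C s * M).natDegree + 5 ≤ n + 6 := by
        have h1 : (V - C s * M).natDegree ≤ n + 2 :=
          (natDegree_sub_le _ _).trans (max_le (by omega)
            ((natDegree_C_mul_le _ _).trans hMd))
        have h2 : (V - C s * M).coeff (n + 2) = 0 := by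
          rw [coeff_sub, coeff_C_mul, hMc, hs, div_mul_cancel₀ _ hb6, sub_self]
        rcases h1.lt_or_eq with h | h
        · omega
        · rw [← h, coeff_natDegree, leadingCoeff_eq_zero] at h2
          rw [h2]; simp
      refine ⟨C s * (X * (1 - X) * X ^ n), C a0⁻¹ * (V - C s * M), 0, ?_, ?_, by simp, ?_⟩
      · have : (C s * (X * (1 - X) * X ^ n)).natDegree ≤ 2 + n := by compute_degree!
        omega
      · have := natDegree_C_mul_le a0⁻¹ (V - C s * M)
        omega
      · have e : C a0 * C a0⁻¹ = (1 : ℝ[X]) := by rw [← C_mul, mul_inv_cancel₀ ha0, C_1]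
        have e2 : derivative (X ^ 2 * (1 - X) ^ 2 * (C s * (X * (1 - X) * X ^ n))) =
            X ^ 2 * (1 - X) ^ 2 * C s * (C (n + 3 : ℝ) * X ^ n - C (n + 6 : ℝ) * X ^ (n + 1)) := by
          rw [show X ^ 2 * (1 - X) ^ 2 * (C s * (X * (1 - X) * X ^ n)) =
            C s * (X ^ (n + 3) * (1 - X) ^ 3 : ℝ[X]) by ring]
          simp only [derivative_mul, derivative_C, derivative_X_pow, derivative_pow,
            derivative_sub, derivative_one, derivative_X, map_natCast, map_ofNat, map_add,
            Nat.add_sub_cancel]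
          push_cast
          ring
        rw [e2]
        simp only [C_0, zero_mul, zero_add, mul_zero, sub_zero]
        rw [← mul_assoc (C a0), e, hM]
        ring
    -- Now the obstruction is the value at the root u of a, which is outside [0, 1]; b(u) ≠ 0, as
    -- otherwise X - u would divide a, b and c.
    · set u := -a0 / a1 with hu
      have hau : a1 * u + a0 = 0 := by rw [hu]; field_simp; ring
      have hu01 : u ∉ Icc (0 : ℝ) 1 := fun h => ha u h (by simpa using hau)
      have hbu : b1 * u + b0 ≠ 0 := by
        intro hb
        have hd : ∀ x1 x0 : ℝ, x1 * u + x0 = 0 → (X - C u) ∣ (C x1 * X + C x0) := fun x1 x0 h =>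
          dvd_iff_isRoot.2 (by simpa using h)
        refine not_isUnit_X_sub_C u (hco _ (hd _ _ hau) (hd _ _ hb) ?_)
        rw [hcp]
        exact (hd _ _ hau).mul_left _
      -- The contribution of p = X(1 - X), divided by X²(1 - X)². Its degree 2 must be at most k -
      -- 4, that is, k ≥ 6. Since a and c vanish at u, M(u) = -3 b(u)(1 - 2u), which is non-zero
      -- because u ≠ 1/2.
      set M : ℝ[X] := -(2 * X * ((C a1 * X + C a0) - (C c1 * X + C c0)))
        - 3 * (C b1 * X + C b0) * (1 - 2 * X) with hM
      have hMu : M.eval u ≠ 0 := by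
        have : M.eval u = -3 * (b1 * u + b0) * (1 - 2 * u) := by
          rw [hM, hcp]
          simp [hau]
        rw [this]
        refine mul_ne_zero (mul_ne_zero (by norm_num) hbu) fun h => hu01 ?_
        constructor <;> linarith
      set s := V.eval u / M.eval u with hs
      obtain ⟨Q, hQ⟩ := dvd_iff_isRoot.2 (show (V - C s * M).IsRoot u by
        rw [IsRoot, eval_sub, eval_mul, eval_C, hs, div_mul_cancel₀ _ hMu, sub_self])
      have hQd : Q.natDegree + 5 ≤ k := by
        have hMd : M.natDegree ≤ 2 := by
          rw [hM]
          compute_degree!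
        have h1 : (V - C s * M).natDegree ≤ k - 4 :=
          (natDegree_sub_le _ _).trans (max_le (by omega)
            ((natDegree_C_mul_le _ _).trans (by omega)))
        by_cases hz : Q = 0
        · simp [hz]; omega
        · rw [hQ, natDegree_mul (X_sub_C_ne_zero u) hz, natDegree_X_sub_C] at h1
          omega
      refine ⟨C s * (X * (1 - X)), C a1⁻¹ * Q, 0, ?_, ?_, by simp; omega, ?_⟩
      · have : (C s * (X * (1 - X))).natDegree ≤ 2 := by compute_degree!
        omega
      · have := natDegree_C_mul_le a1⁻¹ Q
        omega
      · have hfac : (C a1 * X + C a0) * C a1⁻¹ = X - C u := by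
          have e : C a1 * C a1⁻¹ = (1 : ℝ[X]) := by rw [← C_mul, mul_inv_cancel₀ ha1', C_1]
          have e2 : C u = - (C a0 * C a1⁻¹ : ℝ[X]) := by
            rw [hu, ← C_mul, ← C_neg, div_eq_mul_inv, neg_mul]
          rw [e2]
          linear_combination X * e
        have hVe : V = (X - C u) * Q + C s * M := by rw [← hQ]; ring
        have e2 : derivative (X ^ 2 * (1 - X) ^ 2 * (C s * (X * (1 - X)))) =
            X ^ 2 * (1 - X) ^ 2 * C s * (3 * (1 - 2 * X)) := by
          rw [show X ^ 2 * (1 - X) ^ 2 * (C s * (X * (1 - X))) =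
            C s * (X ^ 3 * (1 - X) ^ 3 : ℝ[X]) by ring]
          simp only [derivative_mul, derivative_C, derivative_X_pow, derivative_pow,
            derivative_sub, derivative_one, derivative_X, map_natCast]
          push_cast
          ring
        rw [e2, mul_zero, sub_zero, ← mul_assoc (C a1 * X + C a0), hfac]
        conv_lhs => rw [hVe, hM]
        ring
  -- With D the determinant, c₁a - a₁c = D and a₀c - c₀a = D X. Writing V = X · V.divX + V(0), the
  -- factors q₁, q₂ have degree at most k - 5, and p = 0 suffices.
  · have e : (C (a0 * c1 - a1 * c0) : ℝ[X]) * C (a0 * c1 - a1 * c0)⁻¹ = 1 := by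
      rw [← C_mul, mul_inv_cancel₀ hD, C_1]
    have hdX : V.divX.natDegree + 5 ≤ k := by
      rw [natDegree_divX_eq_natDegree_tsub_one]
      omega
    refine ⟨0, C (a0 * c1 - a1 * c0)⁻¹ * (C c1 * C (V.coeff 0) - C c0 * V.divX),
      C (a0 * c1 - a1 * c0)⁻¹ * (C a1 * C (V.coeff 0) - C a0 * V.divX), by simp; omega, ?_, ?_, ?_⟩
    · have := natDegree_C_mul_le (a0 * c1 - a1 * c0)⁻¹ (C c1 * C (V.coeff 0) - C c0 * V.divX)
      have h2 := natDegree_sub_le (C c1 * C (V.coeff 0)) (C c0 * V.divX)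
      have h3 := natDegree_C_mul_le c0 V.divX
      rw [← C_mul, natDegree_C] at h2
      rw [← C_mul] at this ⊢
      omega
    · have := natDegree_C_mul_le (a0 * c1 - a1 * c0)⁻¹ (C a1 * C (V.coeff 0) - C a0 * V.divX)
      have h2 := natDegree_sub_le (C a1 * C (V.coeff 0)) (C a0 * V.divX)
      have h3 := natDegree_C_mul_le a0 V.divX
      rw [← C_mul, natDegree_C] at h2
      rw [← C_mul] at this ⊢
      omega
    · simp only [mul_zero, derivative_zero, sub_zero]
      conv_lhs => rw [← X_mul_divX_add V]
      simp only [C_sub, C_mul] at e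
      linear_combination -(X ^ 2 * (1 - X) ^ 2 * (X * V.divX + C (V.coeff 0))) * e

/-- If one of the polygons is a rectangle, δ = 1 forces the corresponding a or c to be a non-zero
constant, and the corresponding q may have degree k - 4; dividing V by this constant is enough. Only
two triangles need p. -/
theorem exists_edge_solution {k : ℕ} (hk : 6 ≤ k) {a b c V : ℝ[X]} {r₁ r₂ : ℕ} {R₁ R₂ : ℝ}
    (h₁ : r₁ = 1 ∧ R₁ = 0 ∨ r₁ = 0 ∧ R₁ = 1) (h₂ : r₂ = 1 ∧ R₂ = 0 ∨ r₂ = 0 ∧ R₂ = 1)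
    (hδ : max (max (r₁ + a.natDegree) b.natDegree) (r₂ + c.natDegree) = 1)
    (hco : ∀ p, p ∣ a → p ∣ b → p ∣ c → IsUnit p)
    (ha : ∀ t ∈ Icc (0 : ℝ) 1, a.eval t ≠ 0) (hc : ∀ t ∈ Icc (0 : ℝ) 1, c.eval t ≠ 0)
    (hV : V.natDegree + 4 ≤ k) :
    ∃ p q₁ q₂ : ℝ[X], p.natDegree + 4 ≤ k ∧ q₁.natDegree + 5 ≤ k + r₁ ∧
      q₂.natDegree + 5 ≤ k + r₂ ∧
      X ^ 2 * (1 - X) ^ 2 * V = X ^ 2 * (1 - X) ^ 2 * (a * q₁ - c * q₂)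
        - (C R₁ * a - C R₂ * c) * (2 * X ^ 2 * (1 - X) * p)
        - b * derivative (X ^ 2 * (1 - X) ^ 2 * p) := by
  have hle := hδ.le
  simp only [max_le_iff] at hle
  obtain ⟨⟨hda, hdb⟩, hdc⟩ := hle
  have const : ∀ f : ℝ[X], f.natDegree = 0 → (∀ t ∈ Icc (0 : ℝ) 1, f.eval t ≠ 0) →
      ∃ x : ℝ, f * C x = 1 := by
    intro f hf h
    rw [eq_C_of_natDegree_eq_zero hf] at h ⊢
    refine ⟨(f.coeff 0)⁻¹, ?_⟩
    rw [← C_mul, mul_inv_cancel₀ (by simpa using h 0 (by simp)), C_1]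
  rcases h₁ with ⟨rfl, rfl⟩ | ⟨rfl, rfl⟩
  · obtain ⟨x, hx⟩ := const a (by omega) ha
    refine ⟨0, C x * V, 0, by simp; omega, ?_, by simp; omega, ?_⟩
    · have := natDegree_C_mul_le x V
      omega
    · simp only [mul_zero, derivative_zero, sub_zero]
      linear_combination -(X ^ 2 * (1 - X) ^ 2 * V) * hx
  · rcases h₂ with ⟨rfl, rfl⟩ | ⟨rfl, rfl⟩
    · obtain ⟨x, hx⟩ := const c (by omega) hc
      refine ⟨0, 0, -(C x * V), by simp; omega, by simp; omega, ?_, ?_⟩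
      · have := natDegree_C_mul_le x V
        rw [natDegree_neg]
        omega
      · simp only [mul_zero, derivative_zero, sub_zero]
        linear_combination -(X ^ 2 * (1 - X) ^ 2 * V) * hx
    · simp only [C_1, one_mul]
      refine exists_edge_solution_triangles hk (by omega) hdb (by omega) ?_ hco ha hV
      by_contra hcon
      push Not at hcon
      obtain ⟨x1, x2, x3⟩ := hcon
      have : max (max (0 + a.natDegree) b.natDegree) (0 + c.natDegree) < 1 := by
        simp only [max_lt_iff]; omega
      omega

/-- Solvability of the gluing conditions along one edge, when all conditions at the end points are
satisfied. -/
theorem exists_edge_data {k : ℕ} (hk : 6 ≤ k) {a b c V W : ℝ[X]} {r₁ r₂ : ℕ} {R₁ R₂ : ℝ}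
    (h₁ : r₁ = 1 ∧ R₁ = 0 ∨ r₁ = 0 ∧ R₁ = 1) (h₂ : r₂ = 1 ∧ R₂ = 0 ∨ r₂ = 0 ∧ R₂ = 1)
    (hδ : max (max (r₁ + a.natDegree) b.natDegree) (r₂ + c.natDegree) = 1)
    (hco : ∀ p, p ∣ a → p ∣ b → p ∣ c → IsUnit p)
    (ha : ∀ t ∈ Icc (0 : ℝ) 1, a.eval t ≠ 0) (hc : ∀ t ∈ Icc (0 : ℝ) 1, c.eval t ≠ 0)
    (hW : W.natDegree ≤ k) (hV : V.natDegree ≤ k)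
    (hW0 : W.eval 0 = 0) (hW0' : (derivative W).eval 0 = 0)
    (hW1 : W.eval 1 = 0) (hW1' : (derivative W).eval 1 = 0)
    (hV0 : V.eval 0 = 0) (hV0' : b.eval 0 = 0 → (derivative V).eval 0 = 0)
    (hV1 : V.eval 1 = 0)
    (hV1' : R₁ * a.eval 1 - R₂ * c.eval 1 - b.eval 1 = 0 →
      (derivative V).eval 1 = R₁ * a.eval 1 * (derivative (derivative W)).eval 1) :
    ∃ p₁ p₂ q₁ q₂ : ℝ[X], p₁.natDegree + 4 ≤ k ∧ p₂.natDegree + 4 ≤ k ∧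
      q₁.natDegree + 5 ≤ k + r₁ ∧ q₂.natDegree + 5 ≤ k + r₂ ∧
      W = X ^ 2 * (1 - X) ^ 2 * p₁ - X ^ 2 * (1 - X) ^ 2 * p₂ ∧
      V = a * (X ^ 2 * (1 - X) ^ 2 * q₁ - C R₁ * (2 * X ^ 2 * (1 - X) * p₁))
        - b * derivative (X ^ 2 * (1 - X) ^ 2 * p₂)
        - c * (X ^ 2 * (1 - X) ^ 2 * q₂ - C R₂ * (2 * X ^ 2 * (1 - X) * p₂)) := by
  have hle := hδ.le
  simp only [max_le_iff] at hle
  obtain ⟨⟨hda, hdb⟩, hdc⟩ := hle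
  -- The equation for W fixes p₁ - p₂ = P. Its effect on the transverse derivative is moved into V₁,
  -- so that only the common part p₂ of p₁ and p₂ remains to be chosen.
  obtain ⟨P, hP, hPd⟩ := exists_eq_mul_of_double_roots (by omega) hW hW0 hW0' hW1 hW1'
  have hW2 : (derivative (derivative W)).eval 1 = 2 * P.eval 1 := by
    rw [hP]
    simp [derivative_pow]
  set V₁ : ℝ[X] := V + a * (C R₁ * (2 * X ^ 2 * (1 - X) * P)) with hV₁
  have e00 : V₁.eval 0 = 0 := by simp [hV₁, hV0]
  have e01 : V₁.eval 1 = 0 := by simp [hV₁, hV1]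
  have e10 : (derivative V₁).eval 0 = (derivative V).eval 0 := by simp [hV₁]
  have e11 : (derivative V₁).eval 1 = (derivative V).eval 1 - 2 * (R₁ * a.eval 1) * P.eval 1 := by
    simp [hV₁]; ring
  -- V₁ vanishes at both ends; its derivatives there are removed by a linear common summand L with
  -- L(0) = x and L(1) = y. The denominators vanish exactly at joining ends, where nothing has to be
  -- corrected by the hypotheses on V' and the value of x or y is irrelevant.
  set x := -(derivative V₁).eval 0 / (2 * b.eval 0) with hx
  set y := (derivative V₁).eval 1 / (2 * (R₁ * a.eval 1 - R₂ * c.eval 1 - b.eval 1)) with hy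
  have hx' : (derivative V₁).eval 0 + 2 * b.eval 0 * x = 0 := by
    by_cases h : b.eval 0 = 0
    · rw [h, e10, hV0' h]; simp
    · rw [hx]; field_simp; ring
  have hy' : (derivative V₁).eval 1
      - 2 * (R₁ * a.eval 1 - R₂ * c.eval 1 - b.eval 1) * y = 0 := by
    by_cases h : R₁ * a.eval 1 - R₂ * c.eval 1 - b.eval 1 = 0
    · rw [h, e11, hV1' h, hW2]; ring
    · rw [hy, mul_div_cancel₀ _ (mul_ne_zero two_ne_zero h), sub_self]
  set L : ℝ[X] := C x + C (y - x) * X with hL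
  have hLd : L.natDegree ≤ 1 := by rw [hL]; compute_degree
  set V₂ : ℝ[X] := V₁ + (C R₁ * a - C R₂ * c) * (2 * X ^ 2 * (1 - X) * L)
    + b * derivative (X ^ 2 * (1 - X) ^ 2 * L) with hV₂
  have hm : ∀ (f g : ℝ[X]) (m n : ℕ), f.natDegree ≤ m → g.natDegree ≤ n →
      (f * g).natDegree ≤ m + n := fun f g m n => natDegree_mul_le_of_le
  have d1 : ∀ f : ℝ[X], (2 * X ^ 2 * (1 - X) * f).natDegree ≤ 3 + f.natDegree := fun f =>
    hm _ _ _ _ (by compute_degree) le_rfl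
  have d2 : ∀ f : ℝ[X], (derivative (X ^ 2 * (1 - X) ^ 2 * f)).natDegree ≤ 3 + f.natDegree :=
    fun f => by
      have := hm (X ^ 2 * (1 - X) ^ 2 : ℝ[X]) f 4 _ (by compute_degree) le_rfl
      exact (natDegree_derivative_le _).trans (by omega)
  have hV₁d : V₁.natDegree ≤ k := by
    refine (natDegree_add_le _ _).trans (max_le hV ?_)
    have := d1 P
    have h3 := natDegree_C_mul_le R₁ (2 * X ^ 2 * (1 - X) * P)
    exact (hm _ _ 1 (k - 1) (by omega) (by omega)).trans (by omega)
  have hV₂d : V₂.natDegree ≤ k := by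
    have h3 := d1 L
    have h4 := d2 L
    refine (natDegree_add_le _ _).trans (max_le ((natDegree_add_le _ _).trans (max_le hV₁d ?_)) ?_)
    · refine (hm _ _ 1 (k - 1) ?_ (by omega)).trans (by omega)
      exact (natDegree_sub_le _ _).trans (max_le ((natDegree_C_mul_le _ _).trans (by omega))
        ((natDegree_C_mul_le _ _).trans (by omega)))
    · exact (hm _ _ 1 (k - 1) hdb (by omega)).trans (by omega)
  obtain ⟨Q, hQ, hQd⟩ := exists_eq_mul_of_double_roots (by omega) hV₂d
    (by simp [hV₂, e00, derivative_pow]) (by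
      refine Eq.trans ?_ hx'
      simp [hV₂, hL, derivative_pow]; ring) (by simp [hV₂, e01, derivative_pow]) (by
      refine Eq.trans ?_ hy'
      simp [hV₂, hL, derivative_pow]; ring)
  obtain ⟨p, q₁, q₂, hp, hq₁, hq₂, he⟩ :=
    exists_edge_solution hk h₁ h₂ hδ hco ha hc hQd
  have hpL : (p + L).natDegree + 4 ≤ k := by
    have := natDegree_add_le p L
    omega
  refine ⟨P + (p + L), p + L, q₁, q₂, ?_, hpL, hq₁, hq₂, by rw [hP]; ring, ?_⟩
  · have := natDegree_add_le P (p + L)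
    omega
  · rw [← hQ] at he
    have e3 : derivative (X ^ 2 * (1 - X) ^ 2 * (p + L)) =
        derivative (X ^ 2 * (1 - X) ^ 2 * p) + derivative (X ^ 2 * (1 - X) ^ 2 * L) := by
      rw [← derivative_add, mul_add]
    rw [e3]
    linear_combination he

/-! ### Lifting an action of the infinite dihedral group -/

section Dihedral

variable {D : Type*} {o t : Equiv.Perm D}

/-- Both involutions conjugate the rotation t o to its inverse. -/
theorem zpow_mul_involution (ho : o * o = 1) (ht : t * t = 1) (k : ℤ) :
    o * (t * o) ^ k = (t * o) ^ (-k) * o ∧ t * (t * o) ^ k = o * (t * o) ^ (k - 1) ∧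
      t * (t * o) ^ k = (t * o) ^ (-k) * t := by
  have ho' : o⁻¹ = o := inv_eq_of_mul_eq_one_left ho
  have ht' : t⁻¹ = t := inv_eq_of_mul_eq_one_left ht
  have e1 : ∀ k : ℤ, o * (t * o) ^ k = (t * o) ^ (-k) * o := by
    intro k
    have : o * (t * o) * o⁻¹ = (t * o)⁻¹ := by
      rw [mul_inv_rev, ho', ht', ← mul_assoc, mul_assoc (o * t), ho, mul_one]
    rw [zpow_neg, ← inv_zpow, ← this, conj_zpow, inv_mul_cancel_right]
  have e2 : ∀ k : ℤ, t * (t * o) ^ k = o * (t * o) ^ (k - 1) := by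
    intro k
    rw [show k = 1 + (k - 1) by ring, zpow_add, zpow_one, ← mul_assoc, ← mul_assoc, ht, one_mul,
      add_sub_cancel_left]
  refine ⟨e1 k, e2 k, ?_⟩
  rw [e2, e1, neg_sub, sub_eq_add_neg, add_comm, zpow_add, zpow_one, mul_assoc, mul_assoc, ho,
    mul_one]

/-- A reflection in the dihedral group is conjugate to o or to t by a power of t o, depending on the
parity of k, and o has no fixed points. -/
theorem exists_fixed_of_reflection (ho : o * o = 1) (ht : t * t = 1) (hfree : ∀ d, o d ≠ d)
    {d : D} {k : ℤ} (hk : o (((t * o) ^ k) d) = d) :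
    ∃ j : ℤ, t (((t * o) ^ j) d) = ((t * o) ^ j) d := by
  have hoo : ∀ d, o (o d) = d := fun d => by rw [← Equiv.Perm.mul_apply, ho]; rfl
  have hk' : ((t * o) ^ k) d = o d := by rw [← hk, hoo, hk]
  have add : ∀ (i j : ℤ) d, ((t * o) ^ i) (((t * o) ^ j) d) = ((t * o) ^ (i + j)) d :=
    fun i j d => by rw [zpow_add]; rfl
  have oσ : ∀ (k : ℤ) d, o (((t * o) ^ k) d) = ((t * o) ^ (-k)) (o d) := fun k d =>
    congrArg (fun f : Equiv.Perm D => f d) (zpow_mul_involution ho ht k).1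
  obtain ⟨j, rfl | rfl⟩ := Int.even_or_odd' k
  · exfalso
    apply hfree (((t * o) ^ j) d)
    rw [oσ, ← hk', add]
    congr 2; ring
  · have h1 : ((t * o) ^ (j + 1)) d = o (((t * o) ^ j) d) := by
      rw [oσ, ← hk', add]
      congr 2; ring
    refine ⟨j + 1, ?_⟩
    conv_lhs => rw [h1]
    rw [add_comm, zpow_add, zpow_one]; rfl

/-- Sections over the orbits of two involutions `o`, `t`, where `o` has no fixed point and the lift
of `t` is trivial over the fixed points of `t`: it suffices to have trivial monodromy on the orbits
of `t * o` without fixed points of `t`. -/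
theorem dihedral_lift_injective {B : Type*} {π : B → D} {o' t' : Equiv.Perm B}
    (ho : o * o = 1) (ht : t * t = 1) (ho' : o' * o' = 1) (ht' : t' * t' = 1)
    (hπo : ∀ b, π (o' b) = o (π b)) (hπt : ∀ b, π (t' b) = t (π b))
    (hfix : ∀ b, t (π b) = π b → t' b = b) (hfree : ∀ d, o d ≠ d) (b : B)
    (hmono : (∀ k : ℤ, t (((t * o) ^ k) (π b)) ≠ ((t * o) ^ k) (π b)) →
      ∀ k : ℤ, ((t * o) ^ k) (π b) = π b → ((t' * o') ^ k) b = b)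
    {x y : B} (hx : ∃ k : ℤ, x = ((t' * o') ^ k) b ∨ x = o' (((t' * o') ^ k) b))
    (hy : ∃ k : ℤ, y = ((t' * o') ^ k) b ∨ y = o' (((t' * o') ^ k) b)) (hxy : π x = π y) :
    x = y := by
  have hD := zpow_mul_involution ho ht
  have hB := zpow_mul_involution ho' ht'
  have hoo : ∀ d, o (o d) = d := fun d => by rw [← Equiv.Perm.mul_apply, ho]; rfl
  have hoo' : ∀ d, o' (o' d) = d := fun d => by rw [← Equiv.Perm.mul_apply, ho']; rfl
  have hπ1 : ∀ b, π ((t' * o') b) = (t * o) (π b) := fun b => by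
    rw [Equiv.Perm.mul_apply, Equiv.Perm.mul_apply, hπt, hπo]
  have hπ : ∀ (k : ℤ) b, π (((t' * o') ^ k) b) = ((t * o) ^ k) (π b) := by
    intro k
    induction k using Int.induction_on with
    | zero => intro b; rfl
    | succ i ih =>
      intro b
      rw [zpow_add_one, zpow_add_one]
      change π (((t' * o') ^ (i : ℤ)) ((t' * o') b)) = ((t * o) ^ (i : ℤ)) ((t * o) (π b))
      rw [ih, hπ1]
    | pred i ih =>
      intro b
      rw [zpow_sub_one, zpow_sub_one]
      change π (((t' * o') ^ (-i : ℤ)) ((t' * o')⁻¹ b)) = ((t * o) ^ (-i : ℤ)) ((t * o)⁻¹ (π b))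
      rw [ih]
      congr 1
      rw [Equiv.Perm.eq_inv_iff_eq, ← hπ1]
      exact congrArg π ((t' * o').apply_symm_apply b)
  have add : ∀ (i j : ℤ) d, ((t * o) ^ i) (((t * o) ^ j) d) = ((t * o) ^ (i + j)) d :=
    fun i j d => by rw [zpow_add]; rfl
  have add' : ∀ (i j : ℤ) d, ((t' * o') ^ i) (((t' * o') ^ j) d) = ((t' * o') ^ (i + j)) d :=
    fun i j d => by rw [zpow_add]; rfl
  have oσ : ∀ (k : ℤ) d, o (((t * o) ^ k) d) = ((t * o) ^ (-k)) (o d) := fun k d =>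
    congrArg (fun f : Equiv.Perm D => f d) (hD k).1
  have oσ' : ∀ (k : ℤ) d, o' (((t' * o') ^ k) d) = ((t' * o') ^ (-k)) (o' d) := fun k d =>
    congrArg (fun f : Equiv.Perm B => f d) (hB k).1
  have tσ : ∀ (k : ℤ) d, t (((t * o) ^ k) d) = ((t * o) ^ (-k)) (t d) := fun k d =>
    congrArg (fun f : Equiv.Perm D => f d) (hD k).2.2
  have tσ' : ∀ (k : ℤ) d, t' (((t' * o') ^ k) d) = ((t' * o') ^ (-k)) (t' d) := fun k d =>
    congrArg (fun f : Equiv.Perm B => f d) (hB k).2.2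
  have step : ∀ (k : ℤ) d, t (o (((t * o) ^ k) d)) = ((t * o) ^ (k + 1)) d := fun k d => by
    rw [add_comm, zpow_add, zpow_one]; rfl
  have step' : ∀ (k : ℤ) d, t' (o' (((t' * o') ^ k) d)) = ((t' * o') ^ (k + 1)) d := fun k d => by
    rw [add_comm, zpow_add, zpow_one]; rfl
  have c1 : ∀ k : ℤ, ((t * o) ^ k) (π b) = π b → ((t' * o') ^ k) b = b := by
    -- Once t has a fixed point e on the orbit, triviality of the monodromy is automatic, since t'
    -- is trivial over e.
    by_cases hno : ∀ k : ℤ, t (((t * o) ^ k) (π b)) ≠ ((t * o) ^ k) (π b)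
    · exact hmono hno
    · push Not at hno
      obtain ⟨i, hi⟩ := hno
      intro k hk
      have hi' := hfix (((t' * o') ^ i) b) (by rw [hπ]; exact hi)
      have hek : ((t * o) ^ k) (((t * o) ^ i) (π b)) = ((t * o) ^ i) (π b) := by
        rw [add, add_comm, ← add, hk]
      suffices h : ((t' * o') ^ k) (((t' * o') ^ i) b) = ((t' * o') ^ i) b by
        rw [add', add_comm, ← add'] at h
        exact ((t' * o') ^ i).injective h
      have hπe : π (((t' * o') ^ i) b) = ((t * o) ^ i) (π b) := hπ i b
      generalize ((t' * o') ^ i) b = e' at *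
      generalize ((t * o) ^ i) (π b) = e at *
      -- If 2m is a period of e under σ = t o, then σ^m e is fixed by t as well. Its lift is fixed
      -- by t', so σ'^m and σ'^(-m) agree on the lift of e. An odd period would yield a fixed point
      -- of o.
      obtain ⟨m, rfl | rfl⟩ := Int.even_or_odd' k
      · have h1 : t (((t * o) ^ m) e) = ((t * o) ^ m) e := by
          rw [tσ, hi]
          conv_lhs => rw [← hek, add]
          congr 2; ring
        have h2 := hfix (((t' * o') ^ m) e') (by rw [hπ, hπe]; exact h1)
        rw [tσ', hi'] at h2
        rw [two_mul, ← add', ← h2, add', add_neg_cancel]; rfl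
      · exfalso
        apply hfree (((t * o) ^ m) e)
        apply t.injective
        rw [step, tσ, hi]
        conv_rhs => rw [← hek, add]
        congr 2; ring
  -- Reflections in the stabilizer: for even k there would be a fixed point of o, and for odd k the
  -- point halfway is fixed by t, hence its lift by t'.
  have c2 : ∀ k : ℤ, o (((t * o) ^ k) (π b)) = π b → o' (((t' * o') ^ k) b) = b := by
    intro k hk
    have hk' : ((t * o) ^ k) (π b) = o (π b) := by rw [← hk, hoo, hk]
    obtain ⟨j, rfl | rfl⟩ := Int.even_or_odd' k
    · exfalso
      apply hfree (((t * o) ^ j) (π b))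
      rw [oσ, ← hk', add]
      congr 2; ring
    · have h1 : t (o (((t * o) ^ j) (π b))) = o (((t * o) ^ j) (π b)) := by
        rw [step, oσ, ← hk', add]
        congr 2; ring
      have h2 := hfix (o' (((t' * o') ^ j) b)) (by rw [hπo, hπ]; exact h1)
      rw [step'] at h2
      have h3 : ((t' * o') ^ (2 * j + 1)) b = ((t' * o') ^ j) (((t' * o') ^ (j + 1)) b) := by
        rw [add']; congr 2; ring
      rw [h3, h2, oσ', hoo', add', neg_add_cancel]; rfl
  obtain ⟨i, hx⟩ := hx
  obtain ⟨j, hy⟩ := hy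
  have same : ∀ i j : ℤ, ((t * o) ^ i) (π b) = ((t * o) ^ j) (π b) →
      ((t' * o') ^ i) b = ((t' * o') ^ j) b := by
    intro i j h
    have h1 : ((t * o) ^ (i - j)) (π b) = π b := by
      rw [sub_eq_add_neg, add_comm, ← add, h, add, neg_add_cancel]; rfl
    rw [show i = j + (i - j) by ring, ← add', c1 _ h1]
  have mixed : ∀ i j : ℤ, ((t * o) ^ i) (π b) = o (((t * o) ^ j) (π b)) →
      ((t' * o') ^ i) b = o' (((t' * o') ^ j) b) := by
    intro i j h
    have h1 : o (((t * o) ^ (i + j)) (π b)) = π b := by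
      rw [add_comm, ← add, h, oσ, hoo, add, neg_add_cancel]; rfl
    have h2 : ((t' * o') ^ j) b = o' (((t' * o') ^ i) b) := by
      rw [show j = -i + (i + j) by ring, ← add', oσ', ← c2 _ h1, hoo', c2 _ h1]
    rw [h2, hoo']
  rcases hx with rfl | rfl <;> rcases hy with rfl | rfl
  · rw [hπ, hπ] at hxy; exact same _ _ hxy
  · rw [hπ, hπo, hπ] at hxy; exact mixed _ _ hxy
  · rw [hπ, hπo, hπ] at hxy; exact (mixed _ _ hxy.symm).symm
  · rw [hπo, hπo, hπ, hπ] at hxy; rw [same _ _ (o.injective hxy)]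

end Dihedral

/-! ### Gluing of directed edges -/

namespace OrientedGluing

variable {K₁ : Type*}

/-- The same gluing viewed from the other side. -/
def flip (h : OrientedGluing K₁) : OrientedGluing K₁ := ⟨h.e, !h.swap, h.back⟩

@[simp] theorem flip_flip (h : OrientedGluing K₁) : h.flip.flip = h := by
  obtain ⟨e, s, b⟩ := h; simp [flip]

theorem flip_ne (h : OrientedGluing K₁) : h.flip ≠ h := by
  obtain ⟨e, s, b⟩ := h; simp [flip]

end OrientedGluing

instance {K₀ : Type*} [Finite K₀] (Ω : K₀ → ConvexPolygon) : Finite (Dart Ω) := by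
  let f : Dart Ω → (Σ ℓ, Fin ((Ω ℓ).m + 3)) × Bool := fun d => (⟨d.poly, d.idx⟩, d.fwd)
  refine Finite.of_injective f ?_
  rintro ⟨ℓ, i, b⟩ ⟨ℓ', i', b'⟩ h
  simp only [f, Prod.mk.injEq, Sigma.mk.injEq] at h
  obtain ⟨⟨rfl, h⟩, rfl⟩ := h
  rw [eq_of_heq h]

namespace Dart

variable {K₀ : Type*} {Ω : K₀ → ConvexPolygon}

theorem edge_eq_iff {d d' : Dart Ω} : d.edge = d'.edge ↔ d = d' ∨ d = d'.rev := by
  obtain ⟨ℓ, i, b⟩ := d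
  obtain ⟨ℓ', i', b'⟩ := d'
  constructor
  · intro h
    simp only [edge, Sigma.mk.injEq] at h
    obtain ⟨rfl, h⟩ := h
    obtain rfl := eq_of_heq h
    cases b <;> cases b' <;> simp [rev]
  · rintro (h | h)
    · rw [h]
    · rw [h]; rfl

theorem rev_ne (d : Dart Ω) : d.rev ≠ d := by
  obtain ⟨ℓ, i, b⟩ := d; simp [rev]

end Dart

namespace LinearG0Surface

variable {K₀ K₁ : Type*} (M : LinearG0Surface K₀ K₁)

theorem fromDart_flip (h : OrientedGluing K₁) : M.fromDart h.flip = M.toDart h := by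
  obtain ⟨e, s, b⟩ := h; cases s <;> rfl

theorem toDart_flip (h : OrientedGluing K₁) : M.toDart h.flip = M.fromDart h := by
  obtain ⟨e, s, b⟩ := h; cases s <;> rfl

/-- `paired_once` recovers the gluing and its side from the undirected edge, and the direction
recovers `back`. -/
theorem fromDart_injective : Function.Injective M.fromDart := by
  rintro ⟨e, s, b⟩ ⟨e', s', b'⟩ h
  have hedge := congrArg Dart.edge h
  have hinj := M.paired_once
  have key : ∀ e s b, (M.fromDart ⟨e, s, b⟩).edge =
      Sum.elim (fun e => (M.src e).edge) (fun e => (M.tgt e).edge)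
        (if s then Sum.inr e else Sum.inl e) := by
    intro e s b
    cases s <;> cases b <;> rfl
  rw [key, key] at hedge
  have h2 := hinj hedge
  have h3 : s = s' ∧ e = e' := by
    cases s <;> cases s' <;> simp at h2 ⊢ <;> exact h2
  obtain ⟨rfl, rfl⟩ := h3
  cases b <;> cases b' <;> first | rfl | skip
  · exact ((Dart.rev_ne _) h.symm).elim
  · exact ((Dart.rev_ne _) h).elim

theorem isBoundaryEdge_iff (d : Dart M.Ω) :
    M.IsBoundaryEdge d.edge ↔ ¬ ∃ h, M.fromDart h = d := by
  constructor
  · rintro hb ⟨⟨e, s, b⟩, rfl⟩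
    have := hb e
    cases s <;> cases b
    · exact this.1 rfl
    · exact this.1 rfl
    · exact this.2 rfl
    · exact this.2 rfl
  · intro hn e
    constructor
    · intro h
      rcases Dart.edge_eq_iff.1 h with h | h
      · exact hn ⟨⟨e, false, false⟩, h.symm⟩
      · exact hn ⟨⟨e, false, true⟩, h.symm⟩
    · intro h
      rcases Dart.edge_eq_iff.1 h with h | h
      · exact hn ⟨⟨e, true, false⟩, h.symm⟩
      · exact hn ⟨⟨e, true, true⟩, h.symm⟩

open Classical in
/-- The directed edge glued to a given one; boundary edges are fixed. -/
noncomputable def glue (d : Dart M.Ω) : Dart M.Ω :=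
  if h : ∃ h, M.fromDart h = d then M.toDart h.choose else d

theorem glue_fromDart (h : OrientedGluing K₁) : M.glue (M.fromDart h) = M.toDart h := by
  have hex : ∃ h', M.fromDart h' = M.fromDart h := ⟨h, rfl⟩
  rw [glue, dif_pos hex, M.fromDart_injective hex.choose_spec]

theorem glue_toDart (h : OrientedGluing K₁) : M.glue (M.toDart h) = M.fromDart h := by
  rw [← fromDart_flip, glue_fromDart, toDart_flip]

theorem glue_of_not_exists {d : Dart M.Ω} (h : ¬ ∃ h, M.fromDart h = d) : M.glue d = d := by
  rw [glue, dif_neg h]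

theorem toDart_ne_fromDart (h : OrientedGluing K₁) : M.toDart h ≠ M.fromDart h := by
  rw [← fromDart_flip]
  exact fun e => h.flip_ne (M.fromDart_injective e)

theorem glue_glue (d : Dart M.Ω) : M.glue (M.glue d) = d := by
  by_cases h : ∃ h, M.fromDart h = d
  · obtain ⟨h, rfl⟩ := h
    rw [glue_fromDart, glue_toDart]
  · rw [glue_of_not_exists M h, glue_of_not_exists M h]

theorem glue_eq_iff {d : Dart M.Ω} : M.glue d = d ↔ ¬ ∃ h, M.fromDart h = d := by
  refine ⟨?_, M.glue_of_not_exists⟩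
  rintro e ⟨h, rfl⟩
  rw [glue_fromDart] at e
  exact M.toDart_ne_fromDart h e

theorem vertexOf_glue (d : Dart M.Ω) : M.vertexOf (M.glue d).corner = M.vertexOf d.corner := by
  by_cases h : ∃ h, M.fromDart h = d
  · obtain ⟨h, rfl⟩ := h
    rw [glue_fromDart]
    exact (Quot.sound ⟨h, rfl, rfl⟩).symm
  · rw [glue_of_not_exists M h]

theorem vertexOf_other (d : Dart M.Ω) : M.vertexOf d.other.corner = M.vertexOf d.corner := by
  rw [Dart.other_corner]

/-- Induction over the directed edges that start at a vertex. -/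
theorem dart_induction {P : Dart M.Ω → Prop} (ho : ∀ d, P d → P d.other)
    (hg : ∀ d, P d → P (M.glue d)) {d₀ : Dart M.Ω} (h₀ : P d₀) {d : Dart M.Ω}
    (hd : M.vertexOf d.corner = M.vertexOf d₀.corner) : P d := by
  have key : ∀ p q, Relation.EqvGen (fun p q : (Σ ℓ, Fin ((M.Ω ℓ).m + 3)) =>
      ∃ h : OrientedGluing K₁, p = (M.fromDart h).corner ∧ q = (M.toDart h).corner) p q →
      ((∀ d, d.corner = p → P d) ↔ (∀ d, d.corner = q → P d)) := by
    have step : ∀ h : OrientedGluing K₁, (∀ d, d.corner = (M.fromDart h).corner → P d) →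
        ∀ d, d.corner = (M.toDart h).corner → P d := by
      intro h hp d hd
      have h1 : P (M.toDart h) := by
        rw [← glue_fromDart]; exact hg _ (hp _ rfl)
      rcases Dart.eq_or_eq_other hd with rfl | rfl
      · exact h1
      · exact ho _ h1
    intro p q h
    induction h with
    | rel p q h =>
      obtain ⟨h, rfl, rfl⟩ := h
      refine ⟨step h, fun hq => ?_⟩
      have := step h.flip
      rw [fromDart_flip, toDart_flip] at this
      exact this hq
    | refl p => rfl
    | symm p q _ ih => exact ih.symm
    | trans p q r _ _ ih1 ih2 => exact ih1.trans ih2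
  refine (key _ _ (Quot.eqvGen_exact hd)).2 (fun d hd => ?_) d rfl
  rcases Dart.eq_or_eq_other hd with rfl | rfl
  · exact h₀
  · exact ho _ h₀

/-- `Dart.other` as a permutation. -/
def otherPerm : Equiv.Perm (Dart M.Ω) where
  toFun := Dart.other
  invFun := Dart.other
  left_inv := Dart.other_other
  right_inv := Dart.other_other

/-- `glue` as a permutation. -/
noncomputable def gluePerm : Equiv.Perm (Dart M.Ω) where
  toFun := M.glue
  invFun := M.glue
  left_inv := M.glue_glue
  right_inv := M.glue_glue

/-- The rotation around the starting vertex. -/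
noncomputable def rotation : Equiv.Perm (Dart M.Ω) := M.gluePerm * M.otherPerm

theorem otherPerm_mul_self : M.otherPerm * M.otherPerm = 1 :=
  Equiv.ext fun d => d.other_other

theorem gluePerm_mul_self : M.gluePerm * M.gluePerm = 1 :=
  Equiv.ext fun d => M.glue_glue d

theorem rotation_apply (d : Dart M.Ω) : M.rotation d = M.glue d.other := rfl

/-- Every element of the group generated by the two involutions is a power of the rotation, possibly
followed by `other`. -/
theorem exists_rotation_eq {d₀ d : Dart M.Ω}
    (hd : M.vertexOf d.corner = M.vertexOf d₀.corner) :
    ∃ k : ℤ, d = (M.rotation ^ k) d₀ ∨ d = ((M.rotation ^ k) d₀).other := by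
  have hz := zpow_mul_involution M.otherPerm_mul_self M.gluePerm_mul_self
  refine M.dart_induction (P := fun d => ∃ k : ℤ, d = (M.rotation ^ k) d₀ ∨
    d = ((M.rotation ^ k) d₀).other) ?_ ?_ ⟨0, Or.inl rfl⟩ hd
  · rintro d ⟨k, rfl | rfl⟩
    · exact ⟨k, Or.inr rfl⟩
    · exact ⟨k, Or.inl (Dart.other_other _)⟩
  · rintro d ⟨k, rfl | rfl⟩
    · exact ⟨k - 1, Or.inr (congrArg (fun f : Equiv.Perm (Dart M.Ω) => f d₀) (hz k).2.1)⟩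
    · exact ⟨k + 1, Or.inl (by rw [add_comm, zpow_add, zpow_one]; rfl)⟩

theorem vertexOf_rotation_zpow (d : Dart M.Ω) (k : ℤ) :
    M.vertexOf ((M.rotation ^ k) d).corner = M.vertexOf d.corner := by
  have h1 : ∀ d, M.vertexOf (M.rotation d).corner = M.vertexOf d.corner := fun d => by
    rw [rotation_apply, vertexOf_glue, vertexOf_other]
  induction k using Int.induction_on with
  | zero => rfl
  | succ i ih => rw [add_comm, zpow_add, zpow_one, Equiv.Perm.mul_apply, h1, ih]
  | pred i ih =>
    rw [← ih, sub_eq_add_neg, add_comm, zpow_add, zpow_neg_one, ← h1 ((M.rotation⁻¹ * _) d)]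
    congr 2
    exact M.rotation.apply_symm_apply _

/-- At an interior vertex, all directed edges are glued. -/
theorem exists_fromDart_of_not_boundary {d : Dart M.Ω}
    (h : ¬ M.IsBoundaryVertex (M.vertexOf d.corner)) : ∃ h, M.fromDart h = d := by
  by_contra hn
  exact h ⟨d, (M.isBoundaryEdge_iff d).2 hn, rfl⟩

/-- Around an interior vertex, the gluings form a cycle. -/
theorem exists_interiorFan [Finite K₀] {d : Dart M.Ω}
    (hd : ¬ M.IsBoundaryVertex (M.vertexOf d.corner)) :
    ∃ (n : ℕ) (g : ℕ → OrientedGluing K₁), 0 < n ∧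
      (∀ i, M.fromDart (g i) = (M.rotation ^ (i + 1)) d) ∧
      M.IsInteriorFan ((List.range n).map g) ∧
      (∀ k : ℤ, (M.rotation ^ k) d = d ↔ (n : ℤ) ∣ k) ∧
      Nat.card {p // M.vertexOf p = M.vertexOf d.corner} = n := by
  have hv : ∀ i : ℕ, M.vertexOf ((M.rotation ^ i) d).corner = M.vertexOf d.corner := fun i =>
    M.vertexOf_rotation_zpow d i
  have hex : ∀ i : ℕ, ∃ h, M.fromDart h = (M.rotation ^ (i + 1)) d := fun i =>
    M.exists_fromDart_of_not_boundary (by rwa [hv])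
  choose g hg using hex
  set n := Function.minimalPeriod M.rotation d with hn
  have hper : ∀ k : ℤ, (M.rotation ^ k) d = d ↔ (n : ℤ) ∣ k := fun k =>
    MulAction.zpow_smul_eq_iff_minimalPeriod_dvd (a := M.rotation) (b := d)
  have hpos : 0 < n := by
    obtain ⟨m, hm, he⟩ := (isOfFinOrder_iff_pow_eq_one.1 (isOfFinOrder_of_finite M.rotation))
    refine Function.IsPeriodicPt.minimalPeriod_pos hm ?_
    rw [Function.IsPeriodicPt, ← Equiv.Perm.coe_pow, he]
    rfl
  -- A reflection fixing d would give a directed edge at this vertex that is fixed by `glue`, that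
  -- is, a boundary edge. So different rotates of d start at different corners.
  have hno : ∀ k : ℤ, ((M.rotation ^ k) d).other ≠ d := by
    intro k hk
    obtain ⟨j, hj⟩ := exists_fixed_of_reflection (o := M.otherPerm) (t := M.gluePerm)
      M.otherPerm_mul_self M.gluePerm_mul_self (fun d => d.other_ne) hk
    refine (M.glue_eq_iff.1 hj) (M.exists_fromDart_of_not_boundary ?_)
    rwa [show M.gluePerm * M.otherPerm = M.rotation from rfl, vertexOf_rotation_zpow]
  have add : ∀ (i j : ℤ) d, (M.rotation ^ i) ((M.rotation ^ j) d) = (M.rotation ^ (i + j)) d :=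
    fun i j d => by rw [zpow_add]; rfl
  have hcorner : ∀ i j : ℤ, ((M.rotation ^ i) d).corner = ((M.rotation ^ j) d).corner →
      (n : ℤ) ∣ j - i := by
    intro i j hij
    rcases Dart.eq_or_eq_other hij with h | h
    · rw [← hper, sub_eq_add_neg, add_comm, ← add, ← h, add, neg_add_cancel]; rfl
    · exfalso
      apply hno (j + i)
      have hz := (zpow_mul_involution M.otherPerm_mul_self M.gluePerm_mul_self j).1
      have h2 : ((M.rotation ^ j) d).other = (M.rotation ^ (-j)) d.other :=
        congrArg (fun f : Equiv.Perm (Dart M.Ω) => f d) hz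
      rw [← add, h, h2, add, add_neg_cancel]
      exact d.other_other
  refine ⟨n, g, hpos, hg, ⟨?_, ?_, ?_⟩, hper, ?_⟩
  · simp [hpos.ne']
  · rw [List.map_map]
    refine List.Nodup.map_on ?_ List.nodup_range
    intro i hi j hj hij
    rw [List.mem_range] at hi hj
    simp only [Function.comp_apply, hg] at hij
    have := hcorner (i + 1 : ℕ) (j + 1 : ℕ) (by simpa only [zpow_natCast] using hij)
    have h2 := Int.eq_zero_of_abs_lt_dvd this (by rw [abs_lt]; constructor <;> push_cast <;> omega)
    omega
  · have hgn : g n = g 0 := by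
      apply M.fromDart_injective
      rw [hg, hg, pow_add, Equiv.Perm.mul_apply, zero_add, pow_one, ← zpow_natCast,
        ← Equiv.Perm.mul_apply, ← zpow_add_one, add_comm, zpow_add, zpow_one,
        Equiv.Perm.mul_apply, (hper n).2 dvd_rfl]
    have : (List.range n).map g ++ ((List.range n).map g).head?.toList
        = (List.range (n + 1)).map g := by
      obtain ⟨m, hm⟩ := Nat.exists_eq_succ_of_ne_zero hpos.ne'
      rw [List.range_succ, List.map_append, List.map_singleton, hgn, hm,
        List.range_succ_eq_map]
      simp
    rw [this, List.isChain_map, List.isChain_range_succ]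
    intro i hi
    have hi1 : M.toDart (g (i + 1)) = M.glue (M.fromDart (g (i + 1))) := (M.glue_fromDart _).symm
    rw [Next, hi1, hg, hg, pow_succ', Equiv.Perm.mul_apply, rotation_apply, glue_glue]
  · rw [← Nat.card_fin n]
    refine (Nat.card_eq_of_bijective (fun i : Fin n =>
      (⟨((M.rotation ^ (i : ℤ)) d).corner, M.vertexOf_rotation_zpow d i⟩ :
        {p // M.vertexOf p = M.vertexOf d.corner})) ⟨?_, ?_⟩).symm
    · intro i j hij
      have := hcorner i j (congrArg Subtype.val hij)
      have h2 := Int.eq_zero_of_abs_lt_dvd this (by rw [abs_lt]; constructor <;> omega)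
      exact Fin.ext (by omega)
    · rintro ⟨⟨ℓ, j⟩, hp⟩
      obtain ⟨k, hk⟩ := M.exists_rotation_eq (d₀ := d) (d := ⟨ℓ, j, true⟩) hp
      have hn0 : (0 : ℤ) < n := by exact_mod_cast hpos
      refine ⟨⟨(k % n).toNat, by have := Int.emod_lt_of_pos k hn0; omega⟩, Subtype.ext ?_⟩
      have h1 : (((k % n).toNat : ℕ) : ℤ) = k % n :=
        Int.toNat_of_nonneg (Int.emod_nonneg _ hn0.ne')
      have h2 : (M.rotation ^ (k % n)) d = (M.rotation ^ k) d := by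
        conv_rhs => rw [← Int.emod_add_mul_ediv k n, ← add, (hper _).2 (Dvd.intro _ rfl)]
      simp only [h1, h2]
      rcases hk with hk | hk
      · rw [← hk]; rfl
      · rw [← Dart.other_corner, ← hk]; rfl

end LinearG0Surface

/-! ### Gluing data from both sides and at both ends -/

theorem Dart.revQ_pos {K₀ : Type*} {Ω : K₀ → ConvexPolygon} (d : Dart Ω) : 0 < d.revQ := by
  obtain ⟨ℓ, i, b⟩ := d
  have h1 := (Ω ℓ).convex i (i + 1 + 1) ((Ω ℓ).add_two_ne i).1 ((Ω ℓ).add_two_ne i).2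
  have h2 := (Ω ℓ).convex i (i - 1) ((Ω ℓ).sub_one_ne i).1 ((Ω ℓ).sub_one_ne i).2
  rw [Dart.revQ]
  cases b <;> simp only [Dart.mk_rev, Dart.mk_dirU_true, Dart.mk_dirU_false, Dart.mk_dirV_true,
    Dart.mk_dirV_false, Bool.not_true, Bool.not_false, planeDet, Pi.sub_apply] at h1 h2 ⊢
  · apply div_pos_of_neg_of_neg <;> linarith
  · apply div_pos <;> linarith

namespace RationalGluing

variable {K₀ K₁ : Type*} (M : RationalGluing K₀ K₁)

theorem triple_flip (h : OrientedGluing K₁) : M.triple h.flip = (M.triple h).swap := by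
  obtain ⟨e, s, b⟩ := h
  cases s <;> simp [triple, OrientedGluing.flip, GluingTriple.swap]

end RationalGluing

namespace RationalG1Surface

variable {K₀ K₁ : Type*} (M : RationalG1Surface K₀ K₁)

theorem eval_c_ne_zero (e : K₁) {t : ℝ} (ht : t ∈ Icc (0 : ℝ) 1) : (M.data e).c.eval t ≠ 0 := by
  intro h
  have := M.gamma_neg e t ht
  rw [GluingTriple.gamma, h, zero_div] at this
  exact lt_irrefl _ this

/-- Changing the direction multiplies by the positive constants q and evaluates at the other end of
the edge; changing the side inverts γ. Signs and non-vanishing survive both. -/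
theorem triple_eval_zero (h : OrientedGluing K₁) :
    (M.triple h).a.eval 0 ≠ 0 ∧ M.gamma h 0 < 0 := by
  have key : ∀ e b, (M.triple ⟨e, false, b⟩).a.eval 0 ≠ 0 ∧ M.gamma ⟨e, false, b⟩ 0 < 0 := by
    intro e b
    have h0 : (0 : ℝ) ∈ Icc (0 : ℝ) 1 := by simp
    have h1 : (1 : ℝ) ∈ Icc (0 : ℝ) 1 := by simp
    cases b
    · exact ⟨M.denom_ne_zero e 0 h0, M.gamma_neg e 0 h0⟩
    · have hq1 := (M.src e).revQ_pos
      have hq2 := (M.tgt e).revQ_pos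
      have ha := M.denom_ne_zero e 1 h1
      have hg := M.gamma_neg e 1 h1
      simp only [RationalGluing.gamma, RationalGluing.triple, if_true, Bool.false_eq_true,
        if_false, GluingTriple.back, GluingTriple.gamma, eval_mul, eval_C, eval_comp, eval_sub,
        eval_one, eval_X, sub_zero] at hg ⊢
      refine ⟨mul_ne_zero hq1.ne' ha, ?_⟩
      rw [mul_div_mul_comm]
      exact mul_neg_of_pos_of_neg (div_pos hq2 hq1) hg
  obtain ⟨e, s, b⟩ := h
  cases s
  · exact key e b
  · obtain ⟨h1, h2⟩ := key e b
    have hf : (⟨e, true, b⟩ : OrientedGluing K₁) = OrientedGluing.flip ⟨e, false, b⟩ := rfl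
    rw [RationalGluing.gamma, hf, RationalGluing.triple_flip]
    rw [RationalGluing.gamma, GluingTriple.gamma] at h2
    have hc : (M.triple ⟨e, false, b⟩).c.eval 0 ≠ 0 := by
      intro h; rw [h, zero_div] at h2; exact lt_irrefl _ h2
    refine ⟨hc, ?_⟩
    rw [GluingTriple.gamma, ← inv_div]
    exact inv_lt_zero.2 h2

theorem triple_c_ne_zero (h : OrientedGluing K₁) : (M.triple h).c.eval 0 ≠ 0 := by
  intro h0
  have := (M.triple_eval_zero h).2
  rw [RationalGluing.gamma, GluingTriple.gamma, h0, zero_div] at this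
  exact lt_irrefl _ this

theorem gamma_flip (h : OrientedGluing K₁) : M.gamma h.flip 0 = (M.gamma h 0)⁻¹ := by
  rw [RationalGluing.gamma, RationalGluing.triple_flip, RationalGluing.gamma, GluingTriple.gamma,
    GluingTriple.gamma, inv_div]
  rfl

theorem beta_flip (h : OrientedGluing K₁) :
    M.beta h.flip 0 = -(M.beta h 0) * (M.gamma h 0)⁻¹ := by
  rw [RationalGluing.beta, RationalGluing.triple_flip, RationalGluing.beta, RationalGluing.gamma,
    GluingTriple.gamma, GluingTriple.beta, GluingTriple.beta, inv_div]
  have h1 := (M.triple_eval_zero h).1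
  have h2 := M.triple_c_ne_zero h
  simp only [GluingTriple.swap, eval_neg]
  field_simp

theorem isJoining_flip (h : OrientedGluing K₁) : M.IsJoining h.flip ↔ M.IsJoining h := by
  have := (M.triple_eval_zero h).2.ne
  rw [RationalGluing.IsJoining, RationalGluing.IsJoining, beta_flip]
  simp [this]

/-! ### Transport of tangent covectors around a vertex -/

open Classical in
/-- The change of the components of a tangent covector along a gluing. -/
noncomputable def transport (d : Dart M.Ω) (x : Fin 2 → ℝ) : Fin 2 → ℝ :=
  if h : ∃ h, M.fromDart h = d then
    ![x 0, M.beta h.choose.flip 0 * x 0 + M.gamma h.choose.flip 0 * x 1] else x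

theorem transport_fromDart (h : OrientedGluing K₁) (x : Fin 2 → ℝ) :
    M.transport (M.fromDart h) x =
      ![x 0, M.beta h.flip 0 * x 0 + M.gamma h.flip 0 * x 1] := by
  have hex : ∃ h', M.fromDart h' = M.fromDart h := ⟨h, rfl⟩
  rw [transport, dif_pos hex, M.fromDart_injective hex.choose_spec]

theorem transport_of_not_exists {d : Dart M.Ω} (h : ¬ ∃ h, M.fromDart h = d) (x : Fin 2 → ℝ) :
    M.transport d x = x := by
  rw [transport, dif_neg h]

theorem transport_transport (d : Dart M.Ω) (x : Fin 2 → ℝ) :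
    M.transport (M.glue d) (M.transport d x) = x := by
  by_cases h : ∃ h, M.fromDart h = d
  · obtain ⟨h, rfl⟩ := h
    rw [M.glue_fromDart, transport_fromDart, ← M.fromDart_flip, transport_fromDart,
      OrientedGluing.flip_flip, beta_flip, gamma_flip]
    have := (M.triple_eval_zero h).2.ne
    ext i
    fin_cases i
    · simp
    · simp; field_simp; ring
  · rw [M.glue_of_not_exists h, transport_of_not_exists M h, transport_of_not_exists M h]

/-- Lift of `Dart.other` to tangent covectors. -/
noncomputable def otherLift : Equiv.Perm (Dart M.Ω × (Fin 2 → ℝ)) where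
  toFun b := (b.1.other, ![b.2 1, b.2 0])
  invFun b := (b.1.other, ![b.2 1, b.2 0])
  left_inv b := Prod.ext (Dart.other_other _) (by ext i; fin_cases i <;> rfl)
  right_inv b := Prod.ext (Dart.other_other _) (by ext i; fin_cases i <;> rfl)

/-- Lift of the gluing to tangent covectors. -/
noncomputable def glueLift : Equiv.Perm (Dart M.Ω × (Fin 2 → ℝ)) where
  toFun b := (M.glue b.1, M.transport b.1 b.2)
  invFun b := (M.glue b.1, M.transport b.1 b.2)
  left_inv _ := Prod.ext (M.glue_glue _) (M.transport_transport _ _)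
  right_inv _ := Prod.ext (M.glue_glue _) (M.transport_transport _ _)

/-- The lifted rotation acts on covectors by the matrix A_k. Hence the monodromy around a vertex is
the fan product, to which the compatibility condition applies. -/
theorem glueLift_mul_otherLift_apply {h : OrientedGluing K₁} {d : Dart M.Ω}
    (hd : M.fromDart h = M.rotation d) (x : Fin 2 → ℝ) :
    (M.glueLift * M.otherLift) (d, x) = (M.rotation d, M.tangentMatrix h *ᵥ x) := by
  refine Prod.ext rfl ?_
  change M.transport d.other ![x 1, x 0] = _
  have h1 : d.other = M.fromDart h.flip := by
    rw [M.fromDart_flip, ← M.glue_fromDart, hd, M.rotation_apply, M.glue_glue]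
  rw [h1, transport_fromDart, OrientedGluing.flip_flip]
  ext i
  fin_cases i
  · simp [RationalGluing.tangentMatrix, Matrix.mulVec, dotProduct, Fin.sum_univ_two]
  · simp [RationalGluing.tangentMatrix, Matrix.mulVec, dotProduct, Fin.sum_univ_two]
    ring

theorem pow_lift_apply {g : ℕ → OrientedGluing K₁} {d : Dart M.Ω}
    (hg : ∀ i, M.fromDart (g i) = (M.rotation ^ (i + 1)) d) (x : Fin 2 → ℝ) (n : ℕ) :
    ((M.glueLift * M.otherLift) ^ n) (d, x) =
      ((M.rotation ^ n) d, M.fanProduct ((List.range n).map g) *ᵥ x) := by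
  induction n with
  | zero => simp [RationalGluing.fanProduct]
  | succ n ih =>
    rw [pow_succ', Equiv.Perm.mul_apply, ih,
      M.glueLift_mul_otherLift_apply (h := g n) (by rw [hg, pow_succ', Equiv.Perm.mul_apply])]
    refine Prod.ext ?_ ?_
    · simp only [pow_succ', Equiv.Perm.mul_apply]
    · rw [Matrix.mulVec_mulVec]
      simp [RationalGluing.fanProduct, List.range_succ]

/-- Tangent covectors can be prescribed at one directed edge for every vertex. -/
theorem exists_section [Finite K₀] (base : M.Vertex → Dart M.Ω)
    (hbase : ∀ v, M.vertexOf (base v).corner = v) (x : M.Vertex → Fin 2 → ℝ) :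
    ∃ s : Dart M.Ω → Fin 2 → ℝ, (∀ d, s d.other = ![s d 1, s d 0]) ∧
      (∀ d, s (M.glue d) = M.transport d (s d)) ∧ ∀ v, s (base v) = x v := by
  have ho : M.otherLift * M.otherLift = 1 := Equiv.ext fun b => M.otherLift.left_inv b
  have ht : M.glueLift * M.glueLift = 1 := Equiv.ext fun b => M.glueLift.left_inv b
  -- The graph of the section at v: the dihedral orbit of the prescribed covector. It is
  -- single-valued by `dihedral_lift_injective` and meets every directed edge at v by
  -- `dart_induction`.
  let R : M.Vertex → Dart M.Ω × (Fin 2 → ℝ) → Prop := fun v b => ∃ k : ℤ,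
    b = ((M.glueLift * M.otherLift) ^ k) (base v, x v) ∨
    b = M.otherLift (((M.glueLift * M.otherLift) ^ k) (base v, x v))
  have hRo : ∀ v b, R v b → R v (M.otherLift b) := by
    rintro v b ⟨k, rfl | rfl⟩
    · exact ⟨k, Or.inr rfl⟩
    · exact ⟨k, Or.inl (M.otherLift.left_inv _)⟩
  have hRt : ∀ v b, R v b → R v (M.glueLift b) := by
    rintro v b ⟨k, rfl | rfl⟩
    · exact ⟨k - 1, Or.inr (congrArg (fun f : Equiv.Perm (Dart M.Ω × (Fin 2 → ℝ)) =>
        f (base v, x v)) (zpow_mul_involution ho ht k).2.1)⟩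
    · exact ⟨k + 1, Or.inl (by rw [add_comm, zpow_add, zpow_one]; rfl)⟩
  have hinj : ∀ v b b', R v b → R v b' → b.1 = b'.1 → b = b' := by
    intro v b b' hb hb'
    refine dihedral_lift_injective (o := M.otherPerm) (t := M.gluePerm) M.otherPerm_mul_self
      M.gluePerm_mul_self ho ht (fun _ => rfl) (fun _ => rfl) ?_ (fun d => d.other_ne)
      (base v, x v) ?_ hb hb'
    · rintro ⟨d, y⟩ hd
      refine Prod.ext hd ?_
      exact M.transport_of_not_exists (M.glue_eq_iff.1 hd) y
    -- Without a directed edge fixed by `glue` the vertex is interior, and the monodromy is a power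
    -- of A_n ⋯ A_1 = I.
    · intro hno k hk
      have hnb : ¬ M.IsBoundaryVertex (M.vertexOf (base v).corner) := by
        rintro ⟨d, hd, hdv⟩
        obtain ⟨j, hj⟩ := M.exists_rotation_eq hdv
        have hfix : M.glue d = d := M.glue_eq_iff.2 ((M.isBoundaryEdge_iff d).1 hd)
        rcases hj with hj | hj
        · exact hno j (by rw [hj] at hfix; exact hfix)
        · refine hno (j + 1) ?_
          have h1 : (M.rotation ^ (j + 1)) (base v) = d := by
            rw [add_comm, zpow_add, zpow_one, Equiv.Perm.mul_apply, M.rotation_apply, ← hj, hfix]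
          change M.glue ((M.rotation ^ (j + 1)) (base v)) = (M.rotation ^ (j + 1)) (base v)
          rw [h1, hfix]
      obtain ⟨n, g, hn, hg, hfan, hper, -⟩ := M.exists_interiorFan hnb
      obtain ⟨q, rfl⟩ := (hper k).1 hk
      have h1 : ((M.glueLift * M.otherLift) ^ (n : ℤ)) (base v, x v) = (base v, x v) := by
        rw [zpow_natCast, M.pow_lift_apply hg, M.interior_compat _ hfan, Matrix.one_mulVec,
          ← zpow_natCast, (hper n).2 dvd_rfl]
      rw [zpow_mul]
      exact Equiv.Perm.zpow_apply_eq_self_of_apply_eq_self h1 q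
  have hex : ∀ d, ∃ y, R (M.vertexOf d.corner) (d, y) := by
    intro d
    refine M.dart_induction (P := fun d' => ∃ y, R (M.vertexOf d.corner) (d', y))
      (d₀ := base (M.vertexOf d.corner)) ?_ ?_ ⟨x _, 0, Or.inl rfl⟩ (hbase _).symm
    · rintro d' ⟨y, hy⟩
      exact ⟨_, hRo _ _ hy⟩
    · rintro d' ⟨y, hy⟩
      exact ⟨_, hRt _ _ hy⟩
  choose s hs using hex
  refine ⟨s, fun d => ?_, fun d => ?_, fun v => ?_⟩
  · have h1 := hs d.other
    rw [M.vertexOf_other] at h1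
    exact congrArg Prod.snd (hinj _ _ _ h1 (hRo _ _ (hs d)) rfl)
  · have h1 := hs (M.glue d)
    rw [M.vertexOf_glue] at h1
    exact congrArg Prod.snd (hinj _ _ _ h1 (hRt _ _ (hs d)) rfl)
  · have h1 := hs (base v)
    rw [hbase] at h1
    exact congrArg Prod.snd (hinj _ _ _ h1 ⟨0, Or.inl rfl⟩ rfl)

/-! ### Crossing vertices -/

/-- An interior vertex at which all edges are joining has valency four. -/
theorem exists_crossingFan [Finite K₀] {d : Dart M.Ω}
    (hd : ¬ M.IsBoundaryVertex (M.vertexOf d.corner))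
    (hj : ∀ h, M.vertexOf (M.fromDart h).corner = M.vertexOf d.corner → M.IsJoining h) :
    ∃ g : ℕ → OrientedGluing K₁, (∀ i, M.fromDart (g i) = (M.rotation ^ (i + 1)) d) ∧
      M.IsInteriorFan [g 0, g 1, g 2, g 3] ∧ (M.rotation ^ 4) d = d ∧
      Nat.card {p // M.vertexOf p = M.vertexOf d.corner} = 4 := by
  obtain ⟨n, g, hn, hg, hfan, hper, hcard⟩ := M.exists_interiorFan hd
  have hA : ∀ i, M.tangentMatrix (g i) = !![0, 1; M.gamma (g i) 0, 0] := by
    intro i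
    have : M.IsJoining (g i) := hj _ (by
      rw [hg, ← zpow_natCast, M.vertexOf_rotation_zpow])
    rw [RationalGluing.tangentMatrix, show M.beta (g i) 0 = 0 from this]
  have hγ : ∀ i, M.gamma (g i) 0 < 0 := fun i => (M.triple_eval_zero (g i)).2
  have hprod := M.interior_compat _ hfan
  have hsec := M.interior_sectors _ hfan
  have hfour : M.fanProduct [g 0, g 1, g 2, g 3] =
      !![M.gamma (g 2) 0 * M.gamma (g 0) 0, 0; 0, M.gamma (g 3) 0 * M.gamma (g 1) 0] := by
    simp [RationalGluing.fanProduct, hA]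
  -- All A_k are antidiagonal with negative lower left entry. So n = 1, 3 give a zero diagonal and n
  -- = 2 a negative one, contrary to the product being I; for n > 4 the product of the first four
  -- would be diagonal with positive diagonal, against the sector condition.
  have hn4 : n = 4 := by
    rcases lt_trichotomy n 4 with h | h | h
    · exfalso
      interval_cases n
      · have := congrFun (congrFun hprod 0) 0
        simp [RationalGluing.fanProduct, hA] at this
      · have := congrFun (congrFun hprod 0) 0
        simp [RationalGluing.fanProduct, hA, List.range_succ] at this
        linarith [hγ 0]
      · have := congrFun (congrFun hprod 0) 0
        simp [RationalGluing.fanProduct, hA, List.range_succ] at this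
    · exact h
    · exfalso
      obtain ⟨m, rfl⟩ := Nat.exists_eq_add_of_lt h
      have hpre : [g 0, g 1, g 2, g 3] <+: (List.range (4 + m + 1)).map g := by
        have h1 : List.range 4 <+: List.range (4 + m + 1) := by
          rw [List.prefix_iff_eq_take, List.length_range, List.take_range]
          congr 1
          omega
        exact h1.map g
      obtain ⟨-, i, hi⟩ := hsec _ hpre (by simp) (fun e => by
        have := congrArg List.length e
        simp at this
        omega)
      rw [hfour] at hi
      fin_cases i
      · simp at hi
        linarith [mul_pos_of_neg_of_neg (hγ 2) (hγ 0)]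
      · simp at hi
        linarith [mul_pos_of_neg_of_neg (hγ 3) (hγ 1)]
  subst hn4
  refine ⟨g, hg, hfan, ?_, hcard⟩
  have := (hper 4).2 (by norm_num)
  rwa [show (4 : ℤ) = ((4 : ℕ) : ℤ) from rfl, zpow_natCast] at this

theorem isCrossing_iff [Finite K₀] (v : M.Vertex) :
    M.IsCrossing v ↔ ¬ M.IsBoundaryVertex v ∧
      ∀ h, M.vertexOf (M.fromDart h).corner = v → M.IsJoining h := by
  refine ⟨fun h => ⟨h.1, h.2.2⟩, fun h => ⟨h.1, ?_, h.2⟩⟩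
  obtain ⟨⟨ℓ, i⟩, rfl⟩ := Quot.exists_rep v
  obtain ⟨g, -, -, -, hc⟩ := M.exists_crossingFan (d := ⟨ℓ, i, true⟩) h.1 h.2
  exact hc

end RationalG1Surface

/-! ### Dimension counts -/

theorem Submodule.finrank_map_add_finrank_inf_ker {V W : Type*} [AddCommGroup V] [Module ℝ V]
    [AddCommGroup W] [Module ℝ W] (S : Submodule ℝ V) [FiniteDimensional ℝ S] (f : V →ₗ[ℝ] W) :
    Module.finrank ℝ (S.map f) + Module.finrank ℝ (S ⊓ LinearMap.ker f : Submodule ℝ V) =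
      Module.finrank ℝ S := by
  rw [← LinearMap.finrank_range_add_finrank_ker (f.domRestrict S), LinearMap.range_domRestrict,
    LinearMap.ker_domRestrict, ← Submodule.map_comap_subtype, Submodule.finrank_map_subtype_eq]

/-- If `L` is compared by means of `i`, `j` with a linear map `T` between other spaces, and the
kernel of `i` is in the image of `L`, then `L` and `T` have the same index and cokernel. -/
theorem Submodule.finrank_inf_ker_add {V W C F : Type*} [AddCommGroup V] [Module ℝ V]
    [AddCommGroup W] [Module ℝ W] [AddCommGroup C] [Module ℝ C] [AddCommGroup F] [Module ℝ F]
    [FiniteDimensional ℝ C] (S : Submodule ℝ V) (E : Submodule ℝ W) [FiniteDimensional ℝ S]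
    [FiniteDimensional ℝ E] (L : V →ₗ[ℝ] W) (j : V →ₗ[ℝ] C) (i : W →ₗ[ℝ] F) (T : C →ₗ[ℝ] F)
    (hL : S.map L ≤ E) (hT : ∀ x, T (j x) = i (L x)) (hj : S.map j = ⊤) (hi : E.map i = ⊤)
    (hker : ∀ w ∈ E, i w = 0 → w ∈ S.map L) :
    Module.finrank ℝ (S ⊓ LinearMap.ker L : Submodule ℝ V) + Module.finrank ℝ E +
      Module.finrank ℝ C =
    Module.finrank ℝ S + Module.finrank ℝ F + Module.finrank ℝ (LinearMap.ker T) := by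
  have h1 := S.finrank_map_add_finrank_inf_ker L
  have h2 := E.finrank_map_add_finrank_inf_ker i
  have h3 := (S.map L).finrank_map_add_finrank_inf_ker i
  have h4 := T.finrank_range_add_finrank_ker
  -- As j is onto, T and i ∘ L have the same image.
  have h5 : (S.map L).map i = LinearMap.range T := by
    rw [← Submodule.map_comp, show i ∘ₗ L = T ∘ₗ j from LinearMap.ext fun x => (hT x).symm,
      Submodule.map_comp, hj, Submodule.map_top]
  -- The image of L contains all of the kernel of i on E, so the codimension of the image of L is
  -- seen entirely in F.
  have h6 : S.map L ⊓ LinearMap.ker i = E ⊓ LinearMap.ker i :=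
    le_antisymm (inf_le_inf_right _ hL) fun w hw => ⟨hker w hw.1 hw.2, hw.2⟩
  rw [h5, h6] at h3
  rw [hi, finrank_top] at h2
  omega

theorem finrank_fun_real (ι : Type*) [Finite ι] : Module.finrank ℝ (ι → ℝ) = Nat.card ι := by
  have := Fintype.ofFinite ι
  rw [Module.finrank_fintype_fun_eq_card, Nat.card_eq_fintype_card]

theorem finrank_fun_fin_real (ι : Type*) [Finite ι] (n : ℕ) :
    Module.finrank ℝ (ι → Fin n → ℝ) = Nat.card ι * n := by
  have := Fintype.ofFinite ι
  simp [Module.finrank_pi_fintype, Nat.card_eq_fintype_card]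

/-! ### Jets at the polygonal vertices -/

namespace Dart

variable {K₀ : Type*} {Ω : K₀ → ConvexPolygon}

/-- The components of a collection of jets at the polygonal vertices, in the standard coordinates
attached to a directed edge. -/
def component (d : Dart Ω) (c : (Σ ℓ, Fin ((Ω ℓ).m + 3)) → Fin 4 → ℝ) (j : Fin 4) : ℝ :=
  c d.corner (if d.fwd then j else Equiv.swap 1 2 j)

theorem component_add (d : Dart Ω) (c c' : (Σ ℓ, Fin ((Ω ℓ).m + 3)) → Fin 4 → ℝ) (j : Fin 4) :
    d.component (c + c') j = d.component c j + d.component c' j := rfl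

theorem component_smul (d : Dart Ω) (r : ℝ) (c : (Σ ℓ, Fin ((Ω ℓ).m + 3)) → Fin 4 → ℝ)
    (j : Fin 4) : d.component (r • c) j = r * d.component c j := rfl

theorem component_other (d : Dart Ω) (c : (Σ ℓ, Fin ((Ω ℓ).m + 3)) → Fin 4 → ℝ) :
    d.other.component c 0 = d.component c 0 ∧ d.other.component c 1 = d.component c 2 ∧
    d.other.component c 2 = d.component c 1 ∧ d.other.component c 3 = d.component c 3 := by
  have h : d.other.fwd = !d.fwd := rfl
  have h3 : Equiv.swap (1 : Fin 4) 2 3 = 3 := by decide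
  have h0 : Equiv.swap (1 : Fin 4) 2 0 = 0 := by decide
  unfold component
  rw [d.other_corner, h]
  cases d.fwd <;> simp [h3, h0]

end Dart

/-! ### The corner problem: values and gradients -/

namespace RationalG1Surface

variable {K₀ K₁ : Type*} (M : RationalG1Surface K₀ K₁)

/-- The jet of the deviation from the `G¹` conditions, at the starting point of an oriented edge,
in terms of the jets of the functions on both sides. The last entry is meaningful at a joining
edge only. -/
noncomputable def cornerGap (h : OrientedGluing K₁) :
    ((Σ ℓ, Fin ((M.Ω ℓ).m + 3)) → Fin 4 → ℝ) →ₗ[ℝ] (Fin 4 → ℝ) where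
  toFun c :=
    ![(M.fromDart h).component c 0 - (M.toDart h).component c 0,
      (M.fromDart h).component c 1 - (M.toDart h).component c 1,
      (M.triple h).a.eval 0 * (M.fromDart h).component c 2
        - (M.triple h).b.eval 0 * (M.toDart h).component c 1
        - (M.triple h).c.eval 0 * (M.toDart h).component c 2,
      (derivative (M.triple h).a).eval 0 * (M.fromDart h).component c 2
        + (M.triple h).a.eval 0 * (M.fromDart h).component c 3
        - (derivative (M.triple h).b).eval 0 * (M.toDart h).component c 1
        - (derivative (M.triple h).c).eval 0 * (M.toDart h).component c 2
        - (M.triple h).c.eval 0 * (M.toDart h).component c 3]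
  map_add' c c' := by
    ext i
    fin_cases i <;> simp [Dart.component_add] <;> ring
  map_smul' r c := by
    ext i
    fin_cases i <;> simp [Dart.component_smul] <;> ring

/-- From the other side, (a, b, c) becomes (c, -b, a) and V becomes -V + b W'. Hence it is enough to
impose the conditions from one side. The fourth entry omits the terms with b(0), so only b'(0)
appears in it. -/
theorem cornerGap_flip (h : OrientedGluing K₁) (c) :
    M.cornerGap h.flip c 0 = -M.cornerGap h c 0 ∧ M.cornerGap h.flip c 1 = -M.cornerGap h c 1 ∧
    M.cornerGap h.flip c 2 =
      -M.cornerGap h c 2 + (M.triple h).b.eval 0 * M.cornerGap h c 1 ∧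
    M.cornerGap h.flip c 3 =
      -M.cornerGap h c 3 + (derivative (M.triple h).b).eval 0 * M.cornerGap h c 1 := by
  simp only [cornerGap, LinearMap.coe_mk, AddHom.coe_mk, M.fromDart_flip, M.toDart_flip,
    RationalGluing.triple_flip, GluingTriple.swap]
  refine ⟨?_, ?_, ?_, ?_⟩ <;> simp <;> ring

/-- The oriented edges from a fixed side. -/
abbrev HalfEdge (K₁ : Type*) := {h : OrientedGluing K₁ // h.swap = false}

/-- The joining ones among the oriented edges from a fixed side. -/
abbrev JoiningHalfEdge := {h : OrientedGluing K₁ // h.swap = false ∧ M.IsJoining h}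

/-- The first three entries at all oriented edges, and the fourth at the joining ones. -/
noncomputable def selectRows {V : Type*} [AddCommGroup V] [Module ℝ V]
    (r : OrientedGluing K₁ → V →ₗ[ℝ] (Fin 4 → ℝ)) :
    V →ₗ[ℝ] (HalfEdge K₁ → Fin 3 → ℝ) × (M.JoiningHalfEdge → ℝ) :=
  LinearMap.prod (LinearMap.pi fun h => LinearMap.funLeft ℝ ℝ Fin.castSucc ∘ₗ r h.1)
    (LinearMap.pi fun h => LinearMap.proj 3 ∘ₗ r h.1)

theorem selectRows_eq_iff {V : Type*} [AddCommGroup V] [Module ℝ V]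
    (r : OrientedGluing K₁ → V →ₗ[ℝ] (Fin 4 → ℝ)) (x : V)
    (f : (HalfEdge K₁ → Fin 3 → ℝ) × (M.JoiningHalfEdge → ℝ)) :
    M.selectRows r x = f ↔ (∀ h : HalfEdge K₁, r h.1 x 0 = f.1 h 0 ∧ r h.1 x 1 = f.1 h 1 ∧
      r h.1 x 2 = f.1 h 2) ∧ ∀ h : M.JoiningHalfEdge, r h.1 x 3 = f.2 h := by
  constructor
  · rintro rfl
    exact ⟨fun h => ⟨rfl, rfl, rfl⟩, fun h => rfl⟩
  · rintro ⟨h1, h2⟩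
    refine Prod.ext (funext fun h => funext fun i => ?_) (funext fun h => h2 h)
    fin_cases i
    · exact (h1 h).1
    · exact (h1 h).2.1
    · exact (h1 h).2.2

/-- The jets with matching values and compatible gradients. -/
def compatible : Submodule ℝ ((Σ ℓ, Fin ((M.Ω ℓ).m + 3)) → Fin 4 → ℝ) where
  carrier := {c | ∀ h, M.cornerGap h c 0 = 0 ∧ M.cornerGap h c 1 = 0 ∧ M.cornerGap h c 2 = 0}
  zero_mem' h := by simp
  add_mem' := by
    intro c c' hc hc' h
    simp [hc h, hc' h]
  smul_mem' := by
    intro r c hc h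
    simp [hc h]

theorem mem_ker_selectRows_cornerGap (c) :
    c ∈ LinearMap.ker (M.selectRows M.cornerGap) ↔
      c ∈ M.compatible ∧ ∀ h, M.IsJoining h → M.cornerGap h c 3 = 0 := by
  rw [LinearMap.mem_ker, selectRows_eq_iff]
  constructor
  · rintro ⟨h1, h2⟩
    have h3 : c ∈ M.compatible := by
      intro h
      by_cases hs : h.swap = false
      · exact h1 ⟨h, hs⟩
      · have h4 : M.cornerGap h.flip c 0 = 0 ∧ M.cornerGap h.flip c 1 = 0 ∧
            M.cornerGap h.flip c 2 = 0 := h1 ⟨h.flip, by simpa [OrientedGluing.flip] using hs⟩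
        obtain ⟨e0, e1, e2, -⟩ := M.cornerGap_flip h.flip c
        rw [h.flip_flip] at e0 e1 e2
        rw [e0, e1, e2, h4.1, h4.2.1, h4.2.2]
        simp
    refine ⟨h3, fun h hj => ?_⟩
    by_cases hs : h.swap = false
    · exact h2 ⟨h, hs, hj⟩
    · have h4 : M.cornerGap h.flip c 3 = 0 := h2 ⟨h.flip,
        by simpa [OrientedGluing.flip] using hs, (M.isJoining_flip h).2 hj⟩
      obtain ⟨-, -, -, e3⟩ := M.cornerGap_flip h.flip c
      rw [h.flip_flip] at e3
      rw [e3, h4, (h3 _).2.1]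
      simp
  · rintro ⟨h1, h2⟩
    exact ⟨fun h => h1 h.1, fun h => h2 h.1 h.2.2⟩

theorem component_toDart {c} (hc : c ∈ M.compatible) (h : OrientedGluing K₁) :
    (M.fromDart h).component c 0 = (M.toDart h).component c 0 ∧
    (M.fromDart h).component c 1 = (M.toDart h).component c 1 ∧
    (M.fromDart h).component c 2 =
      M.beta h 0 * (M.toDart h).component c 1 + M.gamma h 0 * (M.toDart h).component c 2 := by
  obtain ⟨h0, h1, h2⟩ := hc h
  have ha := (M.triple_eval_zero h).1
  simp only [cornerGap, LinearMap.coe_mk, AddHom.coe_mk, Matrix.cons_val_zero,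
    Matrix.cons_val_one, Matrix.cons_val] at h0 h1 h2
  refine ⟨by linarith, by linarith, ?_⟩
  rw [RationalGluing.beta, RationalGluing.gamma, GluingTriple.beta, GluingTriple.gamma]
  field_simp
  linarith

/-- Values and gradients at one directed edge for every vertex, and the mixed derivatives. -/
noncomputable def baseJets (base : M.Vertex → Dart M.Ω) :
    ((Σ ℓ, Fin ((M.Ω ℓ).m + 3)) → Fin 4 → ℝ) →ₗ[ℝ]
      (M.Vertex → Fin 3 → ℝ) × ((Σ ℓ, Fin ((M.Ω ℓ).m + 3)) → ℝ) where
  toFun c := (fun v i => (base v).component c i.castSucc, fun p => c p 3)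
  map_add' _ _ := rfl
  map_smul' _ _ := rfl

/-- Vanishing of value and gradient propagates from the base through `other` and `glue` to all
directed edges at the vertex. -/
theorem eq_zero_of_baseJets_eq_zero {base : M.Vertex → Dart M.Ω}
    (hbase : ∀ v, M.vertexOf (base v).corner = v) {c} (hc : c ∈ M.compatible)
    (h0 : M.baseJets base c = 0) : c = 0 := by
  have key : ∀ d : Dart M.Ω, d.component c 0 = 0 ∧ d.component c 1 = 0 ∧ d.component c 2 = 0 := by
    intro d
    refine M.dart_induction (P := fun d => d.component c 0 = 0 ∧ d.component c 1 = 0 ∧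
      d.component c 2 = 0) (d₀ := base (M.vertexOf d.corner)) ?_ ?_ ?_ (hbase _).symm
    · rintro d ⟨h0, h1, h2⟩
      obtain ⟨e0, e1, e2, -⟩ := d.component_other c
      exact ⟨e0.trans h0, e1.trans h2, e2.trans h1⟩
    · rintro d ⟨h0, h1, h2⟩
      by_cases hd : ∃ h, M.fromDart h = d
      · obtain ⟨h, rfl⟩ := hd
        obtain ⟨e0, e1, e2⟩ := M.component_toDart hc h.flip
        rw [M.fromDart_flip, M.toDart_flip] at e0 e1 e2
        rw [M.glue_fromDart, e0, e1, e2, h0, h1, h2]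
        simp
      · rw [M.glue_of_not_exists hd]
        exact ⟨h0, h1, h2⟩
    · have h1 := congrFun (congrArg Prod.fst h0) (M.vertexOf d.corner)
      exact ⟨congrFun h1 0, congrFun h1 1, congrFun h1 2⟩
  ext ⟨ℓ, i⟩ j
  fin_cases j
  · exact (key ⟨ℓ, i, true⟩).1
  · exact (key ⟨ℓ, i, true⟩).2.1
  · exact (key ⟨ℓ, i, true⟩).2.2
  · exact congrFun (congrArg Prod.snd h0) ⟨ℓ, i⟩

/-- Values are constant on each vertex, gradients come from `exists_section`, and mixed derivatives
do not enter the first three rows. -/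
theorem exists_baseJets_eq [Finite K₀] {base : M.Vertex → Dart M.Ω}
    (hbase : ∀ v, M.vertexOf (base v).corner = v)
    (x : (M.Vertex → Fin 3 → ℝ) × ((Σ ℓ, Fin ((M.Ω ℓ).m + 3)) → ℝ)) :
    ∃ c ∈ M.compatible, M.baseJets base c = x := by
  obtain ⟨s, hso, hsg, hsb⟩ := M.exists_section base hbase fun v => ![x.1 v 1, x.1 v 2]
  let c : (Σ ℓ, Fin ((M.Ω ℓ).m + 3)) → Fin 4 → ℝ := fun p =>
    ![x.1 (M.vertexOf p) 0, s ⟨p.1, p.2, true⟩ 0, s ⟨p.1, p.2, true⟩ 1, x.2 p]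
  have hc : ∀ d : Dart M.Ω, d.component c 0 = x.1 (M.vertexOf d.corner) 0 ∧
      d.component c 1 = s d 0 ∧ d.component c 2 = s d 1 := by
    have h1 : ∀ ℓ i, (⟨ℓ, i, true⟩ : Dart M.Ω).component c 0 = x.1 (M.vertexOf ⟨ℓ, i⟩) 0 ∧
        (⟨ℓ, i, true⟩ : Dart M.Ω).component c 1 = s ⟨ℓ, i, true⟩ 0 ∧
        (⟨ℓ, i, true⟩ : Dart M.Ω).component c 2 = s ⟨ℓ, i, true⟩ 1 := fun ℓ i => ⟨rfl, rfl, rfl⟩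
    rintro ⟨ℓ, i, b⟩
    cases b
    · obtain ⟨e0, e1, e2, -⟩ := (⟨ℓ, i, false⟩ : Dart M.Ω).component_other c
      have h2 := hso ⟨ℓ, i, false⟩
      rw [Dart.mk_other_false] at e0 e1 e2 h2
      rw [← e0, ← e1, ← e2, (h1 ℓ (i + 1)).1, (h1 ℓ (i + 1)).2.1, (h1 ℓ (i + 1)).2.2, h2]
      exact ⟨rfl, rfl, rfl⟩
    · exact h1 ℓ i
  refine ⟨c, fun h => ?_, ?_⟩
  · obtain ⟨e0, e1, e2⟩ := hc (M.fromDart h)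
    obtain ⟨f0, f1, f2⟩ := hc (M.toDart h)
    have hv : M.vertexOf (M.toDart h).corner = M.vertexOf (M.fromDart h).corner := by
      rw [← M.glue_fromDart, M.vertexOf_glue]
    have hs := hsg (M.toDart h)
    rw [M.glue_toDart, ← M.fromDart_flip, M.transport_fromDart, OrientedGluing.flip_flip,
      M.fromDart_flip] at hs
    have ha := (M.triple_eval_zero h).1
    simp only [cornerGap, LinearMap.coe_mk, AddHom.coe_mk, Matrix.cons_val_zero,
      Matrix.cons_val_one, Matrix.cons_val, e0, e1, e2, f0, f1, f2, hv, hs]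
    refine ⟨sub_self _, sub_self _, ?_⟩
    rw [RationalGluing.beta, RationalGluing.gamma, GluingTriple.beta, GluingTriple.gamma]
    field_simp
    ring
  · refine Prod.ext (funext fun v => funext fun i => ?_) rfl
    obtain ⟨e0, e1, e2⟩ := hc (base v)
    rw [hsb] at e1 e2
    rw [hbase] at e0
    fin_cases i
    · exact e0
    · exact e1
    · exact e2

theorem exists_base : ∃ base : M.Vertex → Dart M.Ω, ∀ v, M.vertexOf (base v).corner = v := by
  have : ∀ v : M.Vertex, ∃ d : Dart M.Ω, M.vertexOf d.corner = v := by
    intro v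
    obtain ⟨⟨ℓ, i⟩, rfl⟩ := Quot.exists_rep v
    exact ⟨⟨ℓ, i, true⟩, rfl⟩
  exact ⟨fun v => (this v).choose, fun v => (this v).choose_spec⟩

instance [Finite K₀] : Finite M.Vertex := Finite.of_surjective _ Quot.mk_surjective

theorem finrank_compatible [Finite K₀] : Module.finrank ℝ M.compatible =
    M.numVertices * 3 + Nat.card (Σ ℓ, Fin ((M.Ω ℓ).m + 3)) := by
  obtain ⟨base, hbase⟩ := M.exists_base
  have h := M.compatible.finrank_map_add_finrank_inf_ker (M.baseJets base)
  have h1 : M.compatible.map (M.baseJets base) = ⊤ :=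
    Submodule.eq_top_iff'.2 fun x => M.exists_baseJets_eq hbase x
  have h2 : M.compatible ⊓ LinearMap.ker (M.baseJets base) = ⊥ :=
    (Submodule.eq_bot_iff _).2 fun c hc => M.eq_zero_of_baseJets_eq_zero hbase hc.1 hc.2
  have := Fintype.ofFinite K₀
  have := Fintype.ofFinite M.Vertex
  rw [h1, h2, finrank_top, finrank_bot, add_zero, Module.finrank_prod, finrank_fun_fin_real,
    finrank_fun_real] at h
  exact h.symm

end RationalG1Surface

instance {K₁ : Type*} [Finite K₁] : Finite (OrientedGluing K₁) :=
  Finite.of_injective (β := K₁ × Bool × Bool) (fun h => (h.e, h.swap, h.back)) (by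
    rintro ⟨e, s, b⟩ ⟨e', s', b'⟩ h
    simp only [Prod.mk.injEq] at h
    obtain ⟨rfl, rfl, rfl⟩ := h
    rfl)

/-! ### The corner problem: independence of the conditions on mixed derivatives -/

namespace RationalG1Surface

variable {K₀ K₁ : Type*} (M : RationalG1Surface K₀ K₁)

/-- The oriented edges that start, on one of their sides, at the chosen directed edge of a
crossing vertex. -/
def IsOmitted (base : M.Vertex → Dart M.Ω) (h : OrientedGluing K₁) : Prop :=
  ∃ v, M.IsCrossing v ∧ (M.fromDart h = base v ∨ M.toDart h = base v)

theorem isOmitted_flip {base : M.Vertex → Dart M.Ω} {h : OrientedGluing K₁} :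
    M.IsOmitted base h.flip ↔ M.IsOmitted base h := by
  simp only [IsOmitted, M.fromDart_flip, M.toDart_flip, or_comm]

/-- The joining half edges that are not omitted. -/
abbrev RetainedHalfEdge (base : M.Vertex → Dart M.Ω) :=
  {h : OrientedGluing K₁ // (h.swap = false ∧ M.IsJoining h) ∧ ¬ M.IsOmitted base h}

/-- The conditions on the mixed derivatives at the retained half edges. -/
noncomputable def mixedGap (base : M.Vertex → Dart M.Ω) :
    ((Σ ℓ, Fin ((M.Ω ℓ).m + 3)) → Fin 4 → ℝ) →ₗ[ℝ] (M.RetainedHalfEdge base → ℝ) :=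
  LinearMap.pi fun h => LinearMap.proj 3 ∘ₗ M.cornerGap h.1

/-- The collection of jets with prescribed mixed derivatives and no other terms. -/
def mixedJets (m : (Σ ℓ, Fin ((M.Ω ℓ).m + 3)) → ℝ) :
    (Σ ℓ, Fin ((M.Ω ℓ).m + 3)) → Fin 4 → ℝ := fun p => ![0, 0, 0, m p]

theorem cornerGap_mixedJets (h : OrientedGluing K₁) (m) :
    M.cornerGap h (M.mixedJets m) = ![0, 0, 0, (M.triple h).a.eval 0 * m (M.fromDart h).corner
      - (M.triple h).c.eval 0 * m (M.toDart h).corner] := by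
  have key : ∀ d : Dart M.Ω, d.component (M.mixedJets m) 0 = 0 ∧
      d.component (M.mixedJets m) 1 = 0 ∧ d.component (M.mixedJets m) 2 = 0 ∧
      d.component (M.mixedJets m) 3 = m d.corner := by
    rintro ⟨ℓ, i, b⟩
    cases b
    · obtain ⟨e0, e1, e2, e3⟩ := (⟨ℓ, i, false⟩ : Dart M.Ω).component_other (M.mixedJets m)
      rw [← e0, ← e1, ← e2, ← e3]
      exact ⟨rfl, rfl, rfl, rfl⟩
    · exact ⟨rfl, rfl, rfl, rfl⟩
  obtain ⟨e0, e1, e2, e3⟩ := key (M.fromDart h)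
  obtain ⟨f0, f1, f2, f3⟩ := key (M.toDart h)
  simp [cornerGap, e0, e1, e2, e3, f0, f1, f2, f3]

theorem mixedJets_mem_compatible (m) : M.mixedJets m ∈ M.compatible := fun h => by
  simp [cornerGap_mixedJets]

/-- Provides, at every vertex, a place where no retained condition is imposed: a boundary edge, an
edge that is not joining, or the omitted edge of a crossing vertex. -/
theorem exists_not_joining_or [Finite K₀] {base : M.Vertex → Dart M.Ω}
    (hbase : ∀ v, M.vertexOf (base v).corner = v) (v : M.Vertex) :
    ∃ d : Dart M.Ω, M.vertexOf d.corner = v ∧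
      ∀ h, M.fromDart h = d → ¬ M.IsJoining h ∨ M.IsOmitted base h := by
  by_cases hv : M.IsCrossing v
  · exact ⟨base v, hbase v, fun h hh => Or.inr ⟨v, hv, Or.inl hh⟩⟩
  · rw [M.isCrossing_iff] at hv
    by_cases hb : M.IsBoundaryVertex v
    · obtain ⟨d, hd, hdv⟩ := hb
      exact ⟨d, hdv, fun h hh => ((M.isBoundaryEdge_iff d).1 hd ⟨h, hh⟩).elim⟩
    · simp only [hb, not_false_eq_true, true_and, not_forall] at hv
      obtain ⟨h, hh, hj⟩ := hv
      exact ⟨M.fromDart h, hh, fun h' hh' => Or.inl (by rwa [M.fromDart_injective hh'])⟩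

/-- Here s vanishes at one directed edge of each vertex by `exists_not_joining_or`, and its
vanishing propagates through `other` and `glue` to the whole vertex. Then y takes the same value on
both sides of each gluing, and on one of them it is zero. -/
theorem eq_zero_of_transpose_eq_zero [Finite K₀] [Finite K₁] {base : M.Vertex → Dart M.Ω}
    (hbase : ∀ v, M.vertexOf (base v).corner = v) (y : OrientedGluing K₁ → ℝ)
    (hy : ∀ h, (h.swap = true ∨ ¬ M.IsJoining h ∨ M.IsOmitted base h) → y h = 0)
    (s : Dart M.Ω → ℝ) (hs : ∀ h, s (M.fromDart h) = (M.triple h).a.eval 0 * (y h - y h.flip))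
    (hs' : ∀ d, (¬ ∃ h, M.fromDart h = d) → s d = 0) (hso : ∀ d, s d + s d.other = 0) :
    y = 0 := by
  have hzero : ∀ h, s (M.fromDart h) = 0 ↔ y h = y h.flip := fun h => by
    rw [hs, mul_eq_zero, or_iff_right (M.triple_eval_zero h).1, sub_eq_zero]
  have key : ∀ d, s d = 0 := by
    intro d
    obtain ⟨d₀, hd₀, hd⟩ := M.exists_not_joining_or hbase (M.vertexOf d.corner)
    refine M.dart_induction (P := fun d => s d = 0) (d₀ := d₀) ?_ ?_ ?_ hd₀.symm
    · intro d h
      have := hso d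
      rw [h, zero_add] at this
      exact this
    · intro d h
      by_cases hex : ∃ h, M.fromDart h = d
      · obtain ⟨h', rfl⟩ := hex
        rw [M.glue_fromDart, ← M.fromDart_flip, hzero, h'.flip_flip]
        exact ((hzero h').1 h).symm
      · rwa [M.glue_of_not_exists hex]
    · by_cases hex : ∃ h, M.fromDart h = d₀
      · obtain ⟨h, rfl⟩ := hex
        have h1 := hd h rfl
        rw [hzero, hy h (Or.inr h1), hy h.flip (Or.inr ?_)]
        rwa [M.isJoining_flip, M.isOmitted_flip]
      · exact hs' _ hex
  funext h
  have h1 := (hzero h).1 (key _)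
  cases hb : h.swap
  · rw [h1]
    exact hy _ (Or.inl (by simp [OrientedGluing.flip, hb]))
  · exact hy _ (Or.inl hb)

/-- By duality: a functional annihilating the image is given by weights y on the retained half
edges. Jets consisting of mixed derivatives only are compatible, and testing on them yields one
equation for each corner, which forces y = 0. -/
theorem mixedGap_surjective [Finite K₀] [Finite K₁] {base : M.Vertex → Dart M.Ω}
    (hbase : ∀ v, M.vertexOf (base v).corner = v) :
    M.compatible.map (M.mixedGap base) = ⊤ := by
  classical
  by_contra hne
  obtain ⟨f, hf0, hf⟩ := Submodule.exists_le_ker_of_lt_top _ (lt_top_iff_ne_top.2 hne)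
  have := Fintype.ofFinite (M.RetainedHalfEdge base)
  have := Fintype.ofFinite (OrientedGluing K₁)
  let y : OrientedGluing K₁ → ℝ := fun h =>
    if hh : (h.swap = false ∧ M.IsJoining h) ∧ ¬ M.IsOmitted base h then
      f (Pi.single ⟨h, hh⟩ 1) else 0
  have hfy : ∀ x, f x = ∑ h : M.RetainedHalfEdge base, y h.1 * x h := by
    intro x
    conv_lhs => rw [pi_eq_sum_univ x, map_sum]
    refine Finset.sum_congr rfl fun h _ => ?_
    rw [map_smul, smul_eq_mul, mul_comm]
    congr 1
    simp only [y, dif_pos h.2]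
    congr 1
    ext h'
    rw [Pi.single_apply]
    exact if_congr eq_comm rfl rfl
  have hy : ∀ h, (h.swap = true ∨ ¬ M.IsJoining h ∨ M.IsOmitted base h) → y h = 0 := by
    intro h hh
    refine dif_neg ?_
    rintro ⟨⟨h1, h2⟩, h3⟩
    rcases hh with hh | hh | hh
    · rw [h1] at hh
      exact Bool.false_ne_true hh
    · exact hh h2
    · exact h3 hh
  have hsum : ∀ m : (Σ ℓ, Fin ((M.Ω ℓ).m + 3)) → ℝ, ∑ h : OrientedGluing K₁,
      y h * ((M.triple h).a.eval 0 * m (M.fromDart h).corner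
        - (M.triple h).c.eval 0 * m (M.toDart h).corner) = 0 := by
    intro m
    have h1 : f (M.mixedGap base (M.mixedJets m)) = 0 :=
      hf ⟨_, M.mixedJets_mem_compatible m, rfl⟩
    rw [hfy] at h1
    refine Eq.trans ?_ h1
    refine (Fintype.sum_of_injective Subtype.val Subtype.val_injective _ _ ?_ ?_).symm
    · intro h hh
      have h2 : y h = 0 := dif_neg fun h3 => hh ⟨⟨h, h3⟩, rfl⟩
      rw [h2, zero_mul]
    · intro h
      simp [mixedGap, cornerGap_mixedJets]
  -- The share of the directed edge d in the coefficient of the mixed derivative at its corner. A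
  -- corner has the two directed edges d and `d.other`, so their shares add up to zero.
  let s : Dart M.Ω → ℝ := fun d => ∑ h : OrientedGluing K₁,
    y h * ((M.triple h).a.eval 0 * (if M.fromDart h = d then 1 else 0)
      - (M.triple h).c.eval 0 * (if M.toDart h = d then 1 else 0))
  have hy0 : y = 0 := by
    refine M.eq_zero_of_transpose_eq_zero hbase y hy s ?_ ?_ ?_
    · intro h
      have h1 : ∀ h', (M.fromDart h' = M.fromDart h) = (h' = h) := fun h' =>
        propext ⟨fun e => M.fromDart_injective e, fun e => by rw [e]⟩
      have h2 : ∀ h', (M.toDart h' = M.fromDart h) = (h' = h.flip) := fun h' =>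
        propext ⟨fun e => by
          rw [← M.fromDart_flip] at e
          rw [← M.fromDart_injective e, h'.flip_flip], fun e => by rw [e, M.toDart_flip]⟩
      have h3 : (M.triple h.flip).c = (M.triple h).a := by
        rw [RationalGluing.triple_flip]
        rfl
      simp only [s, h1, h2, mul_sub, Finset.sum_sub_distrib, mul_ite, mul_one, mul_zero,
        Finset.sum_ite_eq', Finset.mem_univ, if_true, h3]
      ring
    · intro d hd
      refine Finset.sum_eq_zero fun h _ => ?_
      have h1 : M.fromDart h ≠ d := fun e => hd ⟨h, e⟩
      have h2 : M.toDart h ≠ d := fun e => hd ⟨h.flip, (M.fromDart_flip h).trans e⟩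
      simp [h1, h2]
    · intro d
      rw [← hsum (fun p => if p = d.corner then 1 else 0), ← Finset.sum_add_distrib]
      refine Finset.sum_congr rfl fun h _ => ?_
      have h1 : ∀ d' : Dart M.Ω, (if d' = d then (1 : ℝ) else 0) +
          (if d' = d.other then 1 else 0) = if d'.corner = d.corner then 1 else 0 := by
        intro d'
        by_cases h2 : d'.corner = d.corner
        · rcases Dart.eq_or_eq_other h2 with rfl | rfl
          · simp [d'.other_ne.symm]
          · simp [d.other_ne, d.other_corner]
        · have h3 : d' ≠ d := fun e => h2 (by rw [e])
          have h4 : d' ≠ d.other := fun e => h2 (by rw [e, d.other_corner])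
          simp [h2, h3, h4]
      rw [← h1, ← h1]
      ring
  refine hf0 (LinearMap.ext fun x => ?_)
  rw [hfy, hy0]
  simp

end RationalG1Surface

/-! ### Crossing vertices and the dimension of the corner problem -/

namespace RationalG1Surface

variable {K₀ K₁ : Type*} (M : RationalG1Surface K₀ K₁)

theorem deriv_div_eval_zero {p q : ℝ[X]} (hq : q.eval 0 ≠ 0) :
    deriv (fun t => p.eval t / q.eval t) 0 = ((derivative p).eval 0 * q.eval 0
      - p.eval 0 * (derivative q).eval 0) / q.eval 0 ^ 2 :=
  ((p.hasDerivAt 0).div (q.hasDerivAt 0) hq).deriv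

/-- Division by a(0): the term with a'(0) is rewritten by means of the gradient condition and turns
c'(0)/a(0) into γ'(0), while β'(0) is b'(0)/a(0) because b(0) = 0. -/
theorem cornerGap_three_eq_zero_iff {c} (hc : c ∈ M.compatible) {h : OrientedGluing K₁}
    (hj : M.IsJoining h) :
    M.cornerGap h c 3 = 0 ↔ (M.fromDart h).component c 3 =
      M.gamma h 0 * (M.toDart h).component c 3 + deriv (M.beta h) 0 * (M.toDart h).component c 1
        + deriv (M.gamma h) 0 * (M.toDart h).component c 2 := by
  have ha := (M.triple_eval_zero h).1
  obtain ⟨-, -, h2⟩ := M.component_toDart hc h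
  have hb : (M.triple h).b.eval 0 = 0 := by
    have h3 : (M.triple h).b.eval 0 / (M.triple h).a.eval 0 = 0 := hj
    simpa [ha] using h3
  have hβ : deriv (M.beta h) 0 = (derivative (M.triple h).b).eval 0 / (M.triple h).a.eval 0 := by
    refine (deriv_div_eval_zero ha).trans ?_
    rw [hb]
    field_simp
    ring
  have hγ := deriv_div_eval_zero (p := (M.triple h).c) ha
  change deriv (M.gamma h) 0 = _ at hγ
  rw [hβ, hγ]
  rw [show M.beta h 0 = 0 from hj, zero_mul, zero_add] at h2
  simp only [cornerGap, LinearMap.coe_mk, AddHom.coe_mk, Matrix.cons_val, h2]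
  rw [RationalGluing.gamma, GluingTriple.gamma]
  field_simp
  constructor <;> intro h <;> linarith

/-- At a crossing vertex, three of the conditions on the mixed derivatives imply the fourth. -/
theorem cornerGap_omitted [Finite K₀] {base : M.Vertex → Dart M.Ω}
    (hbase : ∀ v, M.vertexOf (base v).corner = v) {c} (hc : c ∈ M.compatible)
    (hret : ∀ h, M.IsJoining h → ¬ M.IsOmitted base h → M.cornerGap h c 3 = 0)
    {h : OrientedGluing K₁} {v : M.Vertex} (hv : M.IsCrossing v) (hh : M.fromDart h = base v) :
    M.cornerGap h c 3 = 0 := by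
  have hvd : M.vertexOf (base v).corner = v := hbase v
  generalize hd : base v = d at hvd hh
  have hb : ¬ M.IsBoundaryVertex (M.vertexOf d.corner) := by rw [hvd]; exact hv.1
  have hj : ∀ h, M.vertexOf (M.fromDart h).corner = M.vertexOf d.corner → M.IsJoining h := by
    rw [hvd]; exact hv.2.2
  obtain ⟨g, hg, hfan, hper, -⟩ := M.exists_crossingFan hb hj
  have hvx : ∀ i : ℕ, M.vertexOf ((M.rotation ^ i) d).corner = v := fun i =>
    (M.vertexOf_rotation_zpow d i).trans hvd
  have hgj : ∀ i, M.IsJoining (g i) := fun i => hj _ (by rw [hg, hvx, hvd])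
  have hto : ∀ i, M.toDart (g i) = ((M.rotation ^ i) d).other := by
    intro i
    rw [← M.glue_fromDart, hg, pow_succ', Equiv.Perm.mul_apply, M.rotation_apply, M.glue_glue]
  have h3 : h = g 3 := M.fromDart_injective (by rw [hh, hg, hper])
  -- the corners in the fan are distinct
  have hnd : ∀ i < 3, ((M.rotation ^ (i + 1)) d).corner ≠ d.corner := by
    have h4 := hfan.2.1
    simp only [List.map_cons, List.map_nil, hg, zero_add, Nat.reduceAdd, hper, List.nodup_cons,
      List.mem_cons, List.not_mem_nil, or_false, not_or] at h4
    intro i hi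
    interval_cases i
    · exact h4.1.2.2
    · exact h4.2.1.2
    · exact h4.2.2.1
  -- The omitted gluing `h` closes the cycle as `g 3`; the other three are retained because the four
  -- corners are distinct.
  have hno : ∀ i < 3, ¬ M.IsOmitted base (g i) := by
    rintro i hi ⟨w, hw, hw'⟩
    have hwv : w = v := by
      rcases hw' with hw' | hw'
      · rw [← hbase w, ← hw', hg, hvx]
      · rw [← hbase w, ← hw', hto, M.vertexOf_other, hvx]
    subst hwv
    rw [hd, hg, hto] at hw'
    rcases hw' with hw' | hw'
    · exact hnd i hi (congrArg Dart.corner hw')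
    · rcases i with - | i
      · exact d.other_ne hw'
      · refine hnd i (by omega) ?_
        rw [← Dart.other_corner, hw']
  have hprod := M.interior_compat _ hfan
  have hA : ∀ i, M.tangentMatrix (g i) = !![0, 1; M.gamma (g i) 0, 0] := fun i => by
    rw [RationalGluing.tangentMatrix, show M.beta (g i) 0 = 0 from hgj i]
  have hfour : M.fanProduct [g 0, g 1, g 2, g 3] =
      !![M.gamma (g 2) 0 * M.gamma (g 0) 0, 0; 0, M.gamma (g 3) 0 * M.gamma (g 1) 0] := by
    simp [RationalGluing.fanProduct, hA]
  rw [hfour] at hprod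
  have hγ20 : M.gamma (g 2) 0 * M.gamma (g 0) 0 = 1 := congrFun (congrFun hprod 0) 0
  have hγ31 : M.gamma (g 3) 0 * M.gamma (g 1) 0 = 1 := congrFun (congrFun hprod 1) 1
  have step : ∀ i, ((M.rotation ^ (i + 1)) d).component c 1 =
        ((M.rotation ^ i) d).component c 2 ∧
      ((M.rotation ^ (i + 1)) d).component c 2 =
        M.gamma (g i) 0 * ((M.rotation ^ i) d).component c 1 := by
    intro i
    obtain ⟨-, e1, e2⟩ := M.component_toDart hc (g i)
    obtain ⟨-, f1, f2, -⟩ := ((M.rotation ^ i) d).component_other c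
    rw [hg, hto] at e1 e2
    rw [show M.beta (g i) 0 = 0 from hgj i, zero_mul, zero_add] at e2
    exact ⟨e1.trans f1, by rw [e2, f2]⟩
  have mixed : ∀ i, M.cornerGap (g i) c 3 = 0 ↔ ((M.rotation ^ (i + 1)) d).component c 3 =
      M.gamma (g i) 0 * ((M.rotation ^ i) d).component c 3
        + deriv (M.beta (g i)) 0 * ((M.rotation ^ i) d).component c 2
        + deriv (M.gamma (g i)) 0 * ((M.rotation ^ i) d).component c 1 := by
    intro i
    obtain ⟨-, f1, f2, f3⟩ := ((M.rotation ^ i) d).component_other c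
    rw [M.cornerGap_three_eq_zero_iff hc (hgj i), hg, hto, f1, f2, f3]
  have m0 := (mixed 0).1 (hret _ (hgj 0) (hno 0 (by norm_num)))
  have m1 := (mixed 1).1 (hret _ (hgj 1) (hno 1 (by norm_num)))
  have m2 := (mixed 2).1 (hret _ (hgj 2) (hno 2 (by norm_num)))
  obtain ⟨p1, q1⟩ := step 0
  obtain ⟨p2, q2⟩ := step 1
  obtain ⟨p3, q3⟩ := step 2
  obtain ⟨c1, c2⟩ := M.crossing_compat _ _ _ _ hfan (hgj 0) (hgj 1) (hgj 2) (hgj 3)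
  rw [h3, mixed 3]
  norm_num only [zero_add, pow_zero, Nat.reduceAdd, Equiv.Perm.one_apply] at m0 m1 m2 p1 q1 p2 q2 p3 q3 ⊢
  rw [hper, m2, m1, m0, p3, q3, p2, q2, p1, q1]
  -- A₄A₃A₂A₁ = I makes opposite γ inverse to each other, which clears the denominators of the
  -- crossing condition.
  have i0 : (M.gamma (g 0) 0)⁻¹ = M.gamma (g 2) 0 := (eq_inv_of_mul_eq_one_left hγ20).symm
  have i1 : (M.gamma (g 1) 0)⁻¹ = M.gamma (g 3) 0 := (eq_inv_of_mul_eq_one_left hγ31).symm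
  have i2 : (M.gamma (g 2) 0)⁻¹ = M.gamma (g 0) 0 := inv_eq_of_mul_eq_one_right hγ20
  have i3 : (M.gamma (g 3) 0)⁻¹ = M.gamma (g 1) 0 := inv_eq_of_mul_eq_one_right hγ31
  rw [div_eq_mul_inv, div_eq_mul_inv, i1, i3] at c1
  rw [div_eq_mul_inv, div_eq_mul_inv, i2, i0] at c2
  generalize M.gamma (g 0) 0 = x0 at *
  generalize M.gamma (g 1) 0 = x1 at *
  generalize M.gamma (g 2) 0 = x2 at *
  generalize M.gamma (g 3) 0 = x3 at *
  generalize deriv (M.gamma (g 0)) 0 = γ0 at *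
  generalize deriv (M.gamma (g 1)) 0 = γ1 at *
  generalize deriv (M.gamma (g 2)) 0 = γ2 at *
  generalize deriv (M.gamma (g 3)) 0 = γ3 at *
  generalize deriv (M.beta (g 0)) 0 = β0 at *
  generalize deriv (M.beta (g 1)) 0 = β1 at *
  generalize deriv (M.beta (g 2)) 0 = β2 at *
  generalize deriv (M.beta (g 3)) 0 = β3 at *
  generalize d.component c 1 = P at *
  generalize d.component c 2 = Q at *
  generalize d.component c 3 = m at *
  -- After one turn the mixed derivative m returns to itself since opposite γ are inverse; the
  -- coefficients of the first derivatives Q and P cancel by the two crossing equations.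
  linear_combination (-m * x3 * x1 + Q * (β2 + x1 * γ3) - P * x3 * β1 - P * β3) * hγ20
    + (-m - Q * (x2 * β0 + β2) + P * β3) * hγ31 - Q * x2 * c1 - P * x3 * c2

theorem ker_selectRows_cornerGap [Finite K₀] {base : M.Vertex → Dart M.Ω}
    (hbase : ∀ v, M.vertexOf (base v).corner = v) :
    LinearMap.ker (M.selectRows M.cornerGap) =
      M.compatible ⊓ LinearMap.ker (M.mixedGap base) := by
  ext c
  rw [mem_ker_selectRows_cornerGap, Submodule.mem_inf, LinearMap.mem_ker]
  constructor
  · rintro ⟨h1, h2⟩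
    exact ⟨h1, funext fun h => h2 h.1 h.2.1.2⟩
  · rintro ⟨h1, h2⟩
    have hflip : ∀ h, M.cornerGap h.flip c 3 = 0 ↔ M.cornerGap h c 3 = 0 := by
      intro h
      rw [(M.cornerGap_flip h c).2.2.2, (h1 h).2.1, mul_zero, add_zero, neg_eq_zero]
    have hret : ∀ h, M.IsJoining h → ¬ M.IsOmitted base h → M.cornerGap h c 3 = 0 := by
      intro h hj ho
      cases hs : h.swap
      · exact congrFun h2 ⟨h, ⟨hs, hj⟩, ho⟩
      · rw [← hflip]
        exact congrFun h2 ⟨h.flip, ⟨by simp [OrientedGluing.flip, hs],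
          (M.isJoining_flip h).2 hj⟩, by rwa [M.isOmitted_flip]⟩
    refine ⟨h1, fun h hj => ?_⟩
    by_cases ho : M.IsOmitted base h
    · obtain ⟨v, hv, hv' | hv'⟩ := ho
      · exact M.cornerGap_omitted hbase h1 hret hv hv'
      · rw [← hflip]
        exact M.cornerGap_omitted hbase h1 hret hv (by rw [M.fromDart_flip, hv'])
    · exact hret h hj ho

/-- Exactly one of the two views of the gluing at the base of a crossing vertex has `swap = false`,
and it determines the vertex. -/
theorem card_omitted [Finite K₀] {base : M.Vertex → Dart M.Ω}
    (hbase : ∀ v, M.vertexOf (base v).corner = v) :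
    Nat.card {h : OrientedGluing K₁ // (h.swap = false ∧ M.IsJoining h) ∧ M.IsOmitted base h} =
      M.numCrossing := by
  have hat : ∀ h v, M.fromDart h = base v ∨ M.toDart h = base v →
      M.vertexOf (M.fromDart h).corner = v := by
    rintro h v (hv | hv)
    · rw [hv, hbase]
    · rw [← M.glue_toDart, M.vertexOf_glue, hv, hbase]
  have hmem : ∀ h, M.IsOmitted base h → M.IsCrossing (M.vertexOf (M.fromDart h).corner) ∧
      (M.fromDart h = base (M.vertexOf (M.fromDart h).corner) ∨
        M.fromDart h.flip = base (M.vertexOf (M.fromDart h).corner)) := by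
    rintro h ⟨v, hv, hv'⟩
    rw [hat h v hv', M.fromDart_flip]
    exact ⟨hv, hv'⟩
  refine Nat.card_eq_of_bijective (fun h => ⟨M.vertexOf (M.fromDart h.1).corner,
    (hmem h.1 h.2.2).1⟩) ⟨?_, ?_⟩
  · rintro ⟨h, ⟨hs, _⟩, ho⟩ ⟨h', ⟨hs', _⟩, ho'⟩ hvv
    have hvv' : M.vertexOf (M.fromDart h).corner = M.vertexOf (M.fromDart h').corner :=
      congrArg Subtype.val hvv
    have h1 := (hmem h ho).2
    have h2 := (hmem h' ho').2
    rw [← hvv'] at h2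
    refine Subtype.ext ?_
    have hswap : h ≠ h'.flip := fun e => by
      rw [e] at hs
      simp [OrientedGluing.flip, hs'] at hs
    rcases h1 with h1 | h1 <;> rcases h2 with h2 | h2
    · exact M.fromDart_injective (h1.trans h2.symm)
    · exact (hswap (M.fromDart_injective (h1.trans h2.symm))).elim
    · refine (hswap ?_).elim
      rw [← M.fromDart_injective (h1.trans h2.symm), h.flip_flip]
    · have h3 := congrArg OrientedGluing.flip (M.fromDart_injective (h1.trans h2.symm))
      rwa [h.flip_flip, h'.flip_flip] at h3
  · rintro ⟨v, hv⟩
    obtain ⟨h, hh⟩ := M.exists_fromDart_of_not_boundary (d := base v) (by rw [hbase]; exact hv.1)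
    have hj : M.IsJoining h := hv.2.2 h (by rw [hh, hbase])
    cases hs : h.swap
    · refine ⟨⟨h, ⟨hs, hj⟩, v, hv, Or.inl hh⟩, Subtype.ext (hat _ _ (Or.inl hh))⟩
    · have hh' : M.toDart h.flip = base v := by rw [M.toDart_flip, hh]
      exact ⟨⟨h.flip, ⟨by simp [OrientedGluing.flip, hs], (M.isJoining_flip h).2 hj⟩, v, hv,
        Or.inr hh'⟩, Subtype.ext (hat _ _ (Or.inr hh'))⟩

theorem finrank_ker_selectRows_cornerGap [Finite K₀] [Finite K₁] :
    Module.finrank ℝ (LinearMap.ker (M.selectRows M.cornerGap)) + Nat.card M.JoiningHalfEdge =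
      3 * M.numVertices + Nat.card (Σ ℓ, Fin ((M.Ω ℓ).m + 3)) + M.numCrossing := by
  classical
  obtain ⟨base, hbase⟩ := M.exists_base
  have := Fintype.ofFinite K₀
  have h1 := M.compatible.finrank_map_add_finrank_inf_ker (M.mixedGap base)
  rw [M.mixedGap_surjective hbase, finrank_top, finrank_fun_real, M.finrank_compatible,
    ← M.ker_selectRows_cornerGap hbase] at h1
  have h2 : Nat.card M.JoiningHalfEdge =
      Nat.card (M.RetainedHalfEdge base) + M.numCrossing := by
    rw [← M.card_omitted hbase]
    have e := Equiv.sumCompl fun h : M.JoiningHalfEdge => M.IsOmitted base h.1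
    rw [← Nat.card_congr e, Nat.card_sum, add_comm]
    congr 1
    · exact Nat.card_congr (Equiv.subtypeSubtypeEquivSubtypeInter _ fun h => ¬ M.IsOmitted base h)
    · exact Nat.card_congr (Equiv.subtypeSubtypeEquivSubtypeInter _ fun h => M.IsOmitted base h)
  omega

end RationalG1Surface

/-! ### Jets of tuples of polynomials -/

namespace Dart

variable {K₀ : Type*} {Ω : K₀ → ConvexPolygon}

/-- The jets of polynomials at the polygonal vertices. -/
noncomputable def cornerJets (Ω : K₀ → ConvexPolygon) :
    (K₀ → MvPolynomial (Fin 2) ℝ) →ₗ[ℝ] ((Σ ℓ, Fin ((Ω ℓ).m + 3)) → Fin 4 → ℝ) where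
  toFun g p := (⟨p.1, p.2, true⟩ : Dart Ω).jet (g p.1)
  map_add' g g' := by
    ext p i
    fin_cases i <;> simp [jet]
  map_smul' r g := by
    ext p i
    fin_cases i <;> simp [jet, MvPolynomial.smul_eval]

theorem component_cornerJets (d : Dart Ω) (g : K₀ → MvPolynomial (Fin 2) ℝ) (j : Fin 4) :
    d.component (cornerJets Ω g) j = d.jet (g d.poly) j := by
  obtain ⟨ℓ, i, b⟩ := d
  cases b
  · obtain ⟨e0, e1, e2, e3⟩ := (⟨ℓ, i, false⟩ : Dart Ω).component_other (cornerJets Ω g)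
    rw [mk_other_false] at e0 e1 e2 e3
    have h1 : ∀ j, (⟨ℓ, i + 1, true⟩ : Dart Ω).component (cornerJets Ω g) j =
      (⟨ℓ, i + 1, true⟩ : Dart Ω).jet (g ℓ) j := fun j => rfl
    rw [h1] at e0 e1 e2 e3
    have hs := (⟨ℓ, i, false⟩ : Dart Ω).other_start
    have hu := (⟨ℓ, i, false⟩ : Dart Ω).other_dirU
    have hv := (⟨ℓ, i, false⟩ : Dart Ω).other_dirV
    rw [mk_other_false] at hs hu hv
    have h2 : (⟨ℓ, i + 1, true⟩ : Dart Ω).jet (g ℓ) 3 = (⟨ℓ, i, false⟩ : Dart Ω).jet (g ℓ) 3 := by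
      simp only [jet, Matrix.cons_val, hs, hu, hv]
      rw [dirDeriv_comm]
    fin_cases j
    · exact e0.symm.trans (by simp only [jet, Matrix.cons_val, hs]; rfl)
    · exact e2.symm.trans (by simp only [jet, Matrix.cons_val, hs, hv]; rfl)
    · exact e1.symm.trans (by simp only [jet, Matrix.cons_val, hs, hu]; rfl)
    · exact e3.symm.trans h2
  · rfl

/-- Summing corner functions over the vertices of each polygon prescribes all jets independently. -/
theorem map_cornerJets (hΩ : ∀ ℓ, (Ω ℓ).IsTriangle ∨ (Ω ℓ).IsRectangle) {k : ℕ}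
    (hk : 4 ≤ k) :
    (Submodule.pi univ fun ℓ => (Ω ℓ).polySpace k).map (cornerJets Ω) = ⊤ := by
  refine Submodule.eq_top_iff'.2 fun c => ?_
  choose p hp hpc hpz using fun q : Σ ℓ, Fin ((Ω ℓ).m + 3) =>
    exists_corner_function (Ω := Ω) (hΩ q.1) hk q.2 (c q)
  refine ⟨fun ℓ => ∑ i, p ⟨ℓ, i⟩, fun ℓ _ => Submodule.sum_mem _ fun i _ => hp ⟨ℓ, i⟩, ?_⟩
  funext ⟨ℓ, i⟩
  have hlin : ∀ (s : Finset (Fin ((Ω ℓ).m + 3))) (f : Fin ((Ω ℓ).m + 3) → MvPolynomial (Fin 2) ℝ),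
      (⟨ℓ, i, true⟩ : Dart Ω).jet (∑ j ∈ s, f j) = ∑ j ∈ s, (⟨ℓ, i, true⟩ : Dart Ω).jet (f j) := by
    intro s f
    ext j
    rw [Finset.sum_apply]
    fin_cases j <;> simp [jet]
  change (⟨ℓ, i, true⟩ : Dart Ω).jet (∑ j, p ⟨ℓ, j⟩) = c ⟨ℓ, i⟩
  rw [hlin, Finset.sum_eq_single i]
  · exact hpc ⟨ℓ, i⟩
  · intro j _ hj
    exact hpz ⟨ℓ, j⟩ i hj.symm
  · simp

end Dart

/-! ### Deviation from the G¹ conditions along the edges -/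

namespace RationalG1Surface

variable {K₀ K₁ : Type*} (M : RationalG1Surface K₀ K₁)

/-- The deviation from the `G¹` conditions along an oriented edge. -/
noncomputable def edgeGap (h : OrientedGluing K₁) :
    (K₀ → MvPolynomial (Fin 2) ℝ) →ₗ[ℝ] ℝ[X] × ℝ[X] where
  toFun g :=
    ((M.fromDart h).restrict (g (M.fromDart h).poly) - (M.toDart h).restrict (g (M.toDart h).poly),
      (M.triple h).a * (M.fromDart h).restrict
          (dirDeriv (M.fromDart h).dirV (g (M.fromDart h).poly))
        - (M.triple h).b * derivative ((M.toDart h).restrict (g (M.toDart h).poly))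
        - (M.triple h).c * (M.toDart h).restrict
          (dirDeriv (M.toDart h).dirV (g (M.toDart h).poly)))
  map_add' g g' := by
    ext1 <;> simp only [Pi.add_apply, map_add, Prod.mk_add_mk] <;> ring
  map_smul' r g := by
    ext1 <;> simp only [Pi.smul_apply, map_smul, Derivation.map_smul, Prod.smul_mk, smul_sub,
      mul_smul_comm, RingHom.id_apply]

/-- Change of the direction in which an edge is run through, for the deviation from the `G¹`
conditions. -/
noncomputable def reorient (h : OrientedGluing K₁) (w : ℝ[X] × ℝ[X]) : ℝ[X] × ℝ[X] :=
  if h.back then (w.1.comp (1 - X),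
    (w.2 - C (M.src h.e).revR * (M.data h.e).a * derivative w.1).comp (1 - X)) else w

/-- The jet of the deviation from the `G¹` conditions at the starting point of an oriented
edge. -/
noncomputable def edgeJet (h : OrientedGluing K₁) :
    (K₁ → ℝ[X] × ℝ[X]) →ₗ[ℝ] (Fin 4 → ℝ) where
  toFun w := ![(M.reorient h (w h.e)).1.eval 0, (derivative (M.reorient h (w h.e)).1).eval 0,
    (M.reorient h (w h.e)).2.eval 0, (derivative (M.reorient h (w h.e)).2).eval 0]
  map_add' w w' := by
    obtain ⟨e, s, b⟩ := h
    ext i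
    cases b <;> fin_cases i <;> simp [reorient, derivative_comp] <;> ring
  map_smul' r w := by
    obtain ⟨e, s, b⟩ := h
    ext i
    cases b <;> fin_cases i <;> simp [reorient, derivative_comp] <;> ring

/-- The deviation from the `G¹` conditions along all edges. -/
noncomputable def gap : (K₀ → MvPolynomial (Fin 2) ℝ) →ₗ[ℝ] (K₁ → ℝ[X] × ℝ[X]) :=
  LinearMap.pi fun e => M.edgeGap ⟨e, false, false⟩

/-- Since `dirV` = r `dirU` + q `rev.dirV` on each side, V seen from the other end is V - r₁ a W'
with u replaced by 1 - u: the terms with r₂ cancel, and those with r₁ combine to W'. -/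
theorem reorient_gap {h : OrientedGluing K₁} (hs : h.swap = false)
    (g : K₀ → MvPolynomial (Fin 2) ℝ) : M.reorient h (M.gap g h.e) = M.edgeGap h g := by
  obtain ⟨e, s, b⟩ := h
  obtain rfl : s = false := hs
  cases b
  · rfl
  · have hsrc := congrArg (fun w => (M.src e).restrict (dirDeriv w (g (M.src e).poly)))
      (M.src e).dirV_eq
    have htgt := congrArg (fun w => (M.tgt e).restrict (dirDeriv w (g (M.tgt e).poly)))
      (M.tgt e).dirV_eq
    simp only [dirDeriv_add_dir, dirDeriv_smul_dir, map_add, map_smul,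
      ← Dart.derivative_restrict] at hsrc htgt
    have c1 := (M.src e).restrict_comp (g (M.src e).poly)
    have c2 := (M.tgt e).restrict_comp (g (M.tgt e).poly)
    have c3 := (M.src e).restrict_comp (dirDeriv (M.src e).rev.dirV (g (M.src e).poly))
    have c4 := (M.tgt e).restrict_comp (dirDeriv (M.tgt e).rev.dirV (g (M.tgt e).poly))
    have c5 := congrArg derivative c2
    rw [derivative_comp] at c5
    simp only [derivative_sub, derivative_one, derivative_X, zero_sub, neg_mul, one_mul] at c5
    refine Prod.ext ?_ ?_
    · change ((M.src e).restrict (g (M.src e).poly) - (M.tgt e).restrict (g (M.tgt e).poly)).comp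
        (1 - X) = (M.src e).rev.restrict (g (M.src e).poly)
          - (M.tgt e).rev.restrict (g (M.tgt e).poly)
      rw [sub_comp, c1, c2]
    · change ((M.data e).a * (M.src e).restrict (dirDeriv (M.src e).dirV (g (M.src e).poly))
        - (M.data e).b * derivative ((M.tgt e).restrict (g (M.tgt e).poly))
        - (M.data e).c * (M.tgt e).restrict (dirDeriv (M.tgt e).dirV (g (M.tgt e).poly))
        - C (M.src e).revR * (M.data e).a * derivative ((M.src e).restrict (g (M.src e).poly)
          - (M.tgt e).restrict (g (M.tgt e).poly))).comp (1 - X) =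
        C (M.src e).revQ * (M.data e).a.comp (1 - X) *
          (M.src e).rev.restrict (dirDeriv (M.src e).rev.dirV (g (M.src e).poly))
        - (C (M.src e).revR * (M.data e).a.comp (1 - X)
            - C (M.tgt e).revR * (M.data e).c.comp (1 - X) - (M.data e).b.comp (1 - X)) *
          derivative ((M.tgt e).rev.restrict (g (M.tgt e).poly))
        - C (M.tgt e).revQ * (M.data e).c.comp (1 - X) *
          (M.tgt e).rev.restrict (dirDeriv (M.tgt e).rev.dirV (g (M.tgt e).poly))
      rw [hsrc, htgt, ← c3, ← c4, ← c5]
      simp only [sub_comp, add_comp, mul_comp, smul_eq_C_mul, C_comp, derivative_sub]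
      ring

/-- V' at the end point contains the second derivative along the edge with the factor b(0). At a
joining end this term disappears, and the mixed jet suffices. -/
theorem edgeJet_gap {h : OrientedGluing K₁} (hs : h.swap = false)
    (g : K₀ → MvPolynomial (Fin 2) ℝ) :
    M.edgeJet h (M.gap g) 0 = M.cornerGap h (Dart.cornerJets M.Ω g) 0 ∧
    M.edgeJet h (M.gap g) 1 = M.cornerGap h (Dart.cornerJets M.Ω g) 1 ∧
    M.edgeJet h (M.gap g) 2 = M.cornerGap h (Dart.cornerJets M.Ω g) 2 ∧
    (M.IsJoining h →
      M.edgeJet h (M.gap g) 3 = M.cornerGap h (Dart.cornerJets M.Ω g) 3) := by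
  have hb : M.IsJoining h → (M.triple h).b.eval 0 = 0 := fun hj => by
    have h3 : (M.triple h).b.eval 0 / (M.triple h).a.eval 0 = 0 := hj
    simpa [(M.triple_eval_zero h).1] using h3
  simp only [edgeJet, cornerGap, LinearMap.coe_mk, AddHom.coe_mk, M.reorient_gap hs,
    Dart.component_cornerJets, edgeGap, Matrix.cons_val, Dart.jet]
  refine ⟨?_, ?_, ?_, fun hj => ?_⟩
  · simp [Dart.eval_zero_restrict]
  · simp [Dart.eval_zero_restrict, Dart.derivative_restrict]
  · simp [Dart.eval_zero_restrict, Dart.derivative_restrict]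
  · simp [Dart.eval_zero_restrict, Dart.derivative_restrict, hb hj]
    ring

theorem selectRows_edgeJet_gap (g : K₀ → MvPolynomial (Fin 2) ℝ) :
    M.selectRows M.cornerGap (Dart.cornerJets M.Ω g) = M.selectRows M.edgeJet (M.gap g) := by
  refine (M.selectRows_eq_iff _ _ _).2 ⟨fun h => ?_, fun h => ?_⟩
  · obtain ⟨h0, h1, h2, -⟩ := M.edgeJet_gap h.2 g
    exact ⟨h0.symm, h1.symm, h2.symm⟩
  · exact ((M.edgeJet_gap h.2.1 g).2.2.2 h.2.2).symm

end RationalG1Surface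

/-! ### Spline spaces as kernels -/

/-- The elements of a product of submodules. -/
def Submodule.piUnivEquiv {ι : Type*} {V : ι → Type*} [∀ i, AddCommGroup (V i)]
    [∀ i, Module ℝ (V i)] (p : ∀ i, Submodule ℝ (V i)) :
    Submodule.pi univ p ≃ₗ[ℝ] ∀ i, p i where
  toFun x i := ⟨x.1 i, x.2 i (mem_univ i)⟩
  invFun x := ⟨fun i => x i, fun i _ => (x i).2⟩
  map_add' _ _ := rfl
  map_smul' _ _ := rfl
  left_inv _ := rfl
  right_inv _ := rfl

/-- The elements of the product of two submodules. -/
def Submodule.prodElemEquiv {V W : Type*} [AddCommGroup V] [Module ℝ V] [AddCommGroup W]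
    [Module ℝ W] (p : Submodule ℝ V) (q : Submodule ℝ W) : p.prod q ≃ₗ[ℝ] p × q where
  toFun x := (⟨x.1.1, x.2.1⟩, ⟨x.1.2, x.2.2⟩)
  invFun x := ⟨(x.1.1, x.2.1), x.1.2, x.2.2⟩
  map_add' _ _ := rfl
  map_smul' _ _ := rfl
  left_inv _ := rfl
  right_inv _ := rfl

theorem Polynomial.eq_zero_of_eval_Icc {p : ℝ[X]} (h : ∀ t ∈ Icc (0 : ℝ) 1, p.eval t = 0) :
    p = 0 :=
  Polynomial.eq_zero_of_infinite_isRoot p ((Icc_infinite zero_lt_one).mono h)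

/-! ### The spline space as a kernel, and the target space -/

namespace RationalG1Surface

variable {K₀ K₁ : Type*} (M : RationalG1Surface K₀ K₁)

/-- As a has no zero on [0, 1], clearing denominators is an equivalence; a polynomial vanishing on
[0, 1] is zero. -/
theorem splineSpace_eq (k : ℕ) :
    M.splineSpace k =
      Submodule.pi univ (fun ℓ => (M.Ω ℓ).polySpace k) ⊓ LinearMap.ker M.gap := by
  ext g
  have hgap : M.gap g = 0 ↔ ∀ e,
      (M.src e).restrict (g (M.src e).poly) - (M.tgt e).restrict (g (M.tgt e).poly) = 0 ∧
      (M.data e).a * (M.src e).restrict (dirDeriv (M.src e).dirV (g (M.src e).poly))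
        - (M.data e).b * derivative ((M.tgt e).restrict (g (M.tgt e).poly))
        - (M.data e).c * (M.tgt e).restrict (dirDeriv (M.tgt e).dirV (g (M.tgt e).poly)) = 0 :=
    ⟨fun h e => ⟨congrArg Prod.fst (congrFun h e), congrArg Prod.snd (congrFun h e)⟩,
      fun h => funext fun e => Prod.ext (h e).1 (h e).2⟩
  rw [Submodule.mem_inf, LinearMap.mem_ker, hgap]
  refine and_congr ⟨fun h ℓ _ => h ℓ, fun h ℓ => h ℓ (mem_univ ℓ)⟩ ?_
  have hsmooth : ∀ ℓ, ∃ U, IsOpen U ∧ (M.Ω ℓ).carrier ⊆ U ∧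
      ContDiffOn ℝ 1 (fun x => MvPolynomial.eval x (g ℓ)) U := fun ℓ =>
    ⟨univ, isOpen_univ, subset_univ _, (contDiff_mvPolynomial_eval _).contDiffOn⟩
  rw [RationalGluing.IsG1Function, and_iff_right hsmooth]
  refine forall_congr' fun e => ?_
  have hpt : ∀ t ∈ Icc (0 : ℝ) 1,
      (lineDeriv ℝ (fun x => MvPolynomial.eval x (g (M.src e).poly)) ((M.src e).point t)
        (M.src e).dirV = (M.data e).beta t *
          lineDeriv ℝ (fun x => MvPolynomial.eval x (g (M.tgt e).poly)) ((M.tgt e).point t)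
            (M.tgt e).dirU +
        (M.data e).gamma t *
          lineDeriv ℝ (fun x => MvPolynomial.eval x (g (M.tgt e).poly)) ((M.tgt e).point t)
            (M.tgt e).dirV) ↔
      eval t ((M.data e).a * (M.src e).restrict (dirDeriv (M.src e).dirV (g (M.src e).poly))
        - (M.data e).b * derivative ((M.tgt e).restrict (g (M.tgt e).poly))
        - (M.data e).c * (M.tgt e).restrict (dirDeriv (M.tgt e).dirV (g (M.tgt e).poly))) = 0 := by
    intro t ht
    have ha := M.denom_ne_zero e t ht
    rw [lineDeriv_eval, lineDeriv_eval, lineDeriv_eval, GluingTriple.beta, GluingTriple.gamma]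
    simp only [eval_sub, eval_mul, Dart.derivative_restrict, Dart.eval_restrict]
    field_simp
    constructor <;> intro h <;> linarith
  constructor
  · intro h
    refine ⟨Polynomial.eq_zero_of_eval_Icc fun t ht => ?_,
      Polynomial.eq_zero_of_eval_Icc fun t ht => (hpt t ht).1 (h t ht).2⟩
    rw [eval_sub, Dart.eval_restrict, Dart.eval_restrict]
    exact sub_eq_zero.2 (h t ht).1
  · rintro ⟨h1, h2⟩ t ht
    refine ⟨?_, (hpt t ht).2 (by rw [h2, eval_zero])⟩
    have h3 := congrArg (eval t) h1
    rw [eval_sub, Dart.eval_restrict, Dart.eval_restrict, eval_zero] at h3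
    exact sub_eq_zero.1 h3

/-- Pairs of polynomials of degree at most `k` along all edges. -/
noncomputable def edgeSpace (K₁ : Type*) (k : ℕ) : Submodule ℝ (K₁ → ℝ[X] × ℝ[X]) :=
  Submodule.pi univ fun _ => (degreeLT ℝ (k + 1)).prod (degreeLT ℝ (k + 1))

theorem mem_edgeSpace {k : ℕ} {w : K₁ → ℝ[X] × ℝ[X]} :
    w ∈ edgeSpace K₁ k ↔ ∀ e, (w e).1.natDegree ≤ k ∧ (w e).2.natDegree ≤ k := by
  have h : ∀ p : ℝ[X], p ∈ degreeLT ℝ (k + 1) ↔ p.natDegree ≤ k := fun p => by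
    rw [mem_degreeLT, degree_lt_iff_coeff_zero, natDegree_le_iff_coeff_eq_zero]
    rfl
  simp only [edgeSpace, Submodule.mem_pi, mem_univ, true_imp_iff, Submodule.mem_prod, h]

theorem finrank_edgeSpace (K₁ : Type*) [Finite K₁] (k : ℕ) :
    FiniteDimensional ℝ (edgeSpace K₁ k) ∧
      Module.finrank ℝ (edgeSpace K₁ k) = Nat.card K₁ * (2 * (k + 1)) := by
  have := Fintype.ofFinite K₁
  have e := (Submodule.piUnivEquiv fun _ : K₁ =>
    (degreeLT ℝ (k + 1)).prod (degreeLT ℝ (k + 1))).trans (LinearEquiv.piCongrRight fun _ =>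
      (Submodule.prodElemEquiv _ _).trans
        ((degreeLTEquiv ℝ (k + 1)).prodCongr (degreeLTEquiv ℝ (k + 1))))
  have h2 := e.finrank_eq
  have h1 : FiniteDimensional ℝ (edgeSpace K₁ k) := Module.Finite.equiv e.symm
  refine ⟨h1, h2.trans ?_⟩
  simp [Module.finrank_pi_fintype, Nat.card_eq_fintype_card, two_mul]

theorem rectIndicator_revR {Ω : K₀ → ConvexPolygon}
    (hΩ : ∀ ℓ, (Ω ℓ).IsTriangle ∨ (Ω ℓ).IsRectangle) (d : Dart Ω) :
    (Ω d.poly).rectIndicator = 1 ∧ d.revR = 0 ∧ (Ω d.poly).IsRectangle ∨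
      (Ω d.poly).rectIndicator = 0 ∧ d.revR = 1 ∧ (Ω d.poly).IsTriangle := by
  classical
  rcases hΩ d.poly with h | h
  · exact Or.inr ⟨if_neg h.not_isRectangle, Dart.revR_triangle h, h⟩
  · exact Or.inl ⟨if_pos h, Dart.revR_rectangle h, h⟩

/-- The transverse derivative has degree at most k - 1 + r_j, and δ = 1 bounds the degree of its
factor a or c by 1 - r_j. The factor b is at most linear and multiplies a tangential derivative of
degree at most k - 1. -/
theorem gap_mem_edgeSpace (hΩ : ∀ ℓ, (M.Ω ℓ).IsTriangle ∨ (M.Ω ℓ).IsRectangle)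
    (hδ : ∀ e, M.delta e = 1) {k : ℕ} (hk : 6 ≤ k) :
    (Submodule.pi univ fun ℓ => (M.Ω ℓ).polySpace k).map M.gap ≤ edgeSpace K₁ k := by
  rintro _ ⟨g, hg, rfl⟩
  refine mem_edgeSpace.2 fun e => ?_
  have hle := (hδ e).le
  simp only [RationalGluing.delta, max_le_iff] at hle
  obtain ⟨⟨ha, hb⟩, hc⟩ := hle
  have hg' : ∀ d : Dart M.Ω, g d.poly ∈ (M.Ω d.poly).polySpace k := fun d => hg d.poly (mem_univ _)
  have hr : ∀ d : Dart M.Ω, (d.restrict (g d.poly)).natDegree ≤ k := fun d =>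
    Dart.natDegree_restrict_le (hΩ _) (hg' d)
  have hn : ∀ (d : Dart M.Ω) (p : ℝ[X]), (M.Ω d.poly).rectIndicator + p.natDegree ≤ 1 →
      (p * d.restrict (dirDeriv d.dirV (g d.poly))).natDegree ≤ k := by
    intro d p hp
    refine natDegree_mul_le.trans ?_
    obtain ⟨h1, h2⟩ := Dart.natDegree_restrict_dirDeriv_le (hg' d) d.dirV
    rcases rectIndicator_revR hΩ d with ⟨h3, -, h4⟩ | ⟨h3, -, h4⟩
    · have := h2 h4
      omega
    · have := h1 h4
      omega
  have hd := (natDegree_derivative_le ((M.tgt e).restrict (g (M.tgt e).poly))).trans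
    (Nat.sub_le_sub_right (hr (M.tgt e)) 1)
  have hb' : ((M.data e).b * derivative ((M.tgt e).restrict (g (M.tgt e).poly))).natDegree ≤ k :=
    natDegree_mul_le.trans (by omega)
  exact ⟨(natDegree_sub_le_of_le (hr (M.src e)) (hr (M.tgt e))).trans (max_self k).le,
    (natDegree_sub_le_of_le ((natDegree_sub_le_of_le (hn (M.src e) _ ha) hb').trans
      (max_self k).le) (hn (M.tgt e) _ hc)).trans (max_self k).le⟩

theorem map_selectRows_edgeJet {k : ℕ} (hk : 6 ≤ k) :
    (edgeSpace K₁ k).map (M.selectRows M.edgeJet) = ⊤ := by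
  classical
  refine Submodule.eq_top_iff'.2 fun f => ?_
  let f₁ : K₁ → Bool → Fin 3 → ℝ := fun e b => f.1 ⟨⟨e, false, b⟩, rfl⟩
  let f₂ : K₁ → Bool → ℝ := fun e b =>
    if hj : M.IsJoining ⟨e, false, b⟩ then f.2 ⟨⟨e, false, b⟩, rfl, hj⟩ else 0
  choose W hWd hW0 hW0' hW1 hW1' using fun e =>
    exists_hermite (f₁ e false 0) (f₁ e false 1) (f₁ e true 0) (-f₁ e true 1)
  -- The term that `reorient` subtracts from V at the far end. W is chosen first, so U can be
  -- compensated in the data for V; the derivatives at 1 change sign because of u ↦ 1 - u.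
  let U : K₁ → ℝ[X] := fun e => C (M.src e).revR * (M.data e).a * derivative (W e)
  choose V hVd hV0 hV0' hV1 hV1' using fun e =>
    exists_hermite (f₁ e false 2) (f₂ e false) (f₁ e true 2 + (U e).eval 1)
      (-f₂ e true + (derivative (U e)).eval 1)
  refine ⟨fun e => (W e, V e), mem_edgeSpace.2 fun e =>
    ⟨(hWd e).trans (by omega), (hVd e).trans (by omega)⟩, ?_⟩
  rw [M.selectRows_eq_iff]
  constructor
  · rintro ⟨⟨e, s, b⟩, hs⟩
    obtain rfl : s = false := hs
    cases b
    · exact ⟨hW0 e, hW0' e, hV0 e⟩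
    · simp only [edgeJet, reorient, LinearMap.coe_mk, AddHom.coe_mk, Matrix.cons_val, if_true]
      refine ⟨?_, ?_, ?_⟩
      · simp [hW1, f₁]
      · simp [derivative_comp, hW1', f₁]
      · change ((V e - U e).comp (1 - X)).eval 0 = _
        simp [hV1, f₁]
  · rintro ⟨⟨e, s, b⟩, hs, hj⟩
    obtain rfl : s = false := hs
    cases b
    · change (derivative (V e)).eval 0 = _
      rw [hV0']
      exact dif_pos hj
    · change (derivative ((V e - U e).comp (1 - X))).eval 0 = _
      simp only [derivative_comp, derivative_sub, derivative_one, derivative_X, zero_sub, neg_mul,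
        one_mul, eval_neg, eval_comp, eval_sub, eval_one, eval_X, sub_zero, hV1']
      rw [show f₂ e true = f.2 ⟨⟨e, false, true⟩, rfl, hj⟩ from dif_pos hj]
      ring

end RationalG1Surface

theorem Dart.restrict_single_eq_zero {K₀ : Type*} [DecidableEq K₀] {Ω : K₀ → ConvexPolygon}
    {D : Dart Ω} {g : MvPolynomial (Fin 2) ℝ}
    (hg : ∀ (j : Fin ((Ω D.poly).m + 3)) (b : Bool) (w : Plane), j ≠ D.idx →
      (⟨D.poly, j, b⟩ : Dart Ω).restrict g = 0 ∧
      (⟨D.poly, j, b⟩ : Dart Ω).restrict (dirDeriv w g) = 0)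
    {d : Dart Ω} (hd : d.edge ≠ D.edge) (w : Plane) :
    d.restrict ((Pi.single D.poly g : K₀ → MvPolynomial (Fin 2) ℝ) d.poly) = 0 ∧
    d.restrict (dirDeriv w ((Pi.single D.poly g : K₀ → MvPolynomial (Fin 2) ℝ) d.poly)) = 0 := by
  obtain ⟨ℓ, j, b⟩ := d
  obtain ⟨ℓ', i, b'⟩ := D
  by_cases h : ℓ = ℓ'
  · subst h
    simp only [Pi.single_eq_same]
    exact hg j b w fun hj => hd (by rw [Dart.edge, Dart.edge]; exact congrArg (Sigma.mk ℓ) hj)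
  · simp only [Pi.single_eq_of_ne h, map_zero, and_self]

/-! ### Solving along single edges, and counting -/

namespace RationalG1Surface

variable {K₀ K₁ : Type*} (M : RationalG1Surface K₀ K₁)

theorem gap_apply (g : K₀ → MvPolynomial (Fin 2) ℝ) (e : K₁) :
    M.gap g e =
      ((M.src e).restrict (g (M.src e).poly) - (M.tgt e).restrict (g (M.tgt e).poly),
      (M.data e).a * (M.src e).restrict (dirDeriv (M.src e).dirV (g (M.src e).poly))
        - (M.data e).b * derivative ((M.tgt e).restrict (g (M.tgt e).poly))
        - (M.data e).c * (M.tgt e).restrict (dirDeriv (M.tgt e).dirV (g (M.tgt e).poly))) := rfl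

open Classical in
/-- Deviations with vanishing jets are attained along each edge separately. -/
theorem exists_gap_eq_single (hΩ : ∀ ℓ, (M.Ω ℓ).IsTriangle ∨ (M.Ω ℓ).IsRectangle)
    (hδ : ∀ e, M.delta e = 1) {k : ℕ} (hk : 6 ≤ k) {w : K₁ → ℝ[X] × ℝ[X]}
    (hw : w ∈ edgeSpace K₁ k) (h0 : M.selectRows M.edgeJet w = 0) (e : K₁) :
    ∃ g ∈ Submodule.pi univ fun ℓ => (M.Ω ℓ).polySpace k, M.gap g = Pi.single e (w e) := by
  obtain ⟨hr, hj⟩ := (M.selectRows_eq_iff _ _ _).1 h0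
  obtain ⟨hW0, hW0', hV0⟩ := hr ⟨⟨e, false, false⟩, rfl⟩
  obtain ⟨hW1, hW1', hV1⟩ := hr ⟨⟨e, false, true⟩, rfl⟩
  have hV0' := fun h : M.IsJoining ⟨e, false, false⟩ => hj ⟨⟨e, false, false⟩, rfl, h⟩
  have hV1' := fun h : M.IsJoining ⟨e, false, true⟩ => hj ⟨⟨e, false, true⟩, rfl, h⟩
  simp only [edgeJet, reorient, LinearMap.coe_mk, AddHom.coe_mk, Matrix.cons_val, if_true,
    Bool.false_eq_true, if_false, derivative_comp, derivative_sub, derivative_one, derivative_X,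
    zero_sub, neg_mul, one_mul, eval_neg, eval_comp, eval_sub, eval_one, eval_X, sub_zero,
    eval_mul, eval_C, derivative_mul, derivative_C, zero_mul, zero_add, eval_add, neg_eq_zero,
    Prod.fst_zero, Prod.snd_zero, Pi.zero_apply] at hW0 hW0' hV0 hW1 hW1' hV1 hV0' hV1'
  rw [hW1', mul_zero, sub_zero] at hV1
  rw [hW1', mul_zero, zero_add] at hV1'
  obtain ⟨hWd, hVd⟩ := mem_edgeSpace.1 hw e
  have hrR : ∀ d : Dart M.Ω, (M.Ω d.poly).rectIndicator = 1 ∧ d.revR = 0 ∨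
      (M.Ω d.poly).rectIndicator = 0 ∧ d.revR = 1 := fun d =>
    (rectIndicator_revR hΩ d).imp (fun h => ⟨h.1, h.2.1⟩) fun h => ⟨h.1, h.2.1⟩
  obtain ⟨p₁, p₂, q₁, q₂, hp₁, hp₂, hq₁, hq₂, hW, hV⟩ := exists_edge_data hk (hrR (M.src e))
    (hrR (M.tgt e)) (hδ e) (M.coprime e) (M.denom_ne_zero e) (fun t ht => M.eval_c_ne_zero e ht)
    hWd hVd hW0 hW0' hW1 hW1' hV0 (fun hb => hV0' (by
      change (M.data e).b.eval 0 / (M.data e).a.eval 0 = 0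
      rw [hb, zero_div])) hV1 (fun hb => by
      have h1 := hV1' (by
        change (C (M.src e).revR * (M.data e).a.comp (1 - X)
          - C (M.tgt e).revR * (M.data e).c.comp (1 - X) - (M.data e).b.comp (1 - X)).eval 0 /
          (C (M.src e).revQ * (M.data e).a.comp (1 - X)).eval 0 = 0
        simp [hb])
      linarith)
  obtain ⟨g₁, hg₁, hr₁, hd₁, hz₁⟩ := Dart.exists_edge_function (hΩ (M.src e).poly) hp₁ hq₁
  obtain ⟨g₂, hg₂, hr₂, hd₂, hz₂⟩ := Dart.exists_edge_function (hΩ (M.tgt e).poly) hp₂ hq₂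
  have hmem : ∀ (ℓ : K₀) (g : MvPolynomial (Fin 2) ℝ), g ∈ (M.Ω ℓ).polySpace k →
      (Pi.single ℓ g : K₀ → MvPolynomial (Fin 2) ℝ) ∈
        Submodule.pi univ fun ℓ => (M.Ω ℓ).polySpace k := by
    intro ℓ g hg ℓ' _
    by_cases h : ℓ' = ℓ
    · subst h
      rwa [Pi.single_eq_same]
    · rw [Pi.single_eq_of_ne h]
      exact Submodule.zero_mem _
  refine ⟨Pi.single (M.src e).poly g₁ + Pi.single (M.tgt e).poly g₂,
    Submodule.add_mem _ (hmem _ _ hg₁) (hmem _ _ hg₂), funext fun e' => ?_⟩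
  -- The two edge functions vanish doubly on all sides except `src e` and `tgt e`, respectively. As
  -- no polygonal edge is used twice, other gluings see nothing, even if both sides of e belong to
  -- the same polygon.
  have hst : ∀ e e', (M.src e).edge ≠ (M.tgt e').edge := fun e e' h =>
    Sum.inl_ne_inr (M.paired_once (a₁ := Sum.inl e) (a₂ := Sum.inr e') h)
  have s2 := fun w => Dart.restrict_single_eq_zero hz₂ (hst e' e) w
  have t1 := fun w => Dart.restrict_single_eq_zero hz₁ (hst e e').symm w
  rw [gap_apply]
  simp only [Pi.add_apply, map_add, (s2 0).1, (s2 _).2, (t1 0).1, (t1 _).2, add_zero, zero_add]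
  by_cases he : e' = e
  · subst he
    simp only [Pi.single_eq_same, hr₁, hr₂, hd₁, hd₂]
    exact Prod.ext hW.symm hV.symm
  · have hss : (M.src e').edge ≠ (M.src e).edge := fun h =>
      he (Sum.inl_injective (M.paired_once (a₁ := Sum.inl e') (a₂ := Sum.inl e) h))
    have htt : (M.tgt e').edge ≠ (M.tgt e).edge := fun h =>
      he (Sum.inr_injective (M.paired_once (a₁ := Sum.inr e') (a₂ := Sum.inr e) h))
    have s1 := fun w => Dart.restrict_single_eq_zero hz₁ hss w
    have t2 := fun w => Dart.restrict_single_eq_zero hz₂ htt w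
    simp only [(s1 0).1, (s1 _).2, (t2 0).1, (t2 _).2, Pi.single_eq_of_ne he]
    simp

theorem mem_map_gap [Finite K₁] (hΩ : ∀ ℓ, (M.Ω ℓ).IsTriangle ∨ (M.Ω ℓ).IsRectangle)
    (hδ : ∀ e, M.delta e = 1) {k : ℕ} (hk : 6 ≤ k) {w : K₁ → ℝ[X] × ℝ[X]}
    (hw : w ∈ edgeSpace K₁ k) (h0 : M.selectRows M.edgeJet w = 0) :
    w ∈ (Submodule.pi univ fun ℓ => (M.Ω ℓ).polySpace k).map M.gap := by
  classical
  have := Fintype.ofFinite K₁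
  rw [← Finset.univ_sum_single w]
  refine Submodule.sum_mem _ fun e _ => ?_
  obtain ⟨g, hg, he⟩ := M.exists_gap_eq_single hΩ hδ hk hw h0 e
  refine ⟨g, hg, he.trans ?_⟩
  congr!

/-! ### Counting -/

/-- The index type of the corners is also that of the polygonal edges, of which each gluing uses
two. -/
theorem card_corners [Finite K₀] [Finite K₁] :
    Nat.card (Σ ℓ, Fin ((M.Ω ℓ).m + 3)) = 2 * Nat.card K₁ + M.numBoundaryEdges := by
  classical
  have := Fintype.ofFinite K₀
  rw [← Nat.card_congr (Equiv.sumCompl fun ε => ε ∈ Set.range (Sum.elim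
    (fun e => (M.src e).edge) (fun e => (M.tgt e).edge))), Nat.card_sum,
    ← Nat.card_congr (Equiv.ofInjective _ M.paired_once), Nat.card_sum, two_mul]
  congr 1
  refine Nat.card_congr (Equiv.subtypeEquivRight fun ε => ?_)
  simp [LinearG0Surface.IsBoundaryEdge, forall_and, eq_comm]

theorem sum_polygons [Fintype K₀] (hΩ : ∀ ℓ, (M.Ω ℓ).IsTriangle ∨ (M.Ω ℓ).IsRectangle)
    {f : K₀ → ℕ} {α β : ℕ} (hα : ∀ ℓ, (M.Ω ℓ).IsTriangle → f ℓ = α)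
    (hβ : ∀ ℓ, (M.Ω ℓ).IsRectangle → f ℓ = β) :
    ∑ ℓ, f ℓ = M.numTriangles * α + M.numRectangles * β := by
  classical
  have hnot : ∀ ℓ, (M.Ω ℓ).IsRectangle ↔ ¬ (M.Ω ℓ).IsTriangle := fun ℓ =>
    ⟨fun h => h.not_isTriangle, fun h => (hΩ ℓ).resolve_left h⟩
  rw [← Finset.sum_filter_add_sum_filter_not Finset.univ fun ℓ => (M.Ω ℓ).IsTriangle,
    LinearG0Surface.numTriangles, LinearG0Surface.numRectangles, Nat.card_eq_fintype_card,
    Nat.card_eq_fintype_card, Fintype.card_subtype, Fintype.card_subtype,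
    Finset.sum_congr rfl fun ℓ hℓ => hα ℓ (Finset.mem_filter.1 hℓ).2,
    Finset.sum_congr rfl fun ℓ hℓ => hβ ℓ ((hnot ℓ).2 (Finset.mem_filter.1 hℓ).2)]
  simp only [hnot, Finset.sum_const, smul_eq_mul]

theorem card_halfEdge (K₁ : Type*) : Nat.card (HalfEdge K₁) = 2 * Nat.card K₁ := by
  have e : HalfEdge K₁ ≃ K₁ × Bool :=
    { toFun := fun h => (h.1.e, h.1.back)
      invFun := fun p => ⟨⟨p.1, false, p.2⟩, rfl⟩
      left_inv := by
        rintro ⟨⟨e, s, b⟩, hs⟩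
        obtain rfl : s = false := hs
        rfl
      right_inv := fun _ => rfl }
  rw [Nat.card_congr e, Nat.card_prod, Nat.card_eq_fintype_card (α := Bool), Fintype.card_bool,
    mul_comm]

/-- `Submodule.finrank_inf_ker_add` applied to the square of `gap` and `cornerGap`, doubled to keep
the dimension for triangles integral. -/
theorem finrank_splineSpace [Finite K₀] [Finite K₁]
    (hΩ : ∀ ℓ, (M.Ω ℓ).IsTriangle ∨ (M.Ω ℓ).IsRectangle)
    (hδ : ∀ e, M.delta e = 1) {k : ℕ} (hk : 6 ≤ k) :
    FiniteDimensional ℝ (M.splineSpace k) ∧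
    2 * (Module.finrank ℝ (M.splineSpace k) + Nat.card K₁ * (2 * (k + 1)) +
      Nat.card (Σ ℓ, Fin ((M.Ω ℓ).m + 3)) * 4) =
    M.numTriangles * ((k + 1) * (k + 2)) + M.numRectangles * (2 * (k + 1) ^ 2) +
      2 * (2 * Nat.card K₁ * 3 + Nat.card M.JoiningHalfEdge +
        Module.finrank ℝ (LinearMap.ker (M.selectRows M.cornerGap))) := by
  classical
  have := Fintype.ofFinite K₀
  have hfin : ∀ ℓ, FiniteDimensional ℝ ((M.Ω ℓ).polySpace k) := fun ℓ =>
    Dart.finite_polySpace (hΩ ℓ) k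
  have e := Submodule.piUnivEquiv fun ℓ => (M.Ω ℓ).polySpace k
  have hX : FiniteDimensional ℝ (Submodule.pi univ fun ℓ => (M.Ω ℓ).polySpace k) :=
    Module.Finite.equiv e.symm
  obtain ⟨hE, hEd⟩ := finrank_edgeSpace K₁ k
  have h := Submodule.finrank_inf_ker_add (Submodule.pi univ fun ℓ => (M.Ω ℓ).polySpace k)
    (edgeSpace K₁ k) M.gap (Dart.cornerJets M.Ω) (M.selectRows M.edgeJet)
    (M.selectRows M.cornerGap) (M.gap_mem_edgeSpace hΩ hδ hk) M.selectRows_edgeJet_gap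
    (Dart.map_cornerJets hΩ (by omega)) (M.map_selectRows_edgeJet hk)
    fun w hw h0 => M.mem_map_gap hΩ hδ hk hw h0
  rw [hEd, finrank_fun_fin_real, Module.finrank_prod, finrank_fun_fin_real, finrank_fun_real,
    card_halfEdge, e.finrank_eq, Module.finrank_pi_fintype, ← M.splineSpace_eq] at h
  have hs := M.sum_polygons hΩ (f := fun ℓ => 2 * Module.finrank ℝ ((M.Ω ℓ).polySpace k))
    (fun ℓ hℓ => Dart.finrank_polySpace_triangle hℓ k)
    (fun ℓ hℓ => congrArg (2 * ·) (Dart.finrank_polySpace_rectangle hℓ k))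
  rw [← Finset.mul_sum] at hs
  refine ⟨?_, ?_⟩
  · rw [M.splineSpace_eq]
    exact Submodule.finiteDimensional_inf_left _ _
  · rw [h, ← hs]
    ring

end RationalG1Surface

/-! ### The dimension formula -/

theorem mainTheorem6 {K₀ K₁ : Type*} [Finite K₀] [Finite K₁]
    (M : RationalG1Surface K₀ K₁)
    (hM : ∀ ℓ, (M.Ω ℓ).IsTriangle ∨ (M.Ω ℓ).IsRectangle)
    (hδ : ∀ e, M.delta e = 1) (k : ℕ) (hk : 6 ≤ k) :
    FiniteDimensional ℝ (M.splineSpace k) ∧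
    (Module.finrank ℝ (M.splineSpace k) : ℝ) =
      3 * (M.numVertices : ℝ) + (M.numCrossing : ℝ) + ((k : ℝ) - 2) * (M.numBoundaryEdges : ℝ)
        + ((k : ℝ) + 1) * (((k : ℝ) - 3) * (M.numRectangles : ℝ)
            + ((k : ℝ) - 4) / 2 * (M.numTriangles : ℝ)) := by
  have := Fintype.ofFinite K₀
  obtain ⟨hfin, h1⟩ := M.finrank_splineSpace hM hδ hk
  refine ⟨hfin, ?_⟩
  have h2 := M.finrank_ker_selectRows_cornerGap
  have h3 := M.card_corners
  have h4 := M.sum_polygons hM (f := fun ℓ => (M.Ω ℓ).m + 3) (α := 3) (β := 4)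
    (fun ℓ hℓ => by rw [show (M.Ω ℓ).m = 0 from hℓ]) (fun ℓ hℓ => by rw [hℓ.1])
  have h5 : Nat.card (Σ ℓ, Fin ((M.Ω ℓ).m + 3)) = ∑ ℓ, ((M.Ω ℓ).m + 3) := by
    rw [Nat.card_sigma]
    simp
  rw [← h5] at h4
  have h1 := congrArg (Nat.cast (R := ℝ)) h1
  have h2 := congrArg (Nat.cast (R := ℝ)) h2
  have h3 := congrArg (Nat.cast (R := ℝ)) h3
  have h4 := congrArg (Nat.cast (R := ℝ)) h4
  push_cast at h1 h2 h3 h4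
  -- Adding `h2` cancels the joining half edges. The number of gluings then has coefficient -2(k -
  -- 2) and is eliminated by `h3`; this leaves the corners with coefficient -(k + 1), and `h4`
  -- expresses them by triangles and rectangles.
  linear_combination h1 / 2 + h2 + ((k : ℝ) - 2) * h3 - ((k : ℝ) + 1) * h4
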